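/- Let $K$ be an algebraically closed field of characteristic $p>2$, let $n\ge 1$, and let $\mathfrak g=\mathfrak q(n)=\mathfrak g_{\bar 0}\oplus\mathfrak g_{\bar 1}$ be the queer Lie superalgebra of all $2n\times 2n$ matrices $\begin{pmatrix}A&B\\B&A\end{pmatrix}$ over $K$ ($A,B$ arbitrary $n\times n$ matrices; $B=0$ for even and $A=0$ for odd elements) with the supercommutator as bracket. Its even part $\mathfrak g_{\bar 0}\cong\mathfrak{gl}(n)$ carries the $p$-th power map $x\mapsto x^{[p]}$ given by the $p$-th power of matrices. Let $\mathfrak n^{+}_{\bar 0}$ (respectively $\mathfrak n^{-}_{\bar 0}$) be the space of even elements with $A$ strictly upper (respectively strictly lower) triangular, and let $h_i\in\mathfrak g_{\bar 0}$ be the even element for which $A$ is the $i$-th diagonal matrix unit, $1\le i\le n$. For $\chi\in\mathfrak g_{\bar 0}^*$ let $U_\chi(\mathfrak g)$ be the quotient of the universal enveloping superalgebra $U(\mathfrak g)$ by the ideal generated by all $x^p-x^{[p]}-\chi(x)^p$ with $x\in\mathfrak g_{\bar 0}$. Call $\chi$ semisimple if it is $GL(n)$-conjugate to a linear form vanishing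 on $\mathfrak n^+_{\bar 0}$ and $\mathfrak n^-_{\bar 0}$. Let $\chi\in\mathfrak g_{\bar 0}^*$ be semisimple with $\chi(\mathfrak n^+_{\bar 0})=\chi(\mathfrak n^-_{\bar 0})=0$. Then the superalgebra $U_\chi(\mathfrak g)$ is semisimple (that is, every $\mathbb Z/2$-graded left ideal has a $\mathbb Z/2$-graded left ideal as a complement) if and only if $\chi(h_i)\ne 0$ for all $1\le i\le n$ and $\chi(h_i)\ne\pm\chi(h_j)$ for all $1\le i\ne j\le n$. -/

import Mathlib

open scoped DirectSum

noncomputable section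

namespace QueerSuper

variable (K : Type*) [Field K] (n : ℕ)

/-- The superspace `q(n)`: all block matrices `(A B; B A)` with `A`, `B` arbitrary `n × n` matrices.
It is closed under matrix multiplication, and is recorded here as a subalgebra of the
`2n × 2n` matrices; its Lie superbracket is the supercommutator. -/
def queer : Subalgebra K (Matrix (Fin n ⊕ Fin n) (Fin n ⊕ Fin n) K) where
  carrier := {X | ∃ A B : Matrix (Fin n) (Fin n) K, X = Matrix.fromBlocks A B B A}
  mul_mem' := by
    rintro _ _ ⟨A, B, rfl⟩ ⟨A', B', rfl⟩
    refine ⟨A * A' + B * B', A * B' + B * A', ?_⟩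
    rw [Matrix.fromBlocks_multiply, add_comm (B * A'), add_comm (B * B')]
  add_mem' := by
    rintro _ _ ⟨A, B, rfl⟩ ⟨A', B', rfl⟩
    exact ⟨A + A', B + B', Matrix.fromBlocks_add ..⟩
  algebraMap_mem' := by
    intro r
    refine ⟨Matrix.diagonal fun _ => r, 0, ?_⟩
    rw [Matrix.fromBlocks_diagonal, Matrix.algebraMap_eq_diagonal]
    congr 1
    ext i
    rcases i with i | i <;> rfl

/-- The even element `(A 0; 0 A)` of `q(n)`. -/
def evenElt : Matrix (Fin n) (Fin n) K →ₗ[K] queer K n where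
  toFun A := ⟨Matrix.fromBlocks A 0 0 A, A, 0, rfl⟩
  map_add' A A' := Subtype.ext (by simp [Matrix.fromBlocks_add])
  map_smul' c A := Subtype.ext (by simp [Matrix.fromBlocks_smul])

/-- The odd element `(0 B; B 0)` of `q(n)`. -/
def oddElt : Matrix (Fin n) (Fin n) K →ₗ[K] queer K n where
  toFun B := ⟨Matrix.fromBlocks 0 B B 0, 0, B, rfl⟩
  map_add' A A' := Subtype.ext (by simp [Matrix.fromBlocks_add])
  map_smul' c A := Subtype.ext (by simp [Matrix.fromBlocks_smul])

/-- The even part (`i = 0`) and the odd part (`i = 1`) of `q(n)`. -/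
def queerPart (i : ZMod 2) : Submodule K (queer K n) :=
  if i = 0 then LinearMap.range (evenElt K n) else LinearMap.range (oddElt K n)

/-- The sign `(-1) ^ (|x| |y|)` for homogeneous elements of parities `i`, `j`. -/
def sign (i j : ZMod 2) : K := (-1) ^ (i.val * j.val)

variable {K n} in
/-- The Lie superbracket `[x, y] = x y - (-1) ^ (|x| |y|) y x` of homogeneous elements `x`, `y`
of parities `i`, `j` of `q(n)`, inside `gl(n|n)`. -/
def superBracket (i j : ZMod 2) (x y : queer K n) : queer K n :=
  x * y - sign K i j • (y * x)

/-- The defining relations of the universal enveloping superalgebra, imposed on the tensor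
algebra of the vector space `q(n)`: `x y = (-1) ^ (|x| |y|) y x + [x, y]` for homogeneous
`x`, `y`. -/
inductive EnvelopeRel : TensorAlgebra K (queer K n) → TensorAlgebra K (queer K n) → Prop
  | bracket (i j : ZMod 2) (x y : queer K n) (hx : x ∈ queerPart K n i)
      (hy : y ∈ queerPart K n j) :
      EnvelopeRel
        (TensorAlgebra.ι K x * TensorAlgebra.ι K y)
        (sign K i j • (TensorAlgebra.ι K y * TensorAlgebra.ι K x)
          + TensorAlgebra.ι K (superBracket i j x y))

/-- The universal enveloping superalgebra `U(q(n))`. -/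
def Envelope : Type _ := RingQuot (EnvelopeRel K n)

instance : Ring (Envelope K n) := inferInstanceAs (Ring (RingQuot (EnvelopeRel K n)))

instance : Algebra K (Envelope K n) := inferInstanceAs (Algebra K (RingQuot (EnvelopeRel K n)))

/-- The quotient map from the tensor algebra onto `U(q(n))`. -/
def envMk : TensorAlgebra K (queer K n) →ₐ[K] Envelope K n :=
  RingQuot.mkAlgHom K (EnvelopeRel K n)

/-- The canonical map `q(n) → U(q(n))`. -/
def envι : queer K n →ₗ[K] Envelope K n :=
  (envMk K n).toLinearMap ∘ₗ TensorAlgebra.ι K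

variable {K n} (p : ℕ) (χ : Module.Dual K (queerPart K n 0))

/-- The relations generating the ideal `I_χ`: `x ^ p = x^[p] + χ(x) ^ p` for `x` even, where the
`p`-th power map `x^[p]` of the even part `gl(n)` is the `p`-th power of matrices. -/
inductive ReducedRel : Envelope K n → Envelope K n → Prop
  | pchar (x : queerPart K n 0) :
      ReducedRel
        (envι K n (x : queer K n) ^ p)
        (envι K n ((x : queer K n) ^ p) + algebraMap K (Envelope K n) (χ x ^ p))

/-- The reduced enveloping superalgebra `U_χ(q(n)) = U(q(n)) / I_χ`. -/
def ReducedEnvelope : Type _ := RingQuot (ReducedRel p χ)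

instance : Ring (ReducedEnvelope p χ) := inferInstanceAs (Ring (RingQuot (ReducedRel p χ)))

instance : Algebra K (ReducedEnvelope p χ) :=
  inferInstanceAs (Algebra K (RingQuot (ReducedRel p χ)))

/-- The quotient map `U(q(n)) → U_χ(q(n))`. -/
def redMk : Envelope K n →ₐ[K] ReducedEnvelope p χ :=
  RingQuot.mkAlgHom K (ReducedRel p χ)

/-- The canonical map `q(n) → U_χ(q(n))`. -/
def redι : queer K n →ₗ[K] ReducedEnvelope p χ :=
  (redMk p χ).toLinearMap ∘ₗ envι K n

/-- Products of (images of) homogeneous elements of `q(n)`, with their total parity. -/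
inductive IsMonomial : ZMod 2 → ReducedEnvelope p χ → Prop
  | one : IsMonomial 0 1
  | mul {i j : ZMod 2} {x : queer K n} {u : ReducedEnvelope p χ} (hx : x ∈ queerPart K n i)
      (hu : IsMonomial j u) : IsMonomial (i + j) (redι p χ x * u)

/-- The `ZMod 2`-grading of `U_χ(q(n))` induced by that of `q(n)`. -/
def parity (i : ZMod 2) : Submodule K (ReducedEnvelope p χ) :=
  Submodule.span K {u | IsMonomial p χ i u}

section Grading

theorem mul_mem_queerPart {i j : ZMod 2} {x y : queer K n} (hx : x ∈ queerPart K n i)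
    (hy : y ∈ queerPart K n j) : x * y ∈ queerPart K n (i + j) := by
  have h2 : ∀ k : ZMod 2, k = 0 ∨ k = 1 := by decide
  have h11 : (1 + 1 : ZMod 2) = 0 := by decide
  rcases h2 i with rfl | rfl <;> rcases h2 j with rfl | rfl <;>
    simp only [queerPart, h11, zero_add, add_zero, one_ne_zero, if_true, if_false,
      LinearMap.mem_range] at * <;>
    obtain ⟨A, rfl⟩ := hx <;> obtain ⟨B, rfl⟩ := hy <;>
    exact ⟨A * B, Subtype.ext (by simp [evenElt, oddElt, Matrix.fromBlocks_multiply])⟩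

theorem one_mem_queerPart : (1 : queer K n) ∈ queerPart K n 0 := by
  simp only [queerPart, if_true, LinearMap.mem_range]
  exact ⟨1, Subtype.ext (by simp [evenElt])⟩

theorem pow_mem_queerPart {x : queer K n} (hx : x ∈ queerPart K n 0) (m : ℕ) :
    x ^ m ∈ queerPart K n 0 := by
  induction m with
  | zero => simpa using one_mem_queerPart
  | succ m ih => simpa [pow_succ] using mul_mem_queerPart ih hx

theorem superBracket_mem {i j : ZMod 2} {x y : queer K n} (hx : x ∈ queerPart K n i)
    (hy : y ∈ queerPart K n j) : superBracket i j x y ∈ queerPart K n (i + j) :=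
  Submodule.sub_mem _ (mul_mem_queerPart hx hy)
    (Submodule.smul_mem _ _ (add_comm j i ▸ mul_mem_queerPart hy hx))

theorem redι_mem {i : ZMod 2} {x : queer K n} (hx : x ∈ queerPart K n i) :
    redι p χ x ∈ parity p χ i := by
  refine Submodule.subset_span ?_
  have h := IsMonomial.mul (p := p) (χ := χ) hx IsMonomial.one
  rwa [add_zero, mul_one] at h

theorem IsMonomial.mul_mul {i j : ZMod 2} {u v : ReducedEnvelope p χ} (hu : IsMonomial p χ i u)
    (hv : IsMonomial p χ j v) : IsMonomial p χ (i + j) (u * v) := by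
  induction hu with
  | one => simpa using hv
  | mul hx _ ih => rw [add_assoc, mul_assoc]; exact IsMonomial.mul hx ih

instance parity.gradedMonoid : SetLike.GradedMonoid (parity p χ) where
  one_mem := Submodule.subset_span IsMonomial.one
  mul_mem i j u v hu hv := by
    have h : parity p χ i * parity p χ j ≤ parity p χ (i + j) := by
      unfold parity
      rw [Submodule.span_mul_span]
      refine Submodule.span_mono ?_
      rintro _ ⟨u, hu, v, hv, rfl⟩
      exact IsMonomial.mul_mul p χ hu hv
    exact h (Submodule.mul_mem_mul hu hv)

theorem envι_bracket {i j : ZMod 2} {x y : queer K n} (hx : x ∈ queerPart K n i)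
    (hy : y ∈ queerPart K n j) :
    envι K n x * envι K n y
      = sign K i j • (envι K n y * envι K n x) + envι K n (superBracket i j x y) := by
  have h : envMk K n _ = envMk K n _ :=
    RingQuot.mkAlgHom_rel K (EnvelopeRel.bracket i j x y hx hy)
  simp only [map_add, map_mul, map_smul] at h
  exact h

theorem redι_bracket {i j : ZMod 2} {x y : queer K n} (hx : x ∈ queerPart K n i)
    (hy : y ∈ queerPart K n j) :
    redι p χ x * redι p χ y
      = sign K i j • (redι p χ y * redι p χ x) + redι p χ (superBracket i j x y) := by
  have h := congrArg (redMk p χ) (envι_bracket hx hy)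
  simp only [map_add, map_mul, map_smul] at h
  exact h

theorem redι_pow (x : queerPart K n 0) :
    redι p χ (x : queer K n) ^ p
      = redι p χ ((x : queer K n) ^ p) + algebraMap K (ReducedEnvelope p χ) (χ x ^ p) := by
  have h : redMk p χ _ = redMk p χ _ :=
    RingQuot.mkAlgHom_rel K (ReducedRel.pchar (p := p) (χ := χ) x)
  simp only [map_add, map_pow, AlgHom.commutes] at h ⊢
  exact h

/-- Algebra maps out of `U(q(n))`. -/
def envLift {B : Type*} [Semiring B] [Algebra K B] (f : queer K n →ₗ[K] B)
    (hf : ∀ (i j : ZMod 2) (x y : queer K n), x ∈ queerPart K n i → y ∈ queerPart K n j →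
      f x * f y = sign K i j • (f y * f x) + f (superBracket i j x y)) :
    Envelope K n →ₐ[K] B :=
  RingQuot.liftAlgHom K ⟨TensorAlgebra.lift K f, by
    rintro _ _ ⟨i, j, x, y, hx, hy⟩
    simpa only [map_add, map_mul, map_smul, TensorAlgebra.lift_ι_apply] using hf i j x y hx hy⟩

theorem envLift_ι {B : Type*} [Semiring B] [Algebra K B] (f : queer K n →ₗ[K] B) (hf)
    (x : queer K n) : envLift f hf (envι K n x) = f x := by
  have h : envLift f hf (envι K n x) = TensorAlgebra.lift K f (TensorAlgebra.ι K x) :=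
    RingQuot.liftAlgHom_mkAlgHom_apply ..
  rw [h, TensorAlgebra.lift_ι_apply]

/-- Algebra maps out of `U_χ(q(n))`. -/
def redLift {B : Type*} [Semiring B] [Algebra K B] (f : queer K n →ₗ[K] B)
    (hf : ∀ (i j : ZMod 2) (x y : queer K n), x ∈ queerPart K n i → y ∈ queerPart K n j →
      f x * f y = sign K i j • (f y * f x) + f (superBracket i j x y))
    (hf' : ∀ x : queerPart K n 0,
      f x ^ p = f ((x : queer K n) ^ p) + algebraMap K B (χ x ^ p)) :
    ReducedEnvelope p χ →ₐ[K] B :=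
  RingQuot.liftAlgHom K ⟨envLift f hf, by
    rintro _ _ ⟨x⟩
    simpa only [map_add, map_pow, AlgHom.commutes, envLift_ι] using hf' x⟩

theorem redLift_ι {B : Type*} [Semiring B] [Algebra K B] (f : queer K n →ₗ[K] B) (hf) (hf')
    (x : queer K n) : redLift p χ f hf hf' (redι p χ x) = f x := by
  have h : redLift p χ f hf hf' (redι p χ x) = envLift f hf (envι K n x) :=
    RingQuot.liftAlgHom_mkAlgHom_apply ..
  rw [h, envLift_ι]

theorem redHom_ext {B : Type*} [Semiring B] [Algebra K B] {f g : ReducedEnvelope p χ →ₐ[K] B}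
    (h : ∀ x, f (redι p χ x) = g (redι p χ x)) : f = g := by
  refine RingQuot.ringQuot_ext' K f g ?_
  refine RingQuot.ringQuot_ext' K (f.comp (redMk p χ)) (g.comp (redMk p χ)) ?_
  exact TensorAlgebra.hom_ext (LinearMap.ext fun x => h x)

theorem evenElt_mem (A : Matrix (Fin n) (Fin n) K) : evenElt K n A ∈ queerPart K n 0 := by
  simp [queerPart]

theorem oddElt_mem (A : Matrix (Fin n) (Fin n) K) : oddElt K n A ∈ queerPart K n 1 := by
  simp [queerPart]

/-- Auxiliary: the block `A` of an element of `q(n)`. -/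
def evenBlock : queer K n →ₗ[K] Matrix (Fin n) (Fin n) K where
  toFun X := (X : Matrix (Fin n ⊕ Fin n) (Fin n ⊕ Fin n) K).toBlocks₁₁
  map_add' _ _ := rfl
  map_smul' _ _ := rfl

/-- Auxiliary: the block `B` of an element of `q(n)`. -/
def oddBlock : queer K n →ₗ[K] Matrix (Fin n) (Fin n) K where
  toFun X := (X : Matrix (Fin n ⊕ Fin n) (Fin n ⊕ Fin n) K).toBlocks₁₂
  map_add' _ _ := rfl
  map_smul' _ _ := rfl

/-- Auxiliary: the canonical map `q(n) → U_χ(q(n))` on the even component. -/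
def evenι : queer K n →ₗ[K] parity p χ 0 :=
  LinearMap.codRestrict (parity p χ 0) (redι p χ ∘ₗ evenElt K n ∘ₗ evenBlock)
    (fun _ => redι_mem p χ (evenElt_mem _))

/-- Auxiliary: the canonical map `q(n) → U_χ(q(n))` on the odd component. -/
def oddι : queer K n →ₗ[K] parity p χ 1 :=
  LinearMap.codRestrict (parity p χ 1) (redι p χ ∘ₗ oddElt K n ∘ₗ oddBlock)
    (fun _ => redι_mem p χ (oddElt_mem _))

/-- Auxiliary: the canonical map `q(n) → U_χ(q(n))`, split into homogeneous components. -/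
def gradedι : queer K n →ₗ[K] ⨁ i, parity p χ i :=
  DirectSum.lof K (ZMod 2) (fun i => parity p χ i) 0 ∘ₗ evenι p χ
    + DirectSum.lof K (ZMod 2) (fun i => parity p χ i) 1 ∘ₗ oddι p χ

theorem gradedι_of_mem {i : ZMod 2} {x : queer K n} (hx : x ∈ queerPart K n i) :
    gradedι p χ x = DirectSum.of (fun i => parity p χ i) i ⟨redι p χ x, redι_mem p χ hx⟩ := by
  have h2 : ∀ k : ZMod 2, k = 0 ∨ k = 1 := by decide
  rcases h2 i with rfl | rfl
  · have hx' := hx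
    simp only [queerPart, if_true, LinearMap.mem_range] at hx'
    obtain ⟨A, rfl⟩ := hx'
    have h3 : oddBlock (evenElt K n A) = 0 := rfl
    have e1 : oddι p χ (evenElt K n A) = 0 := Subtype.ext (by simp [oddι, h3])
    simp only [gradedι, LinearMap.add_apply, LinearMap.comp_apply, DirectSum.lof_eq_of]
    rw [e1, map_zero, add_zero]
    rfl
  · have hx' := hx
    simp only [queerPart, one_ne_zero, if_false, LinearMap.mem_range] at hx'
    obtain ⟨A, rfl⟩ := hx'
    have h3 : evenBlock (oddElt K n A) = 0 := rfl
    have e1 : evenι p χ (oddElt K n A) = 0 := Subtype.ext (by simp [evenι, h3])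
    simp only [gradedι, LinearMap.add_apply, LinearMap.comp_apply, DirectSum.lof_eq_of]
    rw [e1, map_zero, zero_add]
    rfl

theorem of_congr {i j : ZMod 2} {u v : ReducedEnvelope p χ} (hu : u ∈ parity p χ i)
    (hv : v ∈ parity p χ j) (hij : i = j) (huv : u = v) :
    DirectSum.of (fun i => parity p χ i) i ⟨u, hu⟩
      = DirectSum.of (fun i => parity p χ i) j ⟨v, hv⟩ := by
  subst hij huv
  rfl

/-- Auxiliary: the map sending an element of `U_χ(q(n))` to its homogeneous components. -/
def decomposeHom : ReducedEnvelope p χ →ₐ[K] ⨁ i, parity p χ i :=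
  redLift p χ (gradedι p χ)
    (by
      intro i j x y hx hy
      have hm : redι p χ y * redι p χ x ∈ parity p χ (i + j) := by
        rw [add_comm i j]
        exact SetLike.mul_mem_graded (redι_mem p χ hy) (redι_mem p χ hx)
      have e : gradedι p χ y * gradedι p χ x
          = DirectSum.of (fun i => parity p χ i) (i + j) ⟨redι p χ y * redι p χ x, hm⟩ := by
        rw [gradedι_of_mem p χ hx, gradedι_of_mem p χ hy, DirectSum.of_mul_of]
        exact of_congr p χ _ hm (add_comm j i) rfl
      rw [e, gradedι_of_mem p χ hx, gradedι_of_mem p χ hy,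
        gradedι_of_mem p χ (superBracket_mem hx hy), DirectSum.of_mul_of,
        ← DirectSum.lof_eq_of K, ← DirectSum.lof_eq_of K, ← DirectSum.lof_eq_of K,
        ← map_smul, ← map_add]
      congr 1
      exact Subtype.ext (redι_bracket p χ hx hy))
    (by
      intro x
      have hm : redι p χ (x : queer K n) ^ p ∈ parity p χ 0 := by
        simpa only [smul_zero] using SetLike.pow_mem_graded p (redι_mem p χ x.2)
      have e : gradedι p χ (x : queer K n) ^ p
          = DirectSum.of (fun i => parity p χ i) 0 ⟨redι p χ (x : queer K n) ^ p, hm⟩ := by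
        rw [gradedι_of_mem p χ x.2, DirectSum.ofPow]
        exact of_congr p χ _ hm (smul_zero p) rfl
      rw [e, gradedι_of_mem p χ (pow_mem_queerPart x.2 p), DirectSum.algebraMap_apply, ← map_add]
      congr 1
      exact Subtype.ext (redι_pow p χ x))

theorem decomposeHom_redι (x : queer K n) : decomposeHom p χ (redι p χ x) = gradedι p χ x :=
  redLift_ι ..

theorem queer_eq_add (x : queer K n) : ∃ A B, x = evenElt K n A + oddElt K n B := by
  obtain ⟨_, A, B, rfl⟩ := x
  exact ⟨A, B, Subtype.ext (by simp [evenElt, oddElt, Matrix.fromBlocks_add])⟩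

/-- `U_χ(q(n))` is a superalgebra. -/
instance parity.gradedAlgebra : GradedAlgebra (parity p χ) :=
  GradedAlgebra.ofAlgHom (parity p χ) (decomposeHom p χ)
    (by
      refine redHom_ext p χ fun x => ?_
      change DirectSum.coeAlgHom (parity p χ) (decomposeHom p χ (redι p χ x)) = redι p χ x
      rw [decomposeHom_redι]
      obtain ⟨A, B, rfl⟩ := queer_eq_add x
      rw [map_add, map_add, map_add, gradedι_of_mem p χ (evenElt_mem A),
        gradedι_of_mem p χ (oddElt_mem B), DirectSum.coeAlgHom_of, DirectSum.coeAlgHom_of])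
    (by
      rintro i ⟨u, hu⟩
      dsimp only
      induction hu using Submodule.span_induction with
      | mem u hu =>
        induction hu with
        | one => rw [map_one]; rfl
        | mul hx hu ih =>
          rw [map_mul, decomposeHom_redι, gradedι_of_mem p χ hx, ih, DirectSum.of_mul_of]
          exact DirectSum.of_eq_of_gradedMonoid_eq (Sigma.subtype_ext rfl rfl)
      | zero => rw [map_zero]; exact (map_zero (DirectSum.of (fun i => parity p χ i) i)).symm
      | add u v hu hv ihu ihv => rw [map_add, ihu, ihv, ← map_add]; rfl
      | smul c u hu ihu =>
        rw [map_smul, ihu, ← DirectSum.lof_eq_of K, ← DirectSum.lof_eq_of K, ← map_smul]; rfl)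

end Grading

/-- A superalgebra is semisimple if its left regular supermodule is: every `ZMod 2`-graded left
ideal is a direct summand, with a `ZMod 2`-graded left ideal as complement. -/
def IsSemisimpleSuperalgebra {A : Type*} [Ring A] [Algebra K A]
    (𝒜 : ZMod 2 → Submodule K A) [GradedAlgebra 𝒜] : Prop :=
  ∀ I : Ideal A, I.IsHomogeneous 𝒜 → ∃ J : Ideal A, J.IsHomogeneous 𝒜 ∧ IsCompl I J

/-- The element of the even part `q(n)_0 ≅ gl(n)` given by the `n × n` matrix `A`. -/
def ofGL (A : Matrix (Fin n) (Fin n) K) : queerPart K n 0 :=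
  ⟨evenElt K n A, evenElt_mem A⟩

/-- The element `h_i`: the `i`-th diagonal matrix unit. -/
def h (i : Fin n) : queerPart K n 0 := ofGL (Matrix.single i i 1)

/-- `χ` vanishes on the even part of the positive nilpotent subalgebra `n⁺`
(strictly upper triangular matrices). -/
def VanishesOnNPlus (χ : Module.Dual K (queerPart K n 0)) : Prop :=
  ∀ A : Matrix (Fin n) (Fin n) K, (∀ i j, j ≤ i → A i j = 0) → χ (ofGL A) = 0

/-- `χ` vanishes on the even part of the negative nilpotent subalgebra `n⁻`
(strictly lower triangular matrices). -/
def VanishesOnNMinus (χ : Module.Dual K (queerPart K n 0)) : Prop :=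
  ∀ A : Matrix (Fin n) (Fin n) K, (∀ i j, i ≤ j → A i j = 0) → χ (ofGL A) = 0

/-- A `p`-character is semisimple if it is `GL(n)`-conjugate to one that vanishes on the even
parts of `n⁺` and `n⁻`. -/
def IsSemisimpleCharacter (χ : Module.Dual K (queerPart K n 0)) : Prop :=
  ∃ (g : GL (Fin n) K) (ξ : Module.Dual K (queerPart K n 0)),
    VanishesOnNPlus ξ ∧ VanishesOnNMinus ξ ∧
      ∀ A : Matrix (Fin n) (Fin n) K,
        χ (ofGL A) = ξ (ofGL ((g : Matrix (Fin n) (Fin n) K) * A * (g⁻¹ : GL (Fin n) K)))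

end QueerSuper

end

noncomputable section

/-! ### Defining relations between matrix units -/

namespace QueerSuper

/-! The argument is highest weight theory with a single decisive computation. Fix the order of the
positive roots by column and then by row. To each root attach the block `ev ^ (p - 1) * od`, the top
element of the algebra generated by its two root vectors, and let e and f be the ordered products of
all positive and of all negative blocks. On a singular vector of weight μ, that is, one annihilated
by all positive root vectors, the product e f acts as a scalar. This scalar is the product over i <
j of a nonzero multiple of (μ i + μ j) ∏ (μ i - μ j - k), with k = 1, ..., p - 1
(`posProd_smul_negProd`). It is computed one root at a time: each block has weight p times a root,
which is zero, so the weight never changes. The weights that occur satisfy μ i ^ p - μ i = χ(h i) ^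
p, so for i ≠ j a factor of the scalar can vanish only if χ(h i) = ± χ(h j).

Suppose χ is regular. Then e f is bijective on singular vectors of each weight. With Engel's theorem
this shows that every module is generated by its singular vectors (`span_singular_eq_top`), and that
a Cartan-stable space V of singular vectors is recovered as the space of all singular vectors in the
submodule it generates (`mem_of_mem_span_of_mem_singular`). Complete reducibility is thereby reduced
to the odd Cartan elements acting on singular vectors. These are anticommuting operators whose
squares h i satisfy h i ^ p = h i + χ(h i) ^ p, hence are invertible, and an averaging argument
produces stable complements (`exists_stable_isCompl`). Taking the even part of a projection makes a
complement graded.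

Suppose χ is not regular. In a semisimple superalgebra every homogeneous z has the form z a z. Let π
be the projection onto weight μ. If e f acts as zero on weight μ, then z = f π e satisfies z a z = 0
for all a; if μ i = 0, then z = f π (od i i) e does. It remains to see that these z are nonzero,
which is a fragment of the PBW theorem. It is proved in a concrete representation: q(n) acts by
differential operators on truncated polynomials in even and odd variables, translated to the
identity matrix and twisted by χ. There each basis vector has as leading term the derivation in its
own variable (`hasLeading_fockEv`, `hasLeading_fockOd`), so a product of top powers for distinct
basis vectors is nonzero. Jacobson's formula for (x + y) ^ p reduces the p-th power relations of
this representation to matrix units. -/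

/-- The relations satisfied in a reduced enveloping superalgebra of `q(n)` by the images `ev i j`,
`od i j` of the even and odd matrix units, except those for the `p`-th powers of `ev i i`. -/
structure IsQueerFamily {R : Type*} [Ring R] {n : ℕ} (p : ℕ) (ev od : Fin n → Fin n → R) :
    Prop where
  ev_ev : ∀ i j k l, ev i j * ev k l
    = ev k l * ev i j + ((if j = k then ev i l else 0) - if l = i then ev k j else 0)
  ev_od : ∀ i j k l, ev i j * od k l
    = od k l * ev i j + ((if j = k then od i l else 0) - if l = i then od k j else 0)
  od_od : ∀ i j k l, od i j * od k l
    = -(od k l * od i j) + ((if j = k then ev i l else 0) + if l = i then ev k j else 0)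
  od_mul_self : ∀ i j, i ≠ j → od i j * od i j = 0
  od_diag : ∀ i, od i i * od i i = ev i i
  ev_pow : ∀ i j, i ≠ j → ev i j ^ p = 0

namespace IsQueerFamily

section Ring

variable {R : Type*} [Ring R] {n : ℕ} {p : ℕ} {ev od : Fin n → Fin n → R}

theorem od_ev (H : IsQueerFamily p ev od) (i j k l : Fin n) : od i j * ev k l
    = ev k l * od i j + ((if j = k then od i l else 0) - if l = i then od k j else 0) := by
  rw [H.ev_od k l i j]
  split_ifs <;> abel

/-- The transposed family in the opposite ring. -/
theorem op (H : IsQueerFamily p ev od) :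
    IsQueerFamily p (fun i j => MulOpposite.op (ev j i)) (fun i j => MulOpposite.op (od j i)) where
  ev_ev i j k l := by
    simp only [← MulOpposite.op_mul]
    rw [H.ev_ev l k j i]
    by_cases h1 : j = k <;> by_cases h2 : l = i <;> simp [h1, h2, eq_comm, eq_comm (a := i) (b := l)]
  ev_od i j k l := by
    simp only [← MulOpposite.op_mul]
    rw [H.od_ev l k j i]
    by_cases h1 : j = k <;> by_cases h2 : l = i <;> simp [h1, h2, eq_comm, eq_comm (a := i) (b := l)]
  od_od i j k l := by
    simp only [← MulOpposite.op_mul]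
    rw [H.od_od l k j i]
    by_cases h1 : j = k <;> by_cases h2 : l = i <;>
      simp [h1, h2, eq_comm, eq_comm (a := i) (b := l), add_comm]
  od_mul_self i j hij := by
    simp only [← MulOpposite.op_mul]
    rw [H.od_mul_self j i hij.symm, MulOpposite.op_zero]
  od_diag i := by
    simp only [← MulOpposite.op_mul]
    rw [H.od_diag i]
  ev_pow i j hij := by
    simp only [← MulOpposite.op_pow]
    rw [H.ev_pow j i hij.symm, MulOpposite.op_zero]

theorem commute_ev_od (H : IsQueerFamily p ev od) {i j : Fin n} (hij : i ≠ j) :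
    Commute (ev i j) (od i j) := by
  have := H.ev_od i j i j
  simpa [hij, hij.symm, Commute, SemiconjBy] using this

end Ring

end IsQueerFamily

/-! ### Ordered products of root vector blocks -/

section Killed

variable {R : Type*} [Ring R] {n : ℕ} (p : ℕ) (ev od : Fin n → Fin n → R)
  {M : Type*} [AddCommGroup M] [Module R M]

/-- `m` is annihilated by the root vectors with index in `S`. -/
def Killed (S : Fin n → Fin n → Prop) (m : M) : Prop :=
  ∀ a b, S a b → ev a b • m = 0 ∧ od a b • m = 0

/-- Bracketing with the `(i, j)` root vectors preserves the index set `S`. -/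
def Normalizes (i j : Fin n) (S : Fin n → Fin n → Prop) : Prop :=
  ∀ a b, S a b → (j = a → S i b) ∧ (b = i → S a j)

/-- The top element of the subalgebra generated by the root vectors of index `(i, j)`. -/
def block (i j : Fin n) : R := ev i j ^ (p - 1) * od i j

variable {p ev od} {S : Fin n → Fin n → Prop} {i j : Fin n} {m : M}

theorem ite_smul_eq_zero {P : Prop} [Decidable P] {x : R} (h : P → x • m = 0) :
    (if P then x else 0) • m = 0 := by
  split_ifs with hP
  exacts [h hP, zero_smul R m]

theorem Killed.ev_smul (H : IsQueerFamily p ev od) (hS : Normalizes i j S)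
    (hm : Killed ev od S m) : Killed ev od S (ev i j • m) := by
  intro a b hab
  obtain ⟨h1, h2⟩ := hS a b hab
  rw [← mul_smul, ← mul_smul, H.ev_ev a b i j, H.od_ev a b i j, add_smul, add_smul, sub_smul,
    sub_smul, mul_smul, mul_smul, (hm a b hab).1, (hm a b hab).2,
    ite_smul_eq_zero fun h => (hm _ _ (h1 h)).1, ite_smul_eq_zero fun h => (hm _ _ (h2 h)).1,
    ite_smul_eq_zero fun h => (hm _ _ (h1 h)).2, ite_smul_eq_zero fun h => (hm _ _ (h2 h)).2]
  simp

theorem Killed.od_smul (H : IsQueerFamily p ev od) (hS : Normalizes i j S)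
    (hm : Killed ev od S m) : Killed ev od S (od i j • m) := by
  intro a b hab
  obtain ⟨h1, h2⟩ := hS a b hab
  rw [← mul_smul, ← mul_smul, H.ev_od a b i j, H.od_od a b i j, add_smul, add_smul, sub_smul,
    add_smul, neg_smul, mul_smul, mul_smul, (hm a b hab).1, (hm a b hab).2,
    ite_smul_eq_zero fun h => (hm _ _ (h1 h)).1, ite_smul_eq_zero fun h => (hm _ _ (h2 h)).1,
    ite_smul_eq_zero fun h => (hm _ _ (h1 h)).2, ite_smul_eq_zero fun h => (hm _ _ (h2 h)).2]
  simp

theorem Killed.ev_pow_smul (H : IsQueerFamily p ev od) (hS : Normalizes i j S)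
    (hm : Killed ev od S m) (r : ℕ) : Killed ev od S (ev i j ^ r • m) := by
  induction r with
  | zero => simpa using hm
  | succ r ih => rw [pow_succ', mul_smul]; exact ih.ev_smul H hS

theorem Killed.mono {T : Fin n → Fin n → Prop} (hm : Killed ev od S m)
    (hT : ∀ a b, T a b → S a b) : Killed ev od T m :=
  fun a b h => hm a b (hT a b h)

/-- The block is annihilated by both of its own root vectors, since `ev i j ^ p = 0`, `od i j`
squares to zero and the two commute. Vectors already annihilating `m` continue to do so because (i,
j) normalizes their index set. -/
theorem Killed.block_smul (H : IsQueerFamily p ev od) (hp : 0 < p) (hij : i ≠ j)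
    (hS : Normalizes i j S) (hm : Killed ev od S m) :
    Killed ev od (fun a b => S a b ∨ (a = i ∧ b = j)) (block p ev od i j • m) := by
  rintro a b (hab | ⟨rfl, rfl⟩)
  · rw [block, mul_smul]
    exact (hm.od_smul H hS).ev_pow_smul H hS (p - 1) a b hab
  · rw [block, ← mul_smul, ← mul_smul, ← mul_assoc, ← mul_assoc, mul_pow_sub_one hp.ne',
      H.ev_pow a b hij, ((H.commute_ev_od hij).pow_left (p - 1)).symm.eq, mul_assoc,
      H.od_mul_self a b hij]
    simp

theorem Normalizes.swap (hS : Normalizes i j S) : Normalizes j i (fun a b => S b a) :=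
  fun a b hab => ⟨fun h => (hS b a hab).2 h.symm, fun h => (hS b a hab).1 h.symm⟩

/-- Positive roots are ordered by column, and by row within a column. -/
def RootLT (β γ : Fin n × Fin n) : Prop :=
  β.2 < γ.2 ∨ (β.2 = γ.2 ∧ β.1 < γ.1)

/-- `L` lists, in decreasing order, an initial segment of the positive roots. -/
def IsRootList : List (Fin n × Fin n) → Prop
  | [] => True
  | β :: L => IsRootList L ∧ β.1 < β.2 ∧ ∀ γ, γ ∈ L ↔ γ.1 < γ.2 ∧ RootLT γ β

variable (p ev od) in
/-- The product of the blocks of the roots in `L`. -/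
def posProd : List (Fin n × Fin n) → R
  | [] => 1
  | β :: L => block p ev od β.1 β.2 * posProd L

variable (p ev od) in
/-- The product, in reverse order, of the blocks of the negatives of the roots in `L`. -/
def negProd : List (Fin n × Fin n) → R
  | [] => 1
  | β :: L => negProd L * block p ev od β.2 β.1

theorem exists_isRootList (n : ℕ) :
    ∃ L : List (Fin n × Fin n), IsRootList L ∧ ∀ γ, γ ∈ L ↔ γ.1 < γ.2 := by
  -- The root order is the numerical order of column * n + row, so the list can be built by
  -- recursion on a bound for this number.
  have key : ∀ γ δ : Fin n × Fin n,
      RootLT γ δ ↔ (γ.2 : ℕ) * n + γ.1 < (δ.2 : ℕ) * n + δ.1 := by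
    rintro ⟨a, b⟩ ⟨i, j⟩
    simp only [RootLT, Fin.lt_def, Fin.ext_iff]
    have ha := a.2
    have hi := i.2
    rcases lt_trichotomy (b : ℕ) j with h | h | h
    · have := Nat.mul_le_mul_right n (Nat.succ_le_of_lt h)
      rw [Nat.succ_mul] at this
      omega
    · rw [h]; omega
    · have := Nat.mul_le_mul_right n (Nat.succ_le_of_lt h)
      rw [Nat.succ_mul] at this
      omega
  have inj : ∀ γ δ : Fin n × Fin n,
      (γ.2 : ℕ) * n + γ.1 = (δ.2 : ℕ) * n + δ.1 → γ = δ := by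
    intro γ δ h
    have h1 := mt (key γ δ).1 h.not_lt
    have h2 := mt (key δ γ).1 h.symm.not_lt
    simp only [RootLT, not_or, not_and, not_lt] at h1 h2
    have h3 := le_antisymm h2.1 h1.1
    exact Prod.ext (le_antisymm (h2.2 h3.symm) (h1.2 h3)) h3
  have main : ∀ r : ℕ, ∃ L : List (Fin n × Fin n), IsRootList L ∧
      ∀ γ, γ ∈ L ↔ γ.1 < γ.2 ∧ (γ.2 : ℕ) * n + γ.1 < r := by
    intro r
    induction r with
    | zero => exact ⟨[], trivial, by simp⟩
    | succ r ih =>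
      obtain ⟨L, hL, hmem⟩ := ih
      by_cases h : ∃ β : Fin n × Fin n, β.1 < β.2 ∧ (β.2 : ℕ) * n + β.1 = r
      · obtain ⟨β, hβ, hr⟩ := h
        refine ⟨β :: L, ⟨hL, hβ, fun γ => ?_⟩, fun γ => ?_⟩
        · rw [hmem, key, hr]
        · rw [List.mem_cons, hmem, Nat.lt_succ_iff_lt_or_eq]
          constructor
          · rintro (rfl | h)
            exacts [⟨hβ, Or.inr hr⟩, ⟨h.1, Or.inl h.2⟩]
          · rintro ⟨h1, h2 | h2⟩
            exacts [Or.inr ⟨h1, h2⟩, Or.inl (inj _ _ (h2.trans hr.symm))]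
      · refine ⟨L, hL, fun γ => ?_⟩
        rw [hmem, Nat.lt_succ_iff_lt_or_eq]
        constructor
        · exact fun h => ⟨h.1, Or.inl h.2⟩
        · rintro ⟨h1, h2 | h2⟩
          exacts [⟨h1, h2⟩, (h ⟨γ, h1, h2⟩).elim]
  obtain ⟨L, hL, hmem⟩ := main (n * n)
  refine ⟨L, hL, fun γ => (hmem γ).trans ⟨fun h => h.1, fun h => ⟨h, ?_⟩⟩⟩
  have := Nat.mul_le_mul_right n (Nat.succ_le_of_lt γ.2.2)
  rw [Nat.succ_mul] at this
  have := γ.1.2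
  omega

variable {β : Fin n × Fin n} {L : List (Fin n × Fin n)}

/-- When β plus a smaller root is a root, it lies in the column of β in a smaller row, hence is
again smaller. -/
theorem normalizes_tail (hL : IsRootList (β :: L)) :
    Normalizes β.1 β.2 (fun a b => (a, b) ∈ L) := by
  obtain ⟨i, j⟩ := β
  obtain ⟨-, hβ, hm⟩ := hL
  intro a b
  simp only [hm, RootLT] at *
  rintro ⟨h1, h2⟩
  constructor <;> intro h <;> subst h <;> grind

/-- When β plus a larger root is a root, it lies in a column to the right of β. Thus final segments
of the order are preserved as well as initial ones. -/
theorem normalizes_compl (hL : IsRootList (β :: L)) :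
    Normalizes β.1 β.2 (fun a b => a < b ∧ (a, b) ∉ β :: L) := by
  obtain ⟨i, j⟩ := β
  obtain ⟨-, hβ, hm⟩ := hL
  intro a b
  simp only [List.mem_cons, hm, RootLT, Prod.mk.injEq] at *
  rintro ⟨h1, h2⟩
  constructor <;> intro h <;> subst h <;> omega

/-- The indices of the root vectors that annihilate the intermediate stages when `negProd`, and then
`posProd`, is applied to a highest weight vector. -/
def mixedRoots (L : List (Fin n × Fin n)) (a b : Fin n) : Prop :=
  (a, b) ∈ L ∨ (b < a ∧ (b, a) ∉ L)

/-- Subtracting β from a smaller positive root gives either a smaller positive root or the negative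
of a root in the column of β, in a larger row. Subtracting β from the negative of a larger root
gives the negative of a root still further to the right. So the index set behaves like a reflected
system of positive roots. -/
theorem normalizes_mixed (hL : IsRootList (β :: L)) :
    Normalizes β.2 β.1 (fun a b => (a, b) ∈ L ∨ (b < a ∧ (b, a) ∉ β :: L)) := by
  obtain ⟨i, j⟩ := β
  obtain ⟨-, hβ, hm⟩ := hL
  intro a b
  simp only [List.mem_cons, hm, RootLT, Prod.mk.injEq] at *
  intro h1
  constructor <;> intro h <;> subst h <;> omega

theorem killed_posProd (H : IsQueerFamily p ev od) (hp : 0 < p) (hL : IsRootList L) (m : M) :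
    Killed ev od (fun a b => (a, b) ∈ L) (posProd p ev od L • m) := by
  induction L with
  | nil => intro a b h; simp at h
  | cons β L ih =>
    rw [posProd, mul_smul]
    refine ((ih hL.1).block_smul H hp hL.2.1.ne (normalizes_tail hL)).mono fun a b h => ?_
    rcases List.mem_cons.1 h with h | h
    · exact Or.inr ⟨congrArg Prod.fst h, congrArg Prod.snd h⟩
    · exact Or.inl h

/-- The largest root acts first, so at each stage the negatives of a final segment annihilate the
vector, and the segment grows by the head of the list. -/
theorem killed_negProd (H : IsQueerFamily p ev od) (hp : 0 < p) (hL : IsRootList L)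
    (hm : Killed ev od (fun a b => b < a ∧ (b, a) ∉ L) m) :
    Killed ev od (fun a b => b < a) (negProd p ev od L • m) := by
  induction L generalizing m with
  | nil => simpa [negProd] using hm
  | cons β L ih =>
    rw [negProd, mul_smul]
    refine ih hL.1 ((hm.block_smul H hp hL.2.1.ne' (normalizes_compl hL).swap).mono ?_)
    intro a b ⟨h1, h2⟩
    by_cases h : (b, a) = β
    · exact Or.inr ⟨congrArg Prod.snd h, congrArg Prod.fst h⟩
    · exact Or.inl ⟨h1, by simp [h, h2]⟩

/-- Transposing indices and reversing products exchanges the positive and negative ordered products.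
Annihilation from the right thus follows from annihilation from the left in the opposite ring. -/
theorem op_block (H : IsQueerFamily p ev od) (hij : i ≠ j) :
    block p (fun i j => MulOpposite.op (ev j i)) (fun i j => MulOpposite.op (od j i)) i j
      = MulOpposite.op (block p ev od j i) := by
  rw [block, block, ← MulOpposite.op_pow, ← MulOpposite.op_mul,
    ((H.commute_ev_od hij.symm).pow_left (p - 1)).eq]

theorem op_posProd (H : IsQueerFamily p ev od) (hL : IsRootList L) :
    posProd p (fun i j => MulOpposite.op (ev j i)) (fun i j => MulOpposite.op (od j i)) L
      = MulOpposite.op (negProd p ev od L) := by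
  induction L with
  | nil => rfl
  | cons β L ih => rw [posProd, negProd, MulOpposite.op_mul, ih hL.1, op_block H hL.2.1.ne]

theorem op_negProd (H : IsQueerFamily p ev od) (hL : IsRootList L) :
    negProd p (fun i j => MulOpposite.op (ev j i)) (fun i j => MulOpposite.op (od j i)) L
      = MulOpposite.op (posProd p ev od L) := by
  induction L with
  | nil => rfl
  | cons β L ih => rw [posProd, negProd, MulOpposite.op_mul, ih hL.1, op_block H hL.2.1.ne']

theorem negProd_mul (H : IsQueerFamily p ev od) (hp : 0 < p) (hL : IsRootList L)
    (h : (j, i) ∈ L) :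
    negProd p ev od L * ev i j = 0 ∧ negProd p ev od L * od i j = 0 := by
  have := killed_posProd H.op hp hL (1 : R) j i h
  rw [op_posProd H hL] at this
  simpa using this

theorem posProd_mul (H : IsQueerFamily p ev od) (hp : 0 < p) (hL : IsRootList L)
    (hall : ∀ γ, γ ∈ L ↔ γ.1 < γ.2) (h : i < j) :
    posProd p ev od L * ev i j = 0 ∧ posProd p ev od L * od i j = 0 := by
  have := killed_negProd (m := (1 : R)) H.op hp hL
    (fun a b h => absurd ((hall (b, a)).2 h.1) h.2) j i h
  rw [op_negProd H hL] at this
  simpa using this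

theorem mul_negProd (H : IsQueerFamily p ev od) (hp : 0 < p) (hL : IsRootList L)
    (hall : ∀ γ, γ ∈ L ↔ γ.1 < γ.2) (h : j < i) :
    ev i j * negProd p ev od L = 0 ∧ od i j * negProd p ev od L = 0 := by
  simpa using killed_negProd (m := (1 : R)) H hp hL
    (fun a b h => absurd ((hall (b, a)).2 h.1) h.2) i j h

/-- Engel's theorem for the root vectors of positive roots. -/
theorem exists_killed (H : IsQueerFamily p ev od) [Nontrivial M] (hL : IsRootList L)
    (hall : ∀ γ, γ ∈ L ↔ γ.1 < γ.2) :
    ∃ m : M, m ≠ 0 ∧ Killed ev od (fun a b => a < b) m := by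
  -- The positive roots outside `L'` already annihilate the vector. The largest remaining root is
  -- added next, and the roots above it are preserved because it normalizes them.
  have key : ∀ (L' : List (Fin n × Fin n)), IsRootList L' →
      (∃ m : M, m ≠ 0 ∧ Killed ev od (fun a b => a < b ∧ (a, b) ∉ L') m) →
      ∃ m : M, m ≠ 0 ∧ Killed ev od (fun a b => a < b) m := by
    intro L' hL'
    induction L' with
    | nil => simp
    | cons β L' ih =>
      rintro ⟨m, hm0, hm⟩
      refine ih hL'.1 ?_
      have hn := normalizes_compl hL'
      have hne := hL'.2.1.ne
      -- Since `od` squares to zero, either `m` or its nonzero image under `od` is annihilated by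
      -- it. The last nonzero power of `ev` applied to that vector is then annihilated by both.
      obtain ⟨m₁, h10, h1, h1'⟩ : ∃ m₁ : M, m₁ ≠ 0 ∧ od β.1 β.2 • m₁ = 0 ∧
          Killed ev od (fun a b => a < b ∧ (a, b) ∉ β :: L') m₁ := by
        by_cases h : od β.1 β.2 • m = 0
        · exact ⟨m, hm0, h, hm⟩
        · refine ⟨_, h, ?_, hm.od_smul H hn⟩
          rw [← mul_smul, H.od_mul_self _ _ hne, zero_smul]
      have hex : ∃ r : ℕ, ev β.1 β.2 ^ r • m₁ = 0 := ⟨p, by rw [H.ev_pow _ _ hne, zero_smul]⟩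
      classical
      have hr0 : Nat.find hex ≠ 0 := by
        intro h
        have := Nat.find_spec hex
        rw [h] at this
        simp [h10] at this
      obtain ⟨s, hs⟩ := Nat.exists_eq_succ_of_ne_zero hr0
      refine ⟨ev β.1 β.2 ^ s • m₁, Nat.find_min hex (by omega), ?_⟩
      intro a b ⟨hab, hab'⟩
      by_cases h : (a, b) = β
      · subst h
        refine ⟨?_, ?_⟩
        · rw [← mul_smul, ← pow_succ', ← Nat.succ_eq_add_one, ← hs]
          exact Nat.find_spec hex
        · rw [← mul_smul, ((H.commute_ev_od hne).pow_left s).symm.eq, mul_smul, h1, smul_zero]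
      · exact h1'.ev_pow_smul H hn s a b ⟨hab, by simp [h, hab']⟩
  obtain ⟨m, hm⟩ := exists_ne (0 : M)
  exact key L hL ⟨m, hm, fun a b h => absurd ((hall (a, b)).2 h.1) h.2⟩

end Killed

end QueerSuper

namespace QueerSuper

/-! ### Highest weight computations -/

section RankOne

variable {K : Type*} [Field K] {R : Type*} [Ring R] [Algebra K R] {n : ℕ} {p : ℕ}
  {ev od : Fin n → Fin n → R} {M : Type*} [AddCommGroup M] [Module K M] [Module R M]
  [IsScalarTower K R M] {i j : Fin n} {m : M} {L : List (Fin n × Fin n)}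

/-- `m` is a weight vector of weight `μ`. -/
def IsWeight (ev : Fin n → Fin n → R) (μ : Fin n → K) (m : M) : Prop :=
  ∀ i, ev i i • m = μ i • m

theorem smul_scalar_comm (r : R) (c : K) (m : M) : r • c • m = c • r • m := by
  rw [← algebraMap_smul R c m, ← mul_smul, ← Algebra.commutes, mul_smul, algebraMap_smul]

/-- `E F ^ (r + 1) m = F ^ (r + 1) E m + (r + 1) (μ - r) F ^ r m` for `m` of weight `μ`. -/
theorem ev_smul_pow (H : IsQueerFamily p ev od) (hij : i ≠ j) {a b : K}
    (ha : ev i i • m = a • m) (hb : ev j j • m = b • m) (r : ℕ) :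
    ev i j • ev j i ^ (r + 1) • m
      = ev j i ^ (r + 1) • ev i j • m + ((r + 1 : K) * (a - b - r)) • ev j i ^ r • m := by
  have hwa : ∀ r : ℕ, ev i i • ev j i ^ r • m = (a - r) • ev j i ^ r • m := by
    intro r
    induction r with
    | zero => simp [ha]
    | succ r ih =>
      have h := H.ev_ev i i j i
      simp only [hij, if_false, if_true, zero_sub] at h
      rw [pow_succ', mul_smul, ← mul_smul (ev i i), h, add_smul, mul_smul, ih, neg_smul,
        smul_scalar_comm]
      push_cast
      generalize ev j i • ev j i ^ r • m = z0
      module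
  have hwb : ∀ r : ℕ, ev j j • ev j i ^ r • m = (b + r) • ev j i ^ r • m := by
    intro r
    induction r with
    | zero => simp [hb]
    | succ r ih =>
      have h := H.ev_ev j j j i
      simp only [hij, if_false, if_true, sub_zero] at h
      rw [pow_succ', mul_smul, ← mul_smul (ev j j), h, add_smul, mul_smul, ih,
        smul_scalar_comm]
      push_cast
      generalize ev j i • ev j i ^ r • m = z0
      module
  have hEF := H.ev_ev i j j i
  simp only [if_true] at hEF
  have step : ∀ r : ℕ, ev i j • ev j i ^ (r + 1) • m
      = ev j i • ev i j • ev j i ^ r • m + (a - b - 2 * r) • ev j i ^ r • m := by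
    intro r
    rw [pow_succ', mul_smul, ← mul_smul (ev i j), hEF, add_smul, sub_smul, mul_smul, hwa, hwb]
    generalize ev j i • ev i j • ev j i ^ r • m = z0
    generalize ev j i ^ r • m = z1
    module
  induction r with
  | zero => rw [step]; simp
  | succ r ih =>
    rw [step, ih, smul_add, smul_scalar_comm, ← mul_smul (ev j i), ← mul_smul (ev j i),
      ← pow_succ', ← pow_succ']
    push_cast
    generalize ev j i ^ (r + 1 + 1) • ev i j • m = z0, ev j i ^ (r + 1) • m = z1
    module

/-- Iteration of `ev_smul_pow` when the term with `ev i j • m` disappears. The offset `s` takes the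
value 1 in the correction term of `ev_pow_smul_pow_od`. -/
theorem ev_pow_smul_pow (H : IsQueerFamily p ev od) (hij : i ≠ j) {a b : K}
    (ha : ev i i • m = a • m) (hb : ev j j • m = b • m) (hm : ev i j • m = 0) (r s : ℕ) :
    ev i j ^ r • ev j i ^ (r + s) • m
      = (∏ k ∈ Finset.range r, ((k + s + 1 : K) * (a - b - (k + s)))) • ev j i ^ s • m := by
  induction r with
  | zero => simp
  | succ r ih =>
    rw [pow_succ, mul_smul, show r + 1 + s = r + s + 1 by ring, ev_smul_pow H hij ha hb, hm,
      smul_zero, zero_add, smul_scalar_comm, ih, Finset.prod_range_succ]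
    push_cast
    generalize ev j i ^ s • m = z0
    module

theorem prod_range_factorial (r : ℕ) (f : ℕ → K) :
    ∏ k ∈ Finset.range r, (((k : K) + 1 + 1) * f k)
      = (Nat.factorial (r + 1) : K) * ∏ k ∈ Finset.range r, f k := by
  rw [Finset.prod_mul_distrib, ← Finset.prod_range_add_one_eq_factorial, Finset.prod_range_succ']
  push_cast
  simp

/-- The vector `od j i • m` is not annihilated by `ev i j`, which sends it to (od i i - od j j) m.
That vector is annihilated by `ev i j` and has the same weight as `m`, so the recursion closes with
exactly two terms. -/
theorem ev_pow_smul_pow_od (H : IsQueerFamily p ev od) (hij : i ≠ j) {a b : K}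
    (ha : ev i i • m = a • m) (hb : ev j j • m = b • m) (hm : ev i j • m = 0)
    (hm' : od i j • m = 0) (t : ℕ) :
    ev i j ^ (t + 1) • ev j i ^ (t + 1) • od j i • m
      = (((t + 1).factorial : K) * ∏ k ∈ Finset.range t, (a - b - k - 2)) •
        ((a - b - t - 2) • od j i • m + (t + 1 : K) • ev j i • (od i i - od j j) • m) := by
  have ha1 : ev i i • od j i • m = (a - 1) • od j i • m := by
    have h := H.ev_od i i j i
    simp only [hij, if_false, if_true, zero_sub] at h
    rw [← mul_smul, h, add_smul, mul_smul, ha, neg_smul, smul_scalar_comm]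
    generalize od j i • m = z0
    module
  have hb1 : ev j j • od j i • m = (b + 1) • od j i • m := by
    have h := H.ev_od j j j i
    simp only [hij, if_false, if_true, sub_zero] at h
    rw [← mul_smul, h, add_smul, mul_smul, hb, smul_scalar_comm]
    generalize od j i • m = z0
    module
  have hk : ev i j • od j i • m = (od i i - od j j) • m := by
    have h := H.ev_od i j j i
    simp only [if_true] at h
    rw [← mul_smul, h, add_smul, mul_smul, hm, smul_zero, zero_add]
  have ha2 : ev i i • (od i i - od j j) • m = a • (od i i - od j j) • m := by
    have h := H.ev_od i i i i
    have h' := H.ev_od i i j j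
    simp only [hij, hij.symm, if_false, if_true, sub_self, add_zero] at h h'
    rw [← mul_smul, mul_sub, h, h', ← sub_mul, mul_smul, ha, smul_scalar_comm]
  have hb2 : ev j j • (od i i - od j j) • m = b • (od i i - od j j) • m := by
    have h := H.ev_od j j i i
    have h' := H.ev_od j j j j
    simp only [hij, hij.symm, if_false, if_true, sub_self, add_zero] at h h'
    rw [← mul_smul, mul_sub, h, h', ← sub_mul, mul_smul, hb, smul_scalar_comm]
  have hm2 : ev i j • (od i i - od j j) • m = 0 := by
    have h := H.ev_od i j i i
    have h' := H.ev_od i j j j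
    simp only [hij.symm, if_false, if_true, sub_zero, zero_sub] at h h'
    rw [← mul_smul, mul_sub, h, h', sub_smul, add_smul, add_smul, neg_smul, mul_smul, mul_smul,
      hm, hm']
    simp
  induction t with
  | zero =>
    rw [zero_add, pow_one, pow_one, ← pow_one (ev j i)]
    have := ev_smul_pow H hij ha1 hb1 0
    rw [zero_add] at this
    rw [this, hk]
    simp only [pow_zero, one_smul, Nat.factorial, Finset.range_zero, Finset.prod_empty, pow_one]
    push_cast
    generalize ev j i • (od i i - od j j) • m = z0, od j i • m = z1
    module
  | succ t ih =>
    have hy := ev_pow_smul_pow H hij ha2 hb2 hm2 (t + 1) 1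
    simp only [Nat.cast_one, pow_one] at hy
    rw [pow_succ (ev i j), mul_smul, ev_smul_pow H hij ha1 hb1 (t + 1), hk, smul_add,
      smul_scalar_comm, ih, hy, prod_range_factorial, Finset.prod_range_succ',
      Finset.prod_range_succ _ t]
    have e : ∀ k : ℕ, a - b - (((k + 1 : ℕ) : K) + 1) = a - b - k - 2 := fun k => by
      push_cast; ring
    simp only [e]
    rw [Nat.factorial_succ (t + 1)]
    push_cast
    generalize ev j i • (od i i - od j j) • m = z0, od j i • m = z1
    module

/-- The scalar by which `block i j * block j i` acts on a singular vector of weight `(a, b)`. -/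
def rootScalar (p : ℕ) (a b : K) : K :=
  ((p - 1).factorial : K) * (∏ k ∈ Finset.range (p - 1), (a - b - (k + 1))) * (a + b)

/-- For t + 2 = p the coefficients of `ev_pow_smul_pow_od` become a - b and -1 in K. Applying `od i
j` turns both remaining vectors into (a + b) m, the second because (od i i - od j j) ^ 2 = ev i i +
ev j j. The resulting a - b - 1 is the factor k = 0 absent from the product over k < t. -/
theorem block_smul_block (H : IsQueerFamily p ev od) [CharP K p] (hp : 2 ≤ p) (hij : i ≠ j)
    {a b : K} (ha : ev i i • m = a • m) (hb : ev j j • m = b • m) (hm : ev i j • m = 0)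
    (hm' : od i j • m = 0) :
    block p ev od i j • block p ev od j i • m = rootScalar p a b • m := by
  obtain ⟨t, rfl⟩ := Nat.exists_eq_add_of_le' hp
  have hp0 : (t : K) + 2 = 0 := by exact_mod_cast CharP.cast_eq_zero K (t + 2)
  have ht : (t : K) + 1 = -1 := by linear_combination hp0
  have ht' : a - b - t - 2 = a - b := by linear_combination -hp0
  have h1 := H.od_od i j j i
  have h2 := H.od_ev i j j i
  have h3 := H.od_od i j i i
  have h4 := H.od_od i j j j
  have h5 := H.od_od i i j j
  simp only [hij, hij.symm, if_false, if_true, add_zero, zero_add] at h1 h2 h3 h4 h5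
  set k := od i i - od j j with hkdef
  have hkk : k * k = ev i i + ev j j := by
    rw [hkdef, mul_sub, sub_mul, sub_mul, H.od_diag, H.od_diag, h5]
    abel
  have e1 : od i j • od j i • m = (a + b) • m := by
    rw [← mul_smul, h1, add_smul, add_smul, neg_smul, mul_smul, hm', ha, hb, smul_zero]
    module
  have e2 : od i j • k • m = 0 := by
    rw [hkdef, ← mul_smul, mul_sub, h3, h4, sub_smul, add_smul, add_smul, neg_smul, neg_smul,
      mul_smul, mul_smul, hm']
    simp
  have e3 : od i j • ev j i • k • m = (a + b) • m := by
    rw [← mul_smul, h2, add_smul, mul_smul, e2, smul_zero, zero_add, ← mul_smul, hkk, add_smul,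
      ha, hb]
    module
  rw [block, block, ((H.commute_ev_od hij).pow_left _).eq, mul_smul, mul_smul (ev j i ^ _)]
  simp only [Nat.add_succ_sub_one]
  rw [ev_pow_smul_pow_od H hij ha hb hm hm' t, ht, ht', smul_scalar_comm, smul_add,
    smul_scalar_comm, smul_scalar_comm, e1, e3, rootScalar]
  simp only [Nat.add_succ_sub_one]
  rw [Finset.prod_range_succ']
  have e : ∀ k : ℕ, a - b - (((k + 1 : ℕ) : K) + 1) = a - b - k - 2 := fun k => by
    push_cast; ring
  simp only [e]
  push_cast
  module

/-- The block has weight p times a root, which is zero in characteristic p. -/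
theorem ev_diag_commute_block (H : IsQueerFamily p ev od) [CharP K p] (hp : 1 ≤ p)
    (i j k : Fin n) : Commute (ev k k) (block p ev od i j) := by
  set c : K := (if k = i then 1 else 0) - if j = k then 1 else 0 with hc
  have h1 : ev k k * ev i j = ev i j * ev k k + c • ev i j := by
    rw [H.ev_ev, hc]
    split_ifs with h h' h' <;> (try subst h) <;> (try subst h') <;> simp
  have h2 : ev k k * od i j = od i j * ev k k + c • od i j := by
    rw [H.ev_od, hc]
    split_ifs with h h' h' <;> (try subst h) <;> (try subst h') <;> simp
  have h3 : ∀ r : ℕ, ev k k * ev i j ^ r = ev i j ^ r * ev k k + (r * c) • ev i j ^ r := by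
    intro r
    induction r with
    | zero => simp
    | succ r ih =>
      rw [pow_succ, ← mul_assoc, ih, add_mul, mul_assoc, h1, mul_add, mul_smul_comm,
        smul_mul_assoc, ← mul_assoc]
      push_cast
      module
  have h4 : ((p - 1 : ℕ) : K) * c + c = 0 := by
    rw [Nat.cast_sub hp, CharP.cast_eq_zero K p]
    ring
  rw [Commute, SemiconjBy, block, ← mul_assoc, h3, add_mul, mul_assoc, h2, mul_add,
    mul_smul_comm, smul_mul_assoc, add_assoc, ← add_smul, add_comm c, h4, zero_smul, add_zero,
    mul_assoc]

/-- All correction terms vanish: bracketing with a factor `ev i j` creates a second `od i j`, whose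
square is zero, and bracketing with `od i j` creates the power `ev i j ^ p`. -/
theorem od_diag_mul_block (H : IsQueerFamily p ev od) (hp : 1 ≤ p) (hij : i ≠ j)
    (k : Fin n) : od k k * block p ev od i j = -(block p ev od i j * od k k) := by
  have h1 : ∃ c : ℤ, od k k * ev i j = ev i j * od k k + c • od i j := by
    refine ⟨(if k = i then 1 else 0) - if j = k then 1 else 0, ?_⟩
    rw [H.od_ev]
    split_ifs with h h' h' <;> (try subst h) <;> (try subst h') <;> simp
  have h2 : ∃ c : ℤ, od k k * od i j = -(od i j * od k k) + c • ev i j := by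
    refine ⟨(if k = i then 1 else 0) + if j = k then 1 else 0, ?_⟩
    rw [H.od_od]
    split_ifs with h h' h' <;> (try subst h) <;> (try subst h') <;> simp [two_mul]
  obtain ⟨c, h1⟩ := h1
  obtain ⟨d, h2⟩ := h2
  have h3 : ∀ r : ℕ, od k k * (ev i j ^ r * od i j) = ev i j ^ r * (od k k * od i j) := by
    intro r
    induction r with
    | zero => simp
    | succ r ih =>
      rw [pow_succ', mul_assoc, ← mul_assoc (od k k), h1, add_mul, mul_assoc, ih, smul_mul_assoc,
        ← mul_assoc (od i j), ((H.commute_ev_od hij).pow_left r).symm.eq, mul_assoc (_ ^ r),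
        H.od_mul_self i j hij]
      simp [mul_assoc]
  rw [block, h3, h2, mul_add, mul_smul_comm, pow_sub_one_mul (by omega), H.ev_pow i j hij,
    mul_assoc]
  simp

theorem ev_diag_commute_negProd (H : IsQueerFamily p ev od) [CharP K p] (hp : 1 ≤ p)
    (L : List (Fin n × Fin n)) (k : Fin n) :
    Commute (ev k k) (negProd p ev od L) := by
  induction L with
  | nil => exact Commute.one_right _
  | cons β L ih => exact ih.mul_right (ev_diag_commute_block (K := K) H hp _ _ k)

theorem od_diag_mul_negProd (H : IsQueerFamily p ev od) (hp : 1 ≤ p) (hL : IsRootList L)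
    (k : Fin n) :
    ∃ s : ℤ, od k k * negProd p ev od L = s • (negProd p ev od L * od k k) := by
  induction L with
  | nil => exact ⟨1, by simp [negProd]⟩
  | cons β L ih =>
    obtain ⟨s, hs⟩ := ih hL.1
    refine ⟨-s, ?_⟩
    rw [negProd, ← mul_assoc, hs, smul_mul_assoc, mul_assoc, od_diag_mul_block H hp hL.2.1.ne',
      mul_neg, neg_smul, smul_neg, mul_assoc]

theorem IsWeight.smul_of_commute {μ : Fin n → K} {r : R} (hm : IsWeight ev μ m)
    (hr : ∀ k, Commute (ev k k) r) : IsWeight ev μ (r • m) := by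
  intro k
  rw [← mul_smul, (hr k).eq, mul_smul, hm k, smul_scalar_comm]

/-- The product of the scalars attached to the roots in `L`. -/
def weightScalar (p : ℕ) (μ : Fin n → K) (L : List (Fin n × Fin n)) : K :=
  (L.map fun β => rootScalar p (μ β.1) (μ β.2)).prod

/-- The head β contributes the innermost negative and the outermost positive block. After the
negative block the vector is singular for the index set of the tail and has unchanged weight, so the
tail contributes its scalar by induction; the two blocks of β then meet and contribute theirs. -/
theorem posProd_smul_negProd (H : IsQueerFamily p ev od) [CharP K p] (hp : 2 ≤ p)
    (hL : IsRootList L) {μ : Fin n → K} (hw : IsWeight ev μ m)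
    (hm : Killed ev od (mixedRoots L) m) :
    posProd p ev od L • negProd p ev od L • m = weightScalar p μ L • m := by
  induction L generalizing m with
  | nil => simp [posProd, negProd, weightScalar]
  | cons β L ih =>
    have hk : Killed ev od (mixedRoots L) (block p ev od β.2 β.1 • m) := by
      refine ((hm.mono ?_).block_smul H (by omega) hL.2.1.ne' (normalizes_mixed hL)).mono ?_
      · rintro a b (h | h)
        exacts [Or.inl (List.mem_cons_of_mem _ h), Or.inr h]
      · rintro a b (h | ⟨h, h'⟩)
        · exact Or.inl (Or.inl h)
        · by_cases hβ : (b, a) = β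
          · exact Or.inr ⟨congrArg Prod.snd hβ, congrArg Prod.fst hβ⟩
          · exact Or.inl (Or.inr ⟨h, by simp [hβ, h']⟩)
    have hβ := hm β.1 β.2 (Or.inl (List.mem_cons_self ..))
    rw [posProd, negProd, mul_smul, mul_smul, ih hL.1
      (hw.smul_of_commute fun k => ev_diag_commute_block (K := K) H (by omega) _ _ k) hk,
      smul_scalar_comm, block_smul_block H hp hL.2.1.ne (hw _) (hw _) hβ.1 hβ.2, ← mul_smul,
      weightScalar, weightScalar, List.map_cons, List.prod_cons, mul_comm]

/-- Let the subspace `V` be stable under the root vectors with index outside `Y`, so that the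
submodule it generates is spanned by words in the root vectors with index in `Y`, applied to `V`.
If `z` annihilates the latter from the left, then `z` maps this submodule into `z V`. -/
theorem exists_smul_eq_of_mem_span (H : IsQueerFamily p ev od) {Y : Fin n → Fin n → Prop}
    (hgen : Algebra.adjoin K {r | ∃ i j, r = ev i j ∨ r = od i j} = ⊤)
    {V : Submodule K M} (hV : ∀ i j, ¬Y i j → ∀ v ∈ V, ev i j • v ∈ V ∧ od i j • v ∈ V)
    {z : R} (hz : ∀ i j, Y i j → z * ev i j = 0 ∧ z * od i j = 0) {u : M}
    (hu : u ∈ Submodule.span R (V : Set M)) :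
    ∃ v ∈ V, z • u = z • v := by
  -- `U` is the smallest subspace containing `V` and stable under the root vectors with index in
  -- `Y`.
  let 𝒩 : Set (Submodule K M) :=
    {N | V ≤ N ∧ ∀ i j, Y i j → ∀ m ∈ N, ev i j • m ∈ N ∧ od i j • m ∈ N}
  let U : Submodule K M := sInf 𝒩
  have hVU : V ≤ U := le_sInf fun N hN => hN.1
  have hYU : ∀ i j, Y i j → ∀ m ∈ U, ev i j • m ∈ U ∧ od i j • m ∈ U := fun i j hij m hm =>
    ⟨Submodule.mem_sInf.2 fun N hN => (hN.2 i j hij m (Submodule.mem_sInf.1 hm N hN)).1,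
      Submodule.mem_sInf.2 fun N hN => (hN.2 i j hij m (Submodule.mem_sInf.1 hm N hN)).2⟩
  -- Vectors of `U` that every root vector keeps in `U`. The commutation relations show that `U'`
  -- lies in `𝒩`; minimality then makes `U` stable under all generators, hence under `R`.
  let U' : Submodule K M :=
    { carrier := {m | m ∈ U ∧ ∀ i j, ev i j • m ∈ U ∧ od i j • m ∈ U}
      add_mem' := fun {a b} ha hb => ⟨U.add_mem ha.1 hb.1, fun i j => by
        rw [smul_add, smul_add]
        exact ⟨U.add_mem (ha.2 i j).1 (hb.2 i j).1, U.add_mem (ha.2 i j).2 (hb.2 i j).2⟩⟩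
      zero_mem' := ⟨U.zero_mem, fun i j => by simp⟩
      smul_mem' := fun c a ha => ⟨U.smul_mem c ha.1, fun i j => by
        rw [smul_scalar_comm, smul_scalar_comm]
        exact ⟨U.smul_mem c (ha.2 i j).1, U.smul_mem c (ha.2 i j).2⟩⟩ }
  have ite_mem : ∀ (P : Prop) [Decidable P] (x : R) (m : M), x • m ∈ U →
      (if P then x else 0) • m ∈ U := by
    intro P _ x m hx
    split_ifs
    exacts [hx, by simp]
  have hU' : U ≤ U' := by
    refine sInf_le ⟨fun v hv => ⟨hVU hv, fun i j => ?_⟩, fun a b hab m hm =>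
      ⟨⟨(hYU a b hab m hm.1).1, fun i j => ?_⟩, ⟨(hYU a b hab m hm.1).2, fun i j => ?_⟩⟩⟩
    · by_cases hij : Y i j
      · exact hYU i j hij v (hVU hv)
      · exact ⟨hVU (hV i j hij v hv).1, hVU (hV i j hij v hv).2⟩
    · rw [← mul_smul, ← mul_smul, H.ev_ev, H.od_ev, add_smul, add_smul, sub_smul, sub_smul,
        mul_smul, mul_smul]
      exact ⟨U.add_mem (hYU a b hab _ (hm.2 i j).1).1
          (U.sub_mem (ite_mem _ _ _ (hm.2 _ _).1) (ite_mem _ _ _ (hm.2 _ _).1)),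
        U.add_mem (hYU a b hab _ (hm.2 i j).2).1
          (U.sub_mem (ite_mem _ _ _ (hm.2 _ _).2) (ite_mem _ _ _ (hm.2 _ _).2))⟩
    · rw [← mul_smul, ← mul_smul, H.ev_od, H.od_od, add_smul, add_smul, sub_smul, add_smul,
        neg_smul, mul_smul, mul_smul]
      exact ⟨U.add_mem (hYU a b hab _ (hm.2 i j).1).2
          (U.sub_mem (ite_mem _ _ _ (hm.2 _ _).2) (ite_mem _ _ _ (hm.2 _ _).2)),
        U.add_mem (U.neg_mem (hYU a b hab _ (hm.2 i j).2).2)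
          (U.add_mem (ite_mem _ _ _ (hm.2 _ _).1) (ite_mem _ _ _ (hm.2 _ _).1))⟩
  have hRU : ∀ r : R, ∀ m ∈ U, r • m ∈ U := by
    intro r
    have hr : r ∈ Algebra.adjoin K {r | ∃ i j, r = ev i j ∨ r = od i j} := by
      rw [hgen]; trivial
    induction hr using Algebra.adjoin_induction with
    | mem x hx =>
      obtain ⟨i, j, rfl | rfl⟩ := hx
      exacts [fun m hm => ((hU' hm).2 i j).1, fun m hm => ((hU' hm).2 i j).2]
    | algebraMap c => intro m hm; rw [algebraMap_smul]; exact U.smul_mem c hm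
    | add x y _ _ hx hy => intro m hm; rw [add_smul]; exact U.add_mem (hx m hm) (hy m hm)
    | mul x y _ _ hx hy => intro m hm; rw [mul_smul]; exact hx _ (hy m hm)
  have huU : u ∈ U := by
    induction hu using Submodule.span_induction with
    | mem x hx => exact hVU hx
    | zero => exact U.zero_mem
    | add x y _ _ hx hy => exact U.add_mem hx hy
    | smul r x _ hx => exact hRU r x hx
  let Z : Submodule K M :=
    { carrier := {m | ∃ v ∈ V, z • m = z • v}
      add_mem' := by
        rintro a b ⟨v, hv, h⟩ ⟨v', hv', h'⟩
        exact ⟨v + v', V.add_mem hv hv', by rw [smul_add, smul_add, h, h']⟩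
      zero_mem' := ⟨0, V.zero_mem, rfl⟩
      smul_mem' := by
        rintro c a ⟨v, hv, h⟩
        exact ⟨c • v, V.smul_mem c hv, by rw [smul_scalar_comm, smul_scalar_comm, h]⟩ }
  -- Minimality of `U` again: anything of the form `y • m` with `y` indexed by `Y` is annihilated by
  -- `z`, so the zero vector serves as `v`.
  have hUZ : U ≤ Z := by
    refine sInf_le ⟨fun v hv => ⟨v, hv, rfl⟩, fun i j hij m _ =>
      ⟨⟨0, V.zero_mem, ?_⟩, ⟨0, V.zero_mem, ?_⟩⟩⟩
    · rw [← mul_smul, (hz i j hij).1]; simp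
    · rw [← mul_smul, (hz i j hij).2]; simp
  exact hUZ huU

end RankOne

end QueerSuper

/-! ### Weight decompositions in characteristic p -/

namespace QueerSuper

theorem exists_pow_sub_eq {K : Type*} [Field K] [IsAlgClosed K] {p : ℕ} (hp : 1 < p) (c : K) :
    ∃ a : K, a ^ p - a = c := by
  obtain ⟨a, ha⟩ := IsAlgClosed.exists_root
    (Polynomial.X ^ p - Polynomial.X - Polynomial.C c) (by
      have h1 : (Polynomial.X + Polynomial.C c).degree < (p : WithBot ℕ) := by
        rw [Polynomial.degree_X_add_C]
        exact_mod_cast hp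
      rw [sub_sub, Polynomial.degree_sub_eq_left_of_degree_lt
        (by rwa [Polynomial.degree_X_pow]), Polynomial.degree_X_pow]
      exact_mod_cast (zero_lt_one.trans hp).ne')
  exact ⟨a, by simpa [Polynomial.IsRoot, sub_eq_zero] using ha⟩

section Weights

variable {K : Type*} [Field K] {p : ℕ} [Fact p.Prime] [CharP K p]

theorem natCast_pow_char (k : ℕ) : (k : K) ^ p = k := by
  have := map_natCast (frobenius K p) k
  rwa [frobenius_def] at this

theorem sub_natCast_pow {j k : ℕ} (hj : j < p) (hk : k < p) (hjk : j ≠ k) :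
    ((j : K) - k) ^ (p - 1) = 1 := by
  have hne : (j : K) - k ≠ 0 := by
    rw [sub_ne_zero]
    exact fun h => hjk (CharP.natCast_injOn_Iio K p hj hk h)
  refine mul_right_cancel₀ hne ?_
  rw [pow_sub_one_mul (Fact.out : p.Prime).ne_zero, sub_pow_char, natCast_pow_char,
    natCast_pow_char, one_mul]

open Polynomial in
-- Lagrange interpolation on the prime field: by Fermat the k-th summand takes the value 1 at k and
-- 0 at the other residues, and a polynomial of degree less than p is determined by its values at p
-- points.
theorem sum_one_sub_pow {R : Type*} [Ring R] [Algebra K R] (x : R) :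
    ∑ k ∈ Finset.range p, (1 - (x - (k : R)) ^ (p - 1)) = 1 := by
  classical
  have hp := (Fact.out : p.Prime)
  have key : (∑ k ∈ Finset.range p, (1 - (X - (k : K[X])) ^ (p - 1))) - 1 = 0 := by
    refine eq_zero_of_degree_lt_of_eval_finset_eq_zero (s := (Finset.range p).image
      (fun k : ℕ => (k : K))) ?_ ?_
    · rw [Finset.card_image_of_injOn
        (by simpa [Finset.coe_range] using CharP.natCast_injOn_Iio K p), Finset.card_range]
      have hlt : ∀ q : K[X], q.degree ≤ ((p - 1 : ℕ) : WithBot ℕ) → q.degree < (p : ℕ) :=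
        fun q hq => hq.trans_lt (by exact_mod_cast Nat.sub_lt hp.pos one_pos)
      refine hlt _ ((degree_sub_le _ _).trans (max_le ((degree_sum_le _ _).trans ?_) ?_))
      · refine Finset.sup_le fun k _ => (degree_sub_le _ _).trans (max_le ?_ ?_)
        · exact degree_one_le.trans (by exact_mod_cast Nat.zero_le _)
        · refine (degree_pow_le _ _).trans ?_
          rw [← C_eq_natCast, degree_X_sub_C]
          simp
      · exact degree_one_le.trans (by exact_mod_cast Nat.zero_le _)
    · intro y hy
      obtain ⟨j, hj, rfl⟩ := Finset.mem_image.1 hy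
      rw [eval_sub, eval_finsetSum, Finset.sum_eq_single j]
      · simp [(Nat.sub_pos_of_lt hp.one_lt).ne']
      · intro k hk hkj
        simp [sub_natCast_pow (Finset.mem_range.1 hj) (Finset.mem_range.1 hk) hkj.symm]
      · exact fun h => (h hj).elim
  have := congrArg (aeval x) key
  simp only [map_sub, map_sum, map_one, map_pow, aeval_X, map_natCast, map_zero] at this
  exact sub_eq_zero.1 this

open Polynomial in
-- Translation by a root of T ^ p - T - d turns the Artin-Schreier equation into y ^ p = y.
theorem sub_algebraMap_pow {R : Type*} [Ring R] [Algebra K R] {x : R} {d b : K}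
    (hx : x ^ p = x + algebraMap K R d) (hb : b ^ p - b = d) :
    (x - algebraMap K R b) ^ p = x - algebraMap K R b := by
  have := congrArg (aeval x) (sub_pow_char (X : K[X]) (C b) (p := p))
  rw [← C_pow] at this
  simp only [map_sub, map_pow, aeval_X, aeval_C] at this
  rw [this, hx, ← map_pow, ← hb, map_sub]
  abel

theorem IsQueerFamily.commute_diag {p : ℕ} {R : Type*} [Ring R] {n : ℕ} {ev od : Fin n → Fin n → R}
    (H : IsQueerFamily p ev od) (i j : Fin n) : Commute (ev i i) (ev j j) := by
  have := H.ev_ev i i j j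
  by_cases h : i = j
  · subst h; exact Commute.refl _
  · simpa [h, Ne.symm h, Commute, SemiconjBy] using this

variable {R : Type*} [Ring R] [Algebra K R] {n : ℕ}
  {ev od : Fin n → Fin n → R} {M : Type*} [AddCommGroup M] [Module K M] [Module R M]
  [IsScalarTower K R M] {c : Fin n → K} {L : List (Fin n × Fin n)}

/-- The commuting elements `ev i i` satisfy Artin-Schreier equations, whose polynomials split with
distinct roots, so a stable subspace is spanned by its weight vectors without any finiteness
assumption. In the induction, `s` is the set of indices for which `m` is not yet known to be an
eigenvector. -/
theorem le_of_forall_isWeight [IsAlgClosed K] (H : IsQueerFamily p ev od)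
    (hdiag : ∀ i, ev i i ^ p = ev i i + algebraMap K R (c i ^ p)) {Q G : Submodule K M}
    (hQ : ∀ i, ∀ m ∈ Q, ev i i • m ∈ Q)
    (hG : ∀ μ : Fin n → K, (∀ i, μ i ^ p - μ i = c i ^ p) → ∀ m ∈ Q, IsWeight ev μ m → m ∈ G) :
    Q ≤ G := by
  have hp := (Fact.out : p.Prime)
  have key : ∀ s : Finset (Fin n), ∀ m ∈ Q,
      (∀ i ∉ s, ∃ b : K, b ^ p - b = c i ^ p ∧ ev i i • m = b • m) → m ∈ G := by
    intro s
    induction s using Finset.induction_on with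
    | empty =>
      intro m hm h
      choose μ hμ hμ' using fun i => h i (Finset.notMem_empty i)
      exact hG μ hμ m hm hμ'
    | insert i s hi ih =>
      intro m hm h
      obtain ⟨a, ha⟩ := exists_pow_sub_eq hp.one_lt (c i ^ p)
      have hsum := congrArg (· • m)
        (sum_one_sub_pow (K := K) (p := p) (ev i i - algebraMap K R a))
      simp only [Finset.sum_smul, one_smul] at hsum
      rw [← hsum]
      refine G.sum_mem fun k _ => ?_
      have e : ev i i - algebraMap K R a - (k : R) = ev i i - algebraMap K R (a + k) := by
        rw [map_add, map_natCast]; abel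
      rw [e]
      -- The roots of T ^ p - T = c i ^ p form a translate of the prime field, so each summand is a
      -- projection onto the eigenspace of one of them.
      have hb : (a + k) ^ p - (a + k) = c i ^ p := by
        rw [add_pow_char, natCast_pow_char, ← ha]; ring
      generalize a + k = b at hb
      have hQy : ∀ m ∈ Q, (ev i i - algebraMap K R b) • m ∈ Q := fun m hm => by
        rw [sub_smul, algebraMap_smul]
        exact Q.sub_mem (hQ i m hm) (Q.smul_mem b hm)
      have hQy' : ∀ r : ℕ, (ev i i - algebraMap K R b) ^ r • m ∈ Q := by
        intro r
        induction r with
        | zero => simpa using hm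
        | succ r ihr => rw [pow_succ', mul_smul]; exact hQy _ ihr
      refine ih _ ?_ fun j hj => ?_
      · rw [sub_smul, one_smul]
        exact Q.sub_mem hm (hQy' _)
      · by_cases hji : j = i
        · subst hji
          refine ⟨b, hb, ?_⟩
          rw [← algebraMap_smul R b, ← sub_eq_zero, ← sub_smul, ← mul_smul, mul_sub, mul_one,
            mul_pow_sub_one hp.ne_zero, sub_algebraMap_pow (hdiag j) hb, sub_self, zero_smul]
        · obtain ⟨b', hb', hm'⟩ := h j (by simp [hji, hj])
          refine ⟨b', hb', ?_⟩
          have hc : Commute (ev j j) (1 - (ev i i - algebraMap K R b) ^ (p - 1)) :=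
            (Commute.one_right _).sub_right (((H.commute_diag j i).sub_right
              (Algebra.commutes b (ev j j)).symm).pow_right _)
          rw [← mul_smul, hc.eq, mul_smul, hm', smul_scalar_comm]
  exact fun m hm => key Finset.univ m hm (fun i hi => (hi (Finset.mem_univ i)).elim)

/-- If a - b is in the prime field then a ^ p - a = b ^ p - b, so x ^ p = y ^ p; if a + b = 0 then x
^ p = -y ^ p. Injectivity of Frobenius excludes both. -/
theorem rootScalar_ne_zero {a b x y : K} (ha : a ^ p - a = x ^ p) (hb : b ^ p - b = y ^ p)
    (h1 : x ≠ y) (h2 : x ≠ -y) : rootScalar p a b ≠ 0 := by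
  have hp := (Fact.out : p.Prime)
  refine mul_ne_zero (mul_ne_zero ?_ (Finset.prod_ne_zero_iff.2 fun k _ hk => h1 ?_))
    (fun h => h2 ?_)
  · intro h
    rw [CharP.cast_eq_zero_iff K p, hp.dvd_factorial] at h
    have := hp.pos
    omega
  · have h : a = b + (k + 1 : ℕ) := by push_cast; linear_combination hk
    refine frobenius_inj K p ?_
    rw [frobenius_def, frobenius_def, ← ha, ← hb, h, add_pow_char, natCast_pow_char]
    ring
  · have h : a = -b := by linear_combination h
    refine frobenius_inj K p ?_
    rw [map_neg, frobenius_def, frobenius_def, ← ha, ← hb, h, ← frobenius_def, map_neg,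
      frobenius_def]
    ring

theorem weightScalar_ne_zero {μ : Fin n → K} (hμ : ∀ i, μ i ^ p - μ i = c i ^ p)
    (hc : ∀ i j, i ≠ j → c i ≠ c j ∧ c i ≠ -c j) (hL : ∀ β ∈ L, β.1 ≠ β.2) :
    weightScalar p μ L ≠ 0 := by
  rw [weightScalar, Ne, List.prod_eq_zero_iff, List.mem_map]
  rintro ⟨β, hβ, h⟩
  exact rootScalar_ne_zero (hμ _) (hμ _) (hc _ _ (hL β hβ)).1 (hc _ _ (hL β hβ)).2 h

variable (K M) in
/-- The subspace of singular vectors. -/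
def singular (ev od : Fin n → Fin n → R) : Submodule K M where
  carrier := {m | Killed ev od (fun a b => a < b) m}
  add_mem' hx hy _ _ hab := by simp [hx _ _ hab, hy _ _ hab]
  zero_mem' _ _ _ := by simp
  smul_mem' _ _ hx _ _ hab := by simp [smul_scalar_comm, hx _ _ hab]

theorem mem_singular {m : M} :
    m ∈ singular K M ev od ↔ Killed ev od (fun a b => a < b) m := Iff.rfl

theorem normalizes_diag (i : Fin n) : Normalizes i i (fun a b : Fin n => a < b) :=
  fun a b h => ⟨fun h' => h' ▸ h, fun h' => h' ▸ h⟩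

/-- On each weight space the operator is a nonzero scalar, so it is surjective on any Cartan-stable
space of singular vectors. -/
theorem exists_posProd_smul_negProd_smul_eq [IsAlgClosed K] (H : IsQueerFamily p ev od)
    (hdiag : ∀ i, ev i i ^ p = ev i i + algebraMap K R (c i ^ p))
    (hc : ∀ i j, i ≠ j → c i ≠ c j ∧ c i ≠ -c j) (hL : IsRootList L)
    (hall : ∀ γ, γ ∈ L ↔ γ.1 < γ.2) {Q : Submodule K M} (hQs : Q ≤ singular K M ev od)
    (hQ : ∀ i, ∀ m ∈ Q, ev i i • m ∈ Q) {m : M} (hm : m ∈ Q) :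
    ∃ w ∈ Q, posProd p ev od L • negProd p ev od L • w = m := by
  let G : Submodule K M :=
    { carrier := {m | ∃ w ∈ Q, posProd p ev od L • negProd p ev od L • w = m}
      add_mem' := by
        rintro a b ⟨v, hv, rfl⟩ ⟨v', hv', rfl⟩
        exact ⟨v + v', Q.add_mem hv hv', by rw [smul_add, smul_add]⟩
      zero_mem' := ⟨0, Q.zero_mem, by simp⟩
      smul_mem' := by
        rintro c a ⟨v, hv, rfl⟩
        exact ⟨c • v, Q.smul_mem c hv, by rw [smul_scalar_comm, smul_scalar_comm]⟩ }
  refine le_of_forall_isWeight (G := G) H hdiag hQ (fun μ hμ m hm hw => ?_) hm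
  refine ⟨(weightScalar p μ L)⁻¹ • m, Q.smul_mem _ hm, ?_⟩
  rw [smul_scalar_comm, smul_scalar_comm, posProd_smul_negProd H (Fact.out : p.Prime).two_le hL hw,
    ← mul_smul, inv_mul_cancel₀ (weightScalar_ne_zero hμ hc fun β hβ => ((hall β).1 hβ).ne),
    one_smul]
  refine (mem_singular.1 (hQs hm)).mono fun a b h => ?_
  rcases h with h | ⟨h, h'⟩
  exacts [(hall _).1 h, (h' ((hall _).2 h)).elim]

end Weights

/-! ### Complete reducibility for the odd Cartan elements -/

section Clifford

variable {K : Type*} [Field K] {p : ℕ} [Fact p.Prime] [CharP K p] {n : ℕ}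
  {W : Type*} [AddCommGroup W] [Module K W]

/-- A subspace stable under anticommuting operators `t i`, whose squares `h i` satisfy
`h i ^ p = h i + d i` with `d i ≠ 0`, has a stable complement. -/
theorem exists_stable_isCompl (hp : 2 < p) (t : Fin n → Module.End K W) {d : Fin n → K}
    (ht : ∀ i j, i ≠ j → t i * t j = -(t j * t i)) (hd : ∀ i, d i ≠ 0)
    (htd : ∀ i, (t i * t i) ^ p = t i * t i + algebraMap K (Module.End K W) (d i))
    (V : Submodule K W) (hV : ∀ i, ∀ v ∈ V, t i v ∈ V) :
    ∃ V' : Submodule K W, IsCompl V V' ∧ ∀ i, ∀ v ∈ V', t i v ∈ V' := by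
  have hpr := (Fact.out : p.Prime)
  have h2 : (2 : K) ≠ 0 := by
    intro h
    have : ((2 : ℕ) : K) = 0 := by exact_mod_cast h
    rw [CharP.cast_eq_zero_iff K p] at this
    exact absurd (Nat.le_of_dvd two_pos this) (by omega)
  let IsProj : Module.End K W → Prop := fun π => (∀ x, π x ∈ V) ∧ ∀ x ∈ V, π x = x
  have hcomm : ∀ i j, Commute (t i * t i) (t j) := by
    intro i j
    by_cases hij : i = j
    · subst hij; exact (mul_assoc _ _ _)
    · rw [Commute, SemiconjBy, mul_assoc, ht i j hij, mul_neg, ← mul_assoc, ht i j hij, neg_mul,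
        neg_neg, mul_assoc]
  -- First a projection commuting with the squares. Since D = ad h satisfies D ^ p = D, the operator
  -- 1 - D ^ (p - 1) sends any endomorphism into the commutant of h.
  have step1 : ∀ s : Finset (Fin n), ∃ π, IsProj π ∧ ∀ i ∈ s, Commute (t i * t i) π := by
    intro s
    induction s using Finset.induction_on with
    | empty =>
      obtain ⟨f, hf⟩ := V.subtype.exists_leftInverse_of_injective V.ker_subtype
      refine ⟨V.subtype ∘ₗ f, ⟨fun x => (f x).2, fun x hx => ?_⟩, by simp⟩
      have := LinearMap.congr_fun hf ⟨x, hx⟩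
      simpa using congrArg Subtype.val this
    | insert i s hi ih =>
      obtain ⟨π, ⟨hπ1, hπ2⟩, hπ⟩ := ih
      set h := t i * t i with hh
      have hVh : ∀ v ∈ V, h v ∈ V := fun v hv => hV i _ (hV i v hv)
      let D : Module.End K (Module.End K W) := LinearMap.mulLeft K h - LinearMap.mulRight K h
      have hD : ∀ φ, D φ = h * φ - φ * h := fun φ => rfl
      -- Left and right multiplication by h commute, so the p-th power of their difference is the
      -- difference of the p-th powers, and the central constants `d i` cancel.
      have hDp : D ^ p = D := by
        have hLR : Commute (LinearMap.mulLeft K h) (LinearMap.mulRight K h) :=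
          LinearMap.ext fun φ => (mul_assoc h φ h).symm
        obtain ⟨r, hr⟩ := hLR.neg_right.exists_add_pow_prime_eq hpr
        have hp0 : ((p : ℕ) : Module.End K (Module.End K W)) = 0 := by
          rw [← map_natCast (algebraMap K _), CharP.cast_eq_zero, map_zero]
        rw [← sub_eq_add_neg, hp0, zero_mul, zero_mul, zero_mul, add_zero,
          (hpr.odd_of_ne_two (by omega)).neg_pow, LinearMap.pow_mulLeft, LinearMap.pow_mulRight,
          htd] at hr
        rw [hr]
        ext φ : 1
        simp only [LinearMap.add_apply, LinearMap.neg_apply, LinearMap.mulLeft_apply,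
          LinearMap.mulRight_apply, hD, add_mul, mul_add, Algebra.commutes]
        abel
      -- On `V` the projection is the identity and h preserves `V`, so iterated commutators with h
      -- vanish on `V` and still take values in it. Subtracting one leaves a projection onto `V`.
      have hDr : ∀ r : ℕ, (∀ x, (D ^ (r + 1)) π x ∈ V) ∧ (∀ x ∈ V, (D ^ (r + 1)) π x = 0) ∧
          ∀ j ∈ s, Commute (t j * t j) ((D ^ (r + 1)) π) := by
        have hc : ∀ j φ, Commute (t j * t j) φ → Commute (t j * t j) (D φ) := by
          intro j φ hφ
          have hjh : Commute (t j * t j) h := (hcomm j i).mul_right (hcomm j i)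
          exact (hjh.mul_right hφ).sub_right (hφ.mul_right hjh)
        intro r
        induction r with
        | zero =>
          rw [zero_add, pow_one]
          refine ⟨fun x => ?_, fun x hx => ?_, fun j hj => hc j π (hπ j hj)⟩
          · rw [hD]
            exact V.sub_mem (hVh _ (hπ1 x)) (hπ1 _)
          · change h (π x) - π (h x) = 0
            rw [hπ2 x hx, hπ2 _ (hVh x hx), sub_self]
        | succ r ih =>
          obtain ⟨h1, h2, h3⟩ := ih
          rw [pow_succ', Module.End.mul_apply]
          refine ⟨fun x => ?_, fun x hx => ?_, fun j hj => hc j _ (h3 j hj)⟩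
          · rw [hD]
            exact V.sub_mem (hVh _ (h1 x)) (h1 _)
          · change h ((D ^ (r + 1)) π x) - (D ^ (r + 1)) π (h x) = 0
            rw [h2 x hx, h2 _ (hVh x hx), map_zero, sub_zero]
      obtain ⟨h1, h2, h3⟩ := hDr (p - 2)
      rw [show p - 2 + 1 = p - 1 by omega] at h1 h2 h3
      refine ⟨π - (D ^ (p - 1)) π, ⟨fun x => V.sub_mem (hπ1 x) (h1 x), fun x hx => ?_⟩, ?_⟩
      · rw [LinearMap.sub_apply, h2 x hx, hπ2 x hx, sub_zero]
      · intro j hj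
        rcases Finset.mem_insert.1 hj with rfl | hj
        · refine sub_eq_zero.1 ((hD _).symm.trans ?_)
          rw [map_sub, ← Module.End.mul_apply, mul_pow_sub_one hpr.ne_zero, hDp, sub_self]
        · exact (hπ j hj).sub_right (h3 j hj)
  -- Next the projection is averaged with its conjugate by `t i`. This is possible because 2 and `t
  -- i` are invertible, and anticommutation preserves what was achieved for the earlier indices.
  have step2 : ∀ s : Finset (Fin n), ∃ π, IsProj π ∧ (∀ i, Commute (t i * t i) π) ∧
      ∀ i ∈ s, Commute (t i) π := by
    intro s
    induction s using Finset.induction_on with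
    | empty =>
      obtain ⟨π, h1, h2⟩ := step1 Finset.univ
      exact ⟨π, h1, fun i => h2 i (Finset.mem_univ i), by simp⟩
    | insert i s hi ih =>
      obtain ⟨π, ⟨hπ1, hπ2⟩, hπh, hπ⟩ := ih
      -- The inverse of h = t i * t i is read off from h (h ^ (p - 1) - 1) = d i. Being a polynomial
      -- in h, it commutes with whatever h commutes with.
      obtain ⟨q, hq, hqc⟩ : ∃ q, t i * t i * q = 1 ∧ ∀ φ, Commute (t i * t i) φ → Commute q φ := by
        refine ⟨(d i)⁻¹ • ((t i * t i) ^ (p - 1) - 1), ?_, fun φ hφ => ?_⟩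
        · rw [mul_smul_comm, mul_sub, mul_pow_sub_one hpr.ne_zero, htd, mul_one, add_sub_cancel_left,
            Algebra.algebraMap_eq_smul_one, smul_smul, inv_mul_cancel₀ (hd i), one_smul]
        · exact ((hφ.pow_left _).sub_left (Commute.one_left φ)).smul_left _
      have hqt : ∀ j, Commute q (t j) := fun j => hqc _ (hcomm i j)
      have hqπ : Commute q π := hqc _ (hπh i)
      have hVq : ∀ v ∈ V, t i (t i (q v)) = v := fun v _ => by
        rw [← Module.End.mul_apply, ← Module.End.mul_apply, hq, Module.End.one_apply]
      have e1 : t i * (t i * π * t i * q) = π * t i := by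
        rw [← mul_assoc, ← mul_assoc, ← mul_assoc, (hπh i).eq, mul_assoc _ (t i) q,
          ← (hqt i).eq, ← mul_assoc, mul_assoc π, hq, mul_one]
      have e2 : (t i * π * t i * q) * t i = t i * π := by
        rw [mul_assoc, (hqt i).eq, ← mul_assoc, mul_assoc (t i * π), mul_assoc, hq, mul_one]
      refine ⟨(2⁻¹ : K) • (π + t i * π * t i * q), ⟨fun x => ?_, fun x hx => ?_⟩, fun j => ?_,
        fun j hj => ?_⟩
      · exact V.smul_mem _ (V.add_mem (hπ1 x) (hV i _ (hπ1 _)))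
      · have hqx : π (t i (q x)) = t i (q x) := by
          have h1 : q (t i x) = t i (q x) := LinearMap.congr_fun (hqt i).eq x
          have h2 : q (π (t i x)) = π (q (t i x)) := LinearMap.congr_fun hqπ.eq (t i x)
          rw [← h1, ← h2, hπ2 _ (hV i x hx)]
        simp only [LinearMap.smul_apply, LinearMap.add_apply, Module.End.mul_apply]
        rw [hqx, hVq x hx, hπ2 x hx, ← two_smul K, smul_smul, inv_mul_cancel₀ h2, one_smul]
      · exact ((hπh j).add_right ((((hcomm j i).mul_right (hπh j)).mul_right (hcomm j i)).mul_right
          (hqc _ ((hcomm j i).mul_right (hcomm j i)).symm).symm)).smul_right _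
      · refine Commute.smul_right ?_ _
        rcases Finset.mem_insert.1 hj with rfl | hj
        · rw [Commute, SemiconjBy, mul_add, add_mul, e1, e2, add_comm]
        · have hji : j ≠ i := fun h => hi (h ▸ hj)
          refine (hπ j hj).add_right ?_
          calc t j * (t i * π * t i * q) = t j * t i * π * t i * q := by simp only [mul_assoc]
            _ = -(t i * (t j * π) * t i * q) := by
              rw [ht j i hji]; simp only [neg_mul, mul_assoc]
            _ = -(t i * π * (t j * t i) * q) := by
              rw [(hπ j hj).eq]; simp only [mul_assoc]
            _ = t i * π * t i * (t j * q) := by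
              rw [ht j i hji]; simp only [mul_neg, neg_mul, neg_neg, mul_assoc]
            _ = t i * π * t i * q * t j := by rw [← (hqt j).eq]; simp only [mul_assoc]
  obtain ⟨π, ⟨h1, h2⟩, -, h3⟩ := step2 Finset.univ
  refine ⟨LinearMap.ker π, ?_, fun i v hv => ?_⟩
  · have := LinearMap.isCompl_of_proj (f := π.codRestrict V h1)
      (fun x => Subtype.ext (h2 x x.2))
    rwa [LinearMap.ker_codRestrict] at this
  · have := LinearMap.congr_fun (h3 i (Finset.mem_univ i)).eq v
    rw [LinearMap.mem_ker] at hv ⊢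
    rw [Module.End.mul_apply, Module.End.mul_apply, hv, map_zero] at this
    exact this.symm

end Clifford

end QueerSuper

/-! ### Singular vectors and regular characters -/

namespace QueerSuper

section Singular

variable {K : Type*} [Field K] {p : ℕ} {R : Type*} [Ring R] [Algebra K R] {n : ℕ}
  {ev od : Fin n → Fin n → R} {M : Type*} [AddCommGroup M] [Module K M] [Module R M]
  [IsScalarTower K R M]

theorem ev_diag_smul_mem_singular (H : IsQueerFamily p ev od) (i : Fin n) :
    ∀ m ∈ singular K M ev od, ev i i • m ∈ singular K M ev od :=
  fun _ hm => Killed.ev_smul H (normalizes_diag i) hm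

theorem od_diag_smul_mem_singular (H : IsQueerFamily p ev od) (i : Fin n) :
    ∀ m ∈ singular K M ev od, od i i • m ∈ singular K M ev od :=
  fun _ hm => Killed.od_smul H (normalizes_diag i) hm

end Singular

section Regular

variable {K : Type*} [Field K] [IsAlgClosed K] {p : ℕ} [Fact p.Prime] [CharP K p]
  {R : Type*} [Ring R] [Algebra K R] {n : ℕ}
  {ev od : Fin n → Fin n → R} {M : Type*} [AddCommGroup M] [Module K M] [Module R M]
  [IsScalarTower K R M] {c : Fin n → K} {L : List (Fin n × Fin n)}

/-- Otherwise the quotient contains a nonzero singular vector, which has the form e f w. Lifting f w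
to `M` and applying e gives a singular vector of `M`, so the image of e f w in the quotient is zero.
-/
theorem span_singular_eq_top (H : IsQueerFamily p ev od)
    (hdiag : ∀ i, ev i i ^ p = ev i i + algebraMap K R (c i ^ p))
    (hc : ∀ i j, i ≠ j → c i ≠ c j ∧ c i ≠ -c j) :
    Submodule.span R (singular K M ev od : Set M) = ⊤ := by
  obtain ⟨L, hL, hall⟩ := exists_isRootList n
  have hp := (Fact.out : p.Prime)
  set P := Submodule.span R (singular K M ev od : Set M) with hP
  by_contra hne
  have : Nontrivial (M ⧸ P) := Submodule.Quotient.nontrivial_iff.2 hne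
  obtain ⟨q, hq0, hq⟩ := exists_killed (M := M ⧸ P) H hL hall
  obtain ⟨w, -, hw⟩ := exists_posProd_smul_negProd_smul_eq (K := K) (M := M ⧸ P)
    (Q := singular K (M ⧸ P) ev od) H hdiag hc hL hall le_rfl (ev_diag_smul_mem_singular H)
    (mem_singular.2 hq)
  obtain ⟨m, hm⟩ := Submodule.Quotient.mk_surjective P (negProd p ev od L • w)
  refine hq0 ?_
  rw [← hw, ← hm, ← Submodule.Quotient.mk_smul, Submodule.Quotient.mk_eq_zero]
  exact Submodule.subset_span ((killed_posProd H hp.pos hL m).mono fun a b h => (hall _).2 h)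

/-- The vector u is e f w with w singular and in the submodule generated by `V`. Modulo `V`, that
submodule is reached by words starting with a negative root vector, which f annihilates from the
left. Hence f w = f v with v in `V`, and e f preserves `V` by its action on weight vectors. -/
theorem mem_of_mem_span_of_mem_singular (H : IsQueerFamily p ev od)
    (hgen : Algebra.adjoin K {r | ∃ i j, r = ev i j ∨ r = od i j} = ⊤)
    (hdiag : ∀ i, ev i i ^ p = ev i i + algebraMap K R (c i ^ p))
    (hc : ∀ i j, i ≠ j → c i ≠ c j ∧ c i ≠ -c j) {V : Submodule K M}
    (hVs : V ≤ singular K M ev od) (hV : ∀ i, ∀ v ∈ V, od i i • v ∈ V) {u : M}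
    (hu : u ∈ Submodule.span R (V : Set M)) (hus : u ∈ singular K M ev od) : u ∈ V := by
  obtain ⟨L, hL, hall⟩ := exists_isRootList n
  have hp := (Fact.out : p.Prime)
  have hVh : ∀ i, ∀ v ∈ V, ev i i • v ∈ V := fun i v hv => by
    rw [← H.od_diag, mul_smul]
    exact hV i _ (hV i v hv)
  obtain ⟨w, hw, rfl⟩ := exists_posProd_smul_negProd_smul_eq (K := K)
    (Q := singular K M ev od ⊓ (Submodule.span R (V : Set M)).restrictScalars K)
    H hdiag hc hL hall inf_le_left
    (fun i m hm => ⟨ev_diag_smul_mem_singular H i m hm.1, (Submodule.span R (V : Set M)).smul_mem _ hm.2⟩)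
    (Submodule.mem_inf.2 ⟨hus, hu⟩)
  obtain ⟨v, hv, hwv⟩ := exists_smul_eq_of_mem_span (K := K) (Y := fun i j => j < i)
    (z := negProd p ev od L) H hgen (fun i j hij v hv => by
      rcases (not_lt.1 hij).eq_or_lt with rfl | h
      · exact ⟨hVh i v hv, hV i v hv⟩
      · have := hVs hv i j h
        rw [this.1, this.2]
        exact ⟨V.zero_mem, V.zero_mem⟩)
    (fun i j hij => negProd_mul H hp.pos hL ((hall _).2 hij)) hw.2
  rw [hwv]
  let G : Submodule K M :=
    { carrier := {m | posProd p ev od L • negProd p ev od L • m ∈ V}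
      add_mem' := fun {a b} ha hb => by
        simpa only [Set.mem_ofPred_eq, smul_add] using V.add_mem ha hb
      zero_mem' := by simp
      smul_mem' := fun c a ha => by
        simpa only [Set.mem_ofPred_eq, smul_scalar_comm] using V.smul_mem c ha }
  refine le_of_forall_isWeight (G := G) H hdiag hVh (fun μ _ m hm hμ => ?_) hv
  change posProd p ev od L • negProd p ev od L • m ∈ V
  rw [posProd_smul_negProd H hp.two_le hL hμ]
  · exact V.smul_mem _ hm
  · refine (mem_singular.1 (hVs hm)).mono fun a b h => ?_
    rcases h with h | ⟨h, h'⟩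
    exacts [(hall _).1 h, (h' ((hall _).2 h)).elim]

/-- Complete reducibility for regular semisimple `p`-characters. -/
theorem exists_isCompl_of_regular (hp2 : 2 < p) (H : IsQueerFamily p ev od)
    (hgen : Algebra.adjoin K {r | ∃ i j, r = ev i j ∨ r = od i j} = ⊤)
    (hdiag : ∀ i, ev i i ^ p = ev i i + algebraMap K R (c i ^ p))
    (hc0 : ∀ i, c i ≠ 0) (hc : ∀ i j, i ≠ j → c i ≠ c j ∧ c i ≠ -c j)
    (N : Submodule R M) : ∃ N' : Submodule R M, IsCompl N N' := by
  obtain ⟨L, hL, hall⟩ := exists_isRootList n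
  set W := singular K M ev od with hW
  let t : Fin n → Module.End K W := fun i =>
    (Algebra.lsmul K K M (od i i)).restrict (od_diag_smul_mem_singular H i)
  have ht : ∀ i (w : W), (t i w : M) = od i i • (w : M) := fun i w => rfl
  have hanti : ∀ i j, i ≠ j → t i * t j = -(t j * t i) := by
    intro i j hij
    ext w
    have := H.od_od i i j j
    simp only [hij, hij.symm, if_false, add_zero] at this
    change od i i • od j j • (w : M) = -(od j j • od i i • (w : M))
    rw [← mul_smul, this, neg_smul, mul_smul]
  have hchar : ∀ i, (t i * t i) ^ p = t i * t i + algebraMap K (Module.End K W) (c i ^ p) := by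
    intro i
    have hpow : ∀ (r : ℕ) (w : W), (((t i * t i) ^ r) w : M) = ev i i ^ r • (w : M) := by
      intro r
      induction r with
      | zero => intro w; simp
      | succ r ih =>
        intro w
        rw [pow_succ, Module.End.mul_apply, ih, Module.End.mul_apply, ht, ht, pow_succ,
          mul_smul, ← mul_smul (od i i), H.od_diag]
    ext w
    have h1 := hpow 1 w
    rw [pow_one, pow_one] at h1
    rw [hpow, hdiag, LinearMap.add_apply, Submodule.coe_add, h1, add_smul, algebraMap_smul,
      Module.algebraMap_end_apply]
    rfl
  -- A complement of `N` is generated by a Cartan-stable complement, inside the singular vectors, of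
  -- the singular vectors of `N`.
  obtain ⟨V', hV', hstable⟩ := exists_stable_isCompl hp2 t hanti
    (fun i => pow_ne_zero _ (hc0 i)) hchar ((N.restrictScalars K).comap W.subtype)
    (fun i v hv => N.smul_mem _ hv)
  have hV'W : V'.map W.subtype ≤ W := W.map_subtype_le V'
  refine ⟨Submodule.span R (V'.map W.subtype : Set M), disjoint_iff.2 ?_, codisjoint_iff.2 ?_⟩
  · by_contra hne
    have := (Submodule.nontrivial_iff_ne_bot).2 hne
    -- A nonzero intersection would contain a nonzero singular vector by Engel's theorem, and such a
    -- vector lies both in `N` and in `V'`.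
    obtain ⟨⟨m, hmN, hmV⟩, hm0, hm⟩ := exists_killed
      (M := ↥(N ⊓ Submodule.span R (V'.map W.subtype : Set M))) H hL hall
    have hmW : m ∈ W := fun a b hab =>
      ⟨congrArg Subtype.val (hm a b hab).1, congrArg Subtype.val (hm a b hab).2⟩
    obtain ⟨w, hw, rfl⟩ := mem_of_mem_span_of_mem_singular H hgen hdiag hc hV'W (by
      rintro i _ ⟨v, hv, rfl⟩
      exact ⟨_, hstable i v hv, rfl⟩) hmV hmW
    have := Submodule.disjoint_def.1 hV'.disjoint w hmN hw
    subst this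
    exact hm0 rfl
  · rw [eq_top_iff, ← span_singular_eq_top (K := K) (M := M) H hdiag hc, Submodule.span_le]
    intro w hw
    obtain ⟨v, hv, v', hv', hvv'⟩ := Submodule.mem_sup.1
      ((codisjoint_iff.1 hV'.codisjoint).symm ▸ Submodule.mem_top : (⟨w, hw⟩ : W) ∈ _)
    have := congrArg Subtype.val hvv'
    change (v : M) + v' = w at this
    rw [← this]
    exact Submodule.add_mem_sup hv (Submodule.subset_span ⟨v', hv', rfl⟩)

end Regular

/-! ### Graded complements and sandwich elements -/

section Graded

variable {K : Type*} [Field K] {A : Type*} [Ring A] [Algebra K A] (𝒜 : ZMod 2 → Submodule K A)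
  [GradedAlgebra 𝒜]

/-- A graded left ideal with a complement has a graded complement. -/
theorem exists_homogeneous_isCompl {I J : Ideal A} (hI : I.IsHomogeneous 𝒜) (hIJ : IsCompl I J) :
    ∃ J' : Ideal A, J'.IsHomogeneous 𝒜 ∧ IsCompl I J' := by
  let P : A →ₗ[A] A := I.subtype ∘ₗ Submodule.projectionOnto I J hIJ
  have hP1 : ∀ x, P x ∈ I := fun x => (Submodule.projectionOnto I J hIJ x).2
  have hP2 : ∀ x ∈ I, P x = x := fun x hx =>
    congrArg Subtype.val (Submodule.projectionOnto_apply_left hIJ ⟨x, hx⟩)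
  -- `ψ` is the even part of the projection `P`. It is still linear over `A` and a projection onto
  -- the graded ideal `I`, and it preserves degrees, so its kernel is a graded complement.
  let ψ : A →+ A := ∑ i : ZMod 2,
    (GradedRing.proj 𝒜 i).comp (P.toAddMonoidHom.comp (GradedRing.proj 𝒜 i))
  have hψ : ∀ x, ψ x = ∑ i : ZMod 2, GradedRing.proj 𝒜 i (P (GradedRing.proj 𝒜 i x)) := by
    intro x
    simp only [ψ, AddMonoidHom.finsetSum_apply]
    rfl
  have hsum : ∀ x, ∑ i : ZMod 2, GradedRing.proj 𝒜 i x = x := by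
    classical
    intro x
    conv_rhs => rw [← DirectSum.sum_support_decompose 𝒜 x]
    exact (Finset.sum_subset (Finset.subset_univ _) fun i _ hi => by
      rw [DFinsupp.notMem_support_iff] at hi
      rw [GradedRing.proj_apply, hi, ZeroMemClass.coe_zero]).symm
  have hψ_of_mem : ∀ i, ∀ x ∈ 𝒜 i, ψ x = GradedRing.proj 𝒜 i (P x) := by
    intro i x hx
    rw [hψ, Finset.sum_eq_single i]
    · rw [GradedRing.proj_apply 𝒜 i x, DirectSum.decompose_of_mem_same 𝒜 hx]
    · intro j _ hji
      rw [GradedRing.proj_apply 𝒜 j x, DirectSum.decompose_of_mem_ne 𝒜 hx hji.symm, map_zero,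
        map_zero]
    · simp
  have hlin : ∀ a x, ψ (a * x) = a * ψ x := by
    intro a x
    rw [← hsum a, ← hsum x]
    simp only [Finset.sum_mul, Finset.mul_sum, map_sum]
    refine Finset.sum_congr rfl fun j _ => Finset.sum_congr rfl fun i _ => ?_
    have hi : GradedRing.proj 𝒜 i a ∈ 𝒜 i := SetLike.coe_mem _
    have hj : GradedRing.proj 𝒜 j x ∈ 𝒜 j := SetLike.coe_mem _
    rw [hψ_of_mem _ _ (SetLike.mul_mem_graded hi hj), hψ_of_mem _ _ hj, ← smul_eq_mul,
      P.map_smul, smul_eq_mul, GradedRing.proj_apply,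
      DirectSum.coe_decompose_mul_add_of_left_mem 𝒜 hi]
    rfl
  have hproj : ∀ i x, ψ (GradedRing.proj 𝒜 i x) = GradedRing.proj 𝒜 i (ψ x) := by
    intro i x
    have hi : GradedRing.proj 𝒜 i x ∈ 𝒜 i := SetLike.coe_mem _
    rw [hψ_of_mem i _ hi, hψ, map_sum, Finset.sum_eq_single i]
    · exact (DirectSum.decompose_of_mem_same 𝒜 (SetLike.coe_mem _)).symm
    · intro j _ hji
      exact DirectSum.decompose_of_mem_ne 𝒜 (SetLike.coe_mem _) hji
    · simp
  have hψI : ∀ x, ψ x ∈ I := by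
    intro x
    rw [hψ]
    exact I.sum_mem fun i _ => hI i (hP1 _)
  have hψ2 : ∀ x ∈ I, ψ x = x := by
    intro x hx
    conv_rhs => rw [← hsum x]
    rw [hψ]
    refine Finset.sum_congr rfl fun i _ => ?_
    rw [hP2 (GradedRing.proj 𝒜 i x) (hI i hx)]
    exact DirectSum.decompose_of_mem_same 𝒜 (SetLike.coe_mem _)
  let J' : Ideal A :=
    { carrier := {x | ψ x = 0}
      add_mem' := fun {a b} ha hb => by
        rw [Set.mem_ofPred_eq] at *
        rw [map_add, ha, hb, add_zero]
      zero_mem' := map_zero ψ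
      smul_mem' := fun a x hx => by
        rw [Set.mem_ofPred_eq] at *
        rw [smul_eq_mul, hlin, hx, mul_zero] }
  refine ⟨J', fun i x hx => ?_, disjoint_iff.2 ?_, codisjoint_iff.2 ?_⟩
  · change ψ x = 0 at hx
    change ψ (GradedRing.proj 𝒜 i x) = 0
    rw [hproj, hx, map_zero]
  · refine (Submodule.eq_bot_iff _).2 fun x hx => ?_
    rw [← hψ2 x hx.1]
    exact hx.2
  · refine eq_top_iff.2 fun x _ => ?_
    rw [← add_sub_cancel (ψ x) x]
    refine Submodule.add_mem_sup (hψI x) ?_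
    change ψ (x - ψ x) = 0
    rw [map_sub, hψ2 _ (hψI x), sub_self]

/-- In a semisimple superalgebra every homogeneous element `z` lies in `z A z`. -/
theorem IsSemisimpleSuperalgebra.exists_mul_mul (h : IsSemisimpleSuperalgebra 𝒜) {z : A}
    (hz : SetLike.IsHomogeneousElem 𝒜 z) : ∃ a, z * a * z = z := by
  obtain ⟨J, -, hJ⟩ := h (Ideal.span {z}) (Ideal.homogeneous_span 𝒜 _ (by simpa using hz))
  obtain ⟨x, hx, j, hj, hxj⟩ := Submodule.mem_sup.1
    ((codisjoint_iff.1 hJ.codisjoint).symm ▸ Submodule.mem_top : (1 : A) ∈ _)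
  obtain ⟨a, rfl⟩ := Ideal.mem_span_singleton'.1 hx
  refine ⟨a, ?_⟩
  -- With 1 = a z + j, the element z j = z - z a z lies in both A z and J, hence is zero.
  have e : z * j = (1 - z * a) * z := by
    rw [sub_mul, one_mul, eq_sub_iff_add_eq', mul_assoc, ← mul_add, hxj, mul_one]
  have := Submodule.disjoint_def.1 hJ.disjoint (z * j)
    (e ▸ Ideal.mul_mem_left _ _ (Ideal.mem_span_singleton_self z)) (J.mul_mem_left z hj)
  rw [e, sub_mul, one_mul, sub_eq_zero] at this
  exact this.symm

end Graded

end QueerSuper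

/-! ### Non-regular characters: elements z with z a z = 0 -/

namespace QueerSuper

section Singular

variable {K : Type*} [Field K] {p : ℕ} [Fact p.Prime] [CharP K p]
  {R : Type*} [Ring R] [Algebra K R] {n : ℕ}
  {ev od : Fin n → Fin n → R} {M : Type*} [AddCommGroup M] [Module K M] [Module R M]
  [IsScalarTower K R M] {c μ : Fin n → K} {L : List (Fin n × Fin n)}

/-- The projection onto the weight space of weight `μ`. -/
def weightProj (p : ℕ) (ev : Fin n → Fin n → R) (μ : Fin n → K) : R :=
  ((List.finRange n).map fun i => 1 - (ev i i - algebraMap K R (μ i)) ^ (p - 1)).prod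

omit [Fact p.Prime] [CharP K p] in
theorem commute_weightProj {x : R} (hx : ∀ i, Commute x (ev i i)) :
    Commute x (weightProj p ev μ) := by
  refine Commute.list_prod_right _ _ fun y hy => ?_
  obtain ⟨i, -, rfl⟩ := List.mem_map.1 hy
  exact (Commute.one_right x).sub_right
    (((hx i).sub_right (Algebra.commutes (μ i) x).symm).pow_right _)

/-- The factor of index k is 1 - y ^ (p - 1) with y = ev k k - μ k, and y ^ p = y. -/
theorem ev_mul_weightProj (H : IsQueerFamily p ev od)
    (hdiag : ∀ i, ev i i ^ p = ev i i + algebraMap K R (c i ^ p))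
    (hμ : ∀ i, μ i ^ p - μ i = c i ^ p) (k : Fin n) :
    ev k k * weightProj p ev μ = μ k • weightProj p ev μ := by
  have key : ∀ l : List (Fin n), k ∈ l → (ev k k - algebraMap K R (μ k)) *
      (l.map fun i => 1 - (ev i i - algebraMap K R (μ i)) ^ (p - 1)).prod = 0 := by
    intro l
    induction l with
    | nil => simp
    | cons i l ih =>
      intro hk
      rw [List.map_cons, List.prod_cons, ← mul_assoc]
      by_cases hki : k = i
      · subst hki
        rw [mul_sub, mul_one, mul_pow_sub_one (Fact.out : p.Prime).ne_zero,
          sub_algebraMap_pow (hdiag k) (hμ k), sub_self, zero_mul]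
      · have hc : Commute (ev k k - algebraMap K R (μ k))
            (1 - (ev i i - algebraMap K R (μ i)) ^ (p - 1)) :=
          (Commute.one_right _).sub_right ((((H.commute_diag k i).sub_right
            (Algebra.commutes (μ i) (ev k k)).symm).sub_left
              (Algebra.commutes (μ k) _)).pow_right _)
        rw [hc.eq, mul_assoc, ih ((List.mem_cons.1 hk).resolve_left hki), mul_zero]
  rw [Algebra.smul_def, ← sub_eq_zero, ← sub_mul]
  exact key _ (List.mem_finRange k)

/-- `e R f` maps a space of singular vectors of weight `μ` into multiples of itself, where `e` and
`f` are the products of all positive and of all negative blocks. -/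
theorem exists_posProd_mul_mul_negProd_smul (H : IsQueerFamily p ev od)
    (hgen : Algebra.adjoin K {r | ∃ i j, r = ev i j ∨ r = od i j} = ⊤)
    (hL : IsRootList L) (hall : ∀ γ, γ ∈ L ↔ γ.1 < γ.2) {W : Submodule K M}
    (hWs : W ≤ singular K M ev od) (hWμ : ∀ m ∈ W, IsWeight ev μ m)
    (hW : ∀ i, ∀ m ∈ W, od i i • m ∈ W) (a : R) {m : M} (hm : m ∈ W) :
    ∃ w ∈ W, posProd p ev od L • a • negProd p ev od L • m = weightScalar p μ L • w := by
  have hp := (Fact.out : p.Prime)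
  have hWh : ∀ i, ∀ m ∈ W, ev i i • m ∈ W := fun i m hm => by
    rw [hWμ m hm i]
    exact W.smul_mem _ hm
  -- The image f W is stable under all root vectors that are not positive: negative ones annihilate
  -- it, and diagonal ones commute with f up to an integer factor. Since e annihilates positive root
  -- vectors from the left, e a f m = e f w.
  obtain ⟨_, ⟨w, hw, rfl⟩, hv⟩ := exists_smul_eq_of_mem_span (Y := fun i j => i < j)
    (V := W.map (Algebra.lsmul K K M (negProd p ev od L))) (z := posProd p ev od L) H hgen
    (by
      rintro i j hij _ ⟨w, hw, rfl⟩
      change ev i j • negProd p ev od L • w ∈ _ ∧ od i j • negProd p ev od L • w ∈ _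
      rw [← mul_smul, ← mul_smul]
      rcases (not_lt.1 hij).eq_or_lt with rfl | h
      · refine ⟨⟨ev j j • w, hWh j w hw, ?_⟩, ?_⟩
        · rw [(ev_diag_commute_negProd (K := K) H hp.one_le L j).eq, mul_smul]
          rfl
        · obtain ⟨s, hs⟩ := od_diag_mul_negProd H hp.one_le hL j
          rw [hs, smul_assoc, mul_smul]
          refine zsmul_mem ?_ s
          exact ⟨od j j • w, hW j w hw, rfl⟩
      · have := mul_negProd H hp.pos hL hall h
        rw [this.1, this.2, zero_smul]
        exact ⟨Submodule.zero_mem _, Submodule.zero_mem _⟩)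
    (fun i j hij => posProd_mul H hp.pos hL hall hij)
    (Submodule.smul_mem _ a (Submodule.subset_span ⟨m, hm, rfl⟩))
  refine ⟨w, hw, ?_⟩
  change posProd p ev od L • a • negProd p ev od L • m
    = posProd p ev od L • negProd p ev od L • w at hv
  rw [hv, posProd_smul_negProd H hp.two_le hL (hWμ w hw)]
  refine (mem_singular.1 (hWs hw)).mono fun a b h => ?_
  rcases h with h | ⟨h, h'⟩
  exacts [(hall _).1 h, (h' ((hall _).2 h)).elim]

omit [Fact p.Prime] [CharP K p] in
theorem weightProj_smul_mem_singular (H : IsQueerFamily p ev od) {m : M}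
    (hm : m ∈ singular K M ev od) : weightProj p ev μ • m ∈ singular K M ev od := by
  have key : ∀ l : List (Fin n),
      (l.map fun i => 1 - (ev i i - algebraMap K R (μ i)) ^ (p - 1)).prod • m
        ∈ singular K M ev od := by
    intro l
    induction l with
    | nil => simpa
    | cons i l ih =>
      rw [List.map_cons, List.prod_cons, mul_smul, sub_smul, one_smul]
      refine Submodule.sub_mem _ ih ?_
      set m' := (l.map fun i => 1 - (ev i i - algebraMap K R (μ i)) ^ (p - 1)).prod • m
      clear_value m'
      generalize p - 1 = r
      induction r with
      | zero => simpa
      | succ r ihr =>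
        rw [pow_succ', mul_smul, sub_smul, algebraMap_smul]
        exact Submodule.sub_mem _ (ev_diag_smul_mem_singular H i _ ihr)
          (Submodule.smul_mem _ _ ihr)
  exact key _

omit [Fact p.Prime] in
theorem od_commute_ev_diag (H : IsQueerFamily p ev od) (i j : Fin n) :
    Commute (od i i) (ev j j) := by
  have h := H.od_ev i i j j
  rwa [show ((if i = j then od i j else 0) - if j = i then od j i else 0) = (0 : R) by
    by_cases hij : i = j
    · subst hij; simp
    · simp [hij, Ne.symm hij], add_zero] at h

end Singular

section Nonregular

variable {K : Type*} [Field K] {p : ℕ} [Fact p.Prime] [CharP K p]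
  {R : Type*} [Ring R] [Algebra K R] {n : ℕ}
  {ev od : Fin n → Fin n → R} {c μ : Fin n → K} {L : List (Fin n × Fin n)}
  {𝒜 : ZMod 2 → Submodule K R} [GradedAlgebra 𝒜]

omit [Fact p.Prime] [CharP K p] in
theorem isHomogeneousElem_block (hev : ∀ i j, ev i j ∈ 𝒜 0) (hod : ∀ i j, od i j ∈ 𝒜 1)
    (i j : Fin n) : SetLike.IsHomogeneousElem 𝒜 (block p ev od i j) :=
  ⟨_, SetLike.mul_mem_graded (SetLike.pow_mem_graded _ (hev i j)) (hod i j)⟩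

omit [Fact p.Prime] [CharP K p] in
theorem isHomogeneousElem_posProd (hev : ∀ i j, ev i j ∈ 𝒜 0) (hod : ∀ i j, od i j ∈ 𝒜 1)
    (L : List (Fin n × Fin n)) : SetLike.IsHomogeneousElem 𝒜 (posProd p ev od L) := by
  induction L with
  | nil => exact SetLike.isHomogeneousElem_one 𝒜
  | cons β L ih => exact (isHomogeneousElem_block hev hod _ _).mul ih

omit [Fact p.Prime] [CharP K p] in
theorem isHomogeneousElem_negProd (hev : ∀ i j, ev i j ∈ 𝒜 0) (hod : ∀ i j, od i j ∈ 𝒜 1)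
    (L : List (Fin n × Fin n)) : SetLike.IsHomogeneousElem 𝒜 (negProd p ev od L) := by
  induction L with
  | nil => exact SetLike.isHomogeneousElem_one 𝒜
  | cons β L ih => exact ih.mul (isHomogeneousElem_block hev hod _ _)

omit [Fact p.Prime] [CharP K p] in
theorem isHomogeneousElem_weightProj (hev : ∀ i j, ev i j ∈ 𝒜 0) (μ : Fin n → K) :
    SetLike.IsHomogeneousElem 𝒜 (weightProj p ev μ) := by
  have key : ∀ l : List (Fin n),
      (l.map fun i => 1 - (ev i i - algebraMap K R (μ i)) ^ (p - 1)).prod ∈ 𝒜 0 := by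
    intro l
    induction l with
    | nil => exact SetLike.GradedOne.one_mem
    | cons i l ih =>
      rw [List.map_cons, List.prod_cons, ← add_zero (0 : ZMod 2)]
      refine SetLike.mul_mem_graded (Submodule.sub_mem _ SetLike.GradedOne.one_mem ?_) ih
      have := SetLike.pow_mem_graded (p - 1)
        (Submodule.sub_mem (𝒜 0) (hev i i) (SetLike.algebraMap_mem_graded 𝒜 (μ i)))
      rwa [smul_zero] at this
  exact ⟨0, key _⟩

/-- Write z = f π e = z a z. Here π e is singular of weight μ, so e a f (π e) is a multiple of the
weight scalar, which is zero. -/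
theorem negProd_weightProj_posProd_eq_zero (hss : IsSemisimpleSuperalgebra 𝒜)
    (hev : ∀ i j, ev i j ∈ 𝒜 0) (hod : ∀ i j, od i j ∈ 𝒜 1)
    (H : IsQueerFamily p ev od)
    (hgen : Algebra.adjoin K {r | ∃ i j, r = ev i j ∨ r = od i j} = ⊤)
    (hdiag : ∀ i, ev i i ^ p = ev i i + algebraMap K R (c i ^ p))
    (hμ : ∀ i, μ i ^ p - μ i = c i ^ p)
    (hL : IsRootList L) (hall : ∀ γ, γ ∈ L ↔ γ.1 < γ.2) (h0 : weightScalar p μ L = 0) :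
    negProd p ev od L * weightProj p ev μ * posProd p ev od L = 0 := by
  have hp := (Fact.out : p.Prime)
  obtain ⟨a, ha⟩ := hss.exists_mul_mul 𝒜 (((isHomogeneousElem_negProd (p := p) hev hod L).mul
    (isHomogeneousElem_weightProj (p := p) hev μ)).mul (isHomogeneousElem_posProd (p := p) hev hod L))
  let W : Submodule K R :=
    { carrier := {m | m ∈ singular K R ev od ∧ IsWeight ev μ m}
      add_mem' := fun ha hb => ⟨Submodule.add_mem _ ha.1 hb.1, fun i => by
        rw [smul_add, smul_add, ha.2, hb.2]⟩
      zero_mem' := ⟨Submodule.zero_mem _, fun i => by simp⟩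
      smul_mem' := fun c a ha => ⟨Submodule.smul_mem _ _ ha.1, fun i => by
        rw [smul_scalar_comm, ha.2, smul_comm]⟩ }
  have hes : posProd p ev od L ∈ singular K R ev od := by
    simpa [mem_singular] using
      (killed_posProd H hp.pos hL (1 : R)).mono fun a b h => (hall (a, b)).2 h
  obtain ⟨w, -, hw⟩ := exists_posProd_mul_mul_negProd_smul (W := W) H hgen hL hall
    (fun m hm => hm.1) (fun m hm => hm.2)
    (fun i m hm => ⟨od_diag_smul_mem_singular H i m hm.1,
      hm.2.smul_of_commute fun k => (od_commute_ev_diag H i k).symm⟩) a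
    (m := weightProj p ev μ * posProd p ev od L)
    ⟨weightProj_smul_mem_singular H hes, fun k => by
      rw [smul_eq_mul, ← mul_assoc, ev_mul_weightProj H hdiag hμ, smul_mul_assoc]⟩
  rw [h0, zero_smul] at hw
  simp only [smul_eq_mul] at hw
  rw [← ha]
  simp only [mul_assoc] at hw ⊢
  rw [hw, mul_zero, mul_zero]

/-- On weight μ the square of `od i i` is μ i = 0, so z = f π (od i i) e involves a singular vector
in the kernel of `od i i`. The operators e a f keep it in that kernel, and the other factor z
annihilates the result through its own `od i i`. -/
theorem negProd_weightProj_od_posProd_eq_zero (hss : IsSemisimpleSuperalgebra 𝒜)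
    (hev : ∀ i j, ev i j ∈ 𝒜 0) (hod : ∀ i j, od i j ∈ 𝒜 1)
    (H : IsQueerFamily p ev od)
    (hgen : Algebra.adjoin K {r | ∃ i j, r = ev i j ∨ r = od i j} = ⊤)
    (hdiag : ∀ i, ev i i ^ p = ev i i + algebraMap K R (c i ^ p))
    (hμ : ∀ i, μ i ^ p - μ i = c i ^ p)
    (hL : IsRootList L) (hall : ∀ γ, γ ∈ L ↔ γ.1 < γ.2) {i : Fin n} (h0 : μ i = 0) :
    negProd p ev od L * weightProj p ev μ * (od i i * posProd p ev od L) = 0 := by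
  have hp := (Fact.out : p.Prime)
  obtain ⟨a, ha⟩ := hss.exists_mul_mul 𝒜 (((isHomogeneousElem_negProd (p := p) hev hod L).mul
    (isHomogeneousElem_weightProj (p := p) hev μ)).mul
      (SetLike.IsHomogeneousElem.mul ⟨1, hod i i⟩ (isHomogeneousElem_posProd (p := p) hev hod L)))
  let W : Submodule K R :=
    { carrier := {m | m ∈ singular K R ev od ∧ IsWeight ev μ m ∧ od i i • m = 0}
      add_mem' := fun ha hb => ⟨Submodule.add_mem _ ha.1 hb.1, fun i => by
        rw [smul_add, smul_add, ha.2.1, hb.2.1], by rw [smul_add, ha.2.2, hb.2.2, add_zero]⟩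
      zero_mem' := ⟨Submodule.zero_mem _, fun i => by simp, smul_zero _⟩
      smul_mem' := fun c a ha => ⟨Submodule.smul_mem _ _ ha.1, fun i => by
        rw [smul_scalar_comm, ha.2.1, smul_comm], by
        rw [smul_scalar_comm, ha.2.2, smul_zero]⟩ }
  have hes : posProd p ev od L ∈ singular K R ev od := by
    simpa [mem_singular] using
      (killed_posProd H hp.pos hL (1 : R)).mono fun a b h => (hall (a, b)).2 h
  obtain ⟨w, hwW, hw⟩ := exists_posProd_mul_mul_negProd_smul (W := W) H hgen hL hall
    (fun m hm => hm.1) (fun m hm => hm.2.1)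
    (fun j m hm => ⟨od_diag_smul_mem_singular H j m hm.1,
      hm.2.1.smul_of_commute fun k => (od_commute_ev_diag H j k).symm, by
        by_cases hij : i = j
        · subst hij; rw [hm.2.2, smul_zero]
        · have := H.od_od i i j j
          simp only [hij, Ne.symm hij, if_false, add_zero] at this
          rw [← mul_smul, this, neg_smul, mul_smul, hm.2.2, smul_zero, neg_zero]⟩) a
    (m := weightProj p ev μ * (od i i * posProd p ev od L))
    ⟨weightProj_smul_mem_singular H (od_diag_smul_mem_singular H i _ hes), fun k => by
      rw [smul_eq_mul, ← mul_assoc, ev_mul_weightProj H hdiag hμ, smul_mul_assoc], by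
      rw [smul_eq_mul, ← mul_assoc, (commute_weightProj (od_commute_ev_diag H i)).eq, mul_assoc,
        ← mul_assoc (od i i), H.od_diag, ← mul_assoc,
        ← (commute_weightProj (H.commute_diag i)).eq, ev_mul_weightProj H hdiag hμ, h0, zero_smul,
        zero_mul]⟩
  simp only [smul_eq_mul] at hw
  have hw0 : od i i * w = 0 := hwW.2.2
  rw [← ha]
  simp only [mul_assoc] at hw ⊢
  rw [hw, mul_smul_comm, hw0]
  simp

end Nonregular

end QueerSuper

/-! ### Jacobson's formula for p-th powers -/

namespace QueerSuper

section Jacobson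

open Polynomial

variable {K : Type*} [Field K] {p : ℕ} [Fact p.Prime] [CharP K p]

theorem choose_pred_prime_cast {k : ℕ} (hk : k < p) : ((p - 1).choose k : K) = (-1) ^ k := by
  have hp := (Fact.out : p.Prime)
  induction k with
  | zero => simp
  | succ k ih =>
    have h := Nat.choose_succ_succ (p - 1) k
    rw [Nat.succ_eq_add_one, Nat.succ_eq_add_one, Nat.sub_add_cancel hp.one_le] at h
    have h0 : ((p.choose (k + 1) : ℕ) : K) = 0 :=
      (CharP.cast_eq_zero_iff K p _).2 (hp.dvd_choose_self (Nat.succ_ne_zero k) hk)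
    rw [h, Nat.cast_add, ih (by omega)] at h0
    rw [pow_succ]
    linear_combination h0

/-- In characteristic p the binomial coefficient of p - 1 over k is (-1) ^ k, which cancels the sign
from the power of -y. -/
theorem sub_pow_pred_of_commute {A : Type*} [Ring A] [Algebra K A] {x y : A} (h : Commute x y) :
    (x - y) ^ (p - 1) = ∑ k ∈ Finset.range p, x ^ k * y ^ (p - 1 - k) := by
  have hp := (Fact.out : p.Prime)
  rw [sub_eq_add_neg, h.neg_right.add_pow, Nat.sub_add_cancel hp.one_le]
  refine Finset.sum_congr rfl fun k hk => ?_
  have hk := Finset.mem_range.1 hk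
  have e : (((p - 1).choose k : ℕ) : A) = (-1) ^ k := by
    rw [← map_natCast (algebraMap K A), choose_pred_prime_cast hk]
    simp
  have e' : (-1 : A) ^ (p - 1 - k) * (-1) ^ k = 1 := by
    rw [← pow_add, Nat.sub_add_cancel (by omega)]
    have : (algebraMap K A) (((p - 1).choose (p - 1) : ℕ) : K) = 1 := by simp
    rw [choose_pred_prime_cast (by have := hp.pos; omega)] at this
    simpa using this
  rw [e, neg_pow y, (((Commute.neg_one_left (y ^ (p - 1 - k))).pow_left (p - 1 - k))).eq,
    mul_assoc, mul_assoc, e', mul_one]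

theorem derivative_pow_eq_sum {B : Type*} [Ring B] (q : B[X]) (m : ℕ) :
    derivative (q ^ m) = ∑ k ∈ Finset.range m, q ^ k * derivative q * q ^ (m - 1 - k) := by
  induction m with
  | zero => simp
  | succ m ih =>
    rw [pow_succ, derivative_mul, ih, Finset.sum_range_succ, Finset.sum_mul]
    simp only [Nat.add_sub_cancel, Nat.sub_self, pow_zero, mul_one]
    congr 1
    refine Finset.sum_congr rfl fun k hk => ?_
    have hk := Finset.mem_range.1 hk
    rw [mul_assoc, ← pow_succ, show m - 1 - k + 1 = m - k by omega]

/-- The linear polynomial `x t + y`. -/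
def linearPoly {B : Type*} [Ring B] (x y : B) : B[X] := C x * X + C y

/-- The iterated commutator of `x t + y` with `x`. -/
def iterBracket {B : Type*} [Ring B] (x y : B) : ℕ → B[X]
  | 0 => C x
  | r + 1 => linearPoly x y * iterBracket x y r - iterBracket x y r * linearPoly x y

variable {A B : Type*} [Ring A] [Algebra K A] [Ring B] [Algebra K B]

/-- For q = x t + y the derivative of q ^ p is the sum of q ^ k x q ^ (p - 1 - k). By
`sub_pow_pred_of_commute`, applied to left and right multiplication by q, this sum is (ad q) ^ (p -
1) of x. -/
theorem derivative_linearPoly_pow (K : Type*) [Field K] [CharP K p] [Algebra K B] (x y : B) :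
    derivative (linearPoly x y ^ p) = iterBracket x y (p - 1) := by
  have hp := (Fact.out : p.Prime)
  set q := linearPoly x y with hq
  have hLR : Commute (LinearMap.mulLeft K q) (LinearMap.mulRight K q) :=
    LinearMap.ext fun φ => (mul_assoc q φ q).symm
  have hr : ∀ r, iterBracket x y r
      = ((LinearMap.mulLeft K q - LinearMap.mulRight K q) ^ r) (C x) := by
    intro r
    induction r with
    | zero => rfl
    | succ r ih =>
      rw [pow_succ', Module.End.mul_apply, ← ih]
      rfl
  have hd : derivative q = C x := by
    simp [hq, linearPoly]
  rw [derivative_pow_eq_sum, hr, sub_pow_pred_of_commute (K := K) hLR, hd,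
    LinearMap.sum_apply]
  refine Finset.sum_congr rfl fun k _ => ?_
  rw [Module.End.mul_apply, LinearMap.pow_mulLeft, LinearMap.pow_mulRight,
    LinearMap.mulLeft_apply, LinearMap.mulRight_apply, mul_assoc]

/-- The coefficients are built from x and y by commutators alone, since t is central, so a Lie
homomorphism carries them over. -/
theorem coeff_iterBracket (ρ : A →ₗ[K] B) (hρ : ∀ a b, ρ (a * b - b * a) = ρ a * ρ b - ρ b * ρ a)
    (x y : A) (r i : ℕ) :
    ρ ((iterBracket x y r).coeff i) = (iterBracket (ρ x) (ρ y) r).coeff i := by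
  induction r generalizing i with
  | zero =>
    simp only [iterBracket, coeff_C]
    split_ifs <;> simp
  | succ r ih =>
    simp only [iterBracket, linearPoly, add_mul, mul_add, coeff_sub, coeff_add, mul_assoc,
      coeff_C_mul, coeff_mul_C]
    simp only [← X_mul_C (_ : A), ← X_mul_C (_ : B), ← mul_assoc]
    cases i with
    | zero =>
      simp only [mul_coeff_zero, coeff_X_zero, zero_mul, mul_zero, zero_add, hρ, ← ih]
    | succ i =>
      simp only [coeff_X_mul, coeff_mul_X, coeff_mul_C]
      rw [add_sub_add_comm, add_sub_add_comm, map_add, hρ, hρ, ih, ih]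

/-- Specialization of (x t + y) ^ p at t = 1; the extreme coefficients are y ^ p and x ^ p. -/
theorem add_pow_sub_eq_sum {D : Type*} [Ring D] (x y : D) : (x + y) ^ p - x ^ p - y ^ p
    = ∑ i ∈ Finset.range (p - 1), (linearPoly x y ^ p).coeff (i + 1) := by
  have hp := (Fact.out : p.Prime)
  have hdeg : (linearPoly x y).natDegree ≤ 1 := natDegree_linear_le
  have h0 : (linearPoly x y ^ p).coeff 0 = y ^ p := by
    have := map_pow constantCoeff (linearPoly x y) p
    simpa [linearPoly] using this
  have h1 : (linearPoly x y ^ p).coeff p = x ^ p := by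
    have := coeff_pow_of_natDegree_le (m := p) hdeg
    simpa [linearPoly] using this
  have h2 := map_pow (eval₂RingHom' (RingHom.id D) 1 fun a => Commute.one_right a)
    (linearPoly x y) p
  have h3 : ∀ f : D[X], eval₂RingHom' (RingHom.id D) 1 (fun a => Commute.one_right a) f
      = f.eval 1 := fun f => rfl
  rw [h3, h3, eval_eq_sum_range' (n := p + 1) (lt_of_le_of_lt natDegree_pow_le (by
    have := Nat.mul_le_mul_left p hdeg
    omega))] at h2
  obtain ⟨q, rfl⟩ := Nat.exists_eq_add_of_le' hp.one_le
  rw [Finset.sum_range_succ, Finset.sum_range_succ'] at h2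
  simp only [one_pow, mul_one] at h2
  rw [h0, h1] at h2
  have h4 : (linearPoly x y).eval 1 = x + y := by simp [linearPoly]
  rw [h4] at h2
  rw [← h2, Nat.add_sub_cancel]
  abel

theorem mul_natCast_add_one {D : Type*} [Ring D] [Algebra K D] (z : D) (i : ℕ) :
    z * ((i : D) + 1) = ((i : K) + 1) • z := by
  rw [Algebra.smul_def, map_add, map_one, map_natCast]
  exact ((Nat.cast_commute i z).add_left (Commute.one_left z)).eq.symm

/-- Jacobson's formula, in the form: a Lie homomorphism between associative algebras of
characteristic `p` preserves the difference `(x + y) ^ p - x ^ p - y ^ p`. -/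
theorem map_add_pow_sub (ρ : A →ₗ[K] B)
    (hρ : ∀ a b, ρ (a * b - b * a) = ρ a * ρ b - ρ b * ρ a) (x y : A) :
    ρ ((x + y) ^ p - x ^ p - y ^ p) = (ρ x + ρ y) ^ p - ρ x ^ p - ρ y ^ p := by
  have hp := (Fact.out : p.Prime)
  rw [add_pow_sub_eq_sum, add_pow_sub_eq_sum, map_sum]
  refine Finset.sum_congr rfl fun i hi => ?_
  have hi := Finset.mem_range.1 hi
  -- The derivative multiplies the coefficient of degree i + 1 by i + 1 < p, which is invertible, so
  -- the middle coefficients are Lie expressions.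
  have hne : ((i : K) + 1) ≠ 0 := by
    have : ((i + 1 : ℕ) : K) ≠ 0 := by
      rw [Ne, CharP.cast_eq_zero_iff K p]
      exact fun h => absurd (Nat.le_of_dvd (Nat.succ_pos i) h) (by omega)
    exact_mod_cast this
  have hA := congrArg (fun f => ρ (f.coeff i)) (derivative_linearPoly_pow (p := p) K x y)
  have hB := congrArg (fun f => f.coeff i) (derivative_linearPoly_pow (p := p) K (ρ x) (ρ y))
  simp only [coeff_derivative, coeff_iterBracket ρ hρ] at hA hB
  rw [← hB] at hA
  rw [mul_natCast_add_one (K := K), mul_natCast_add_one (K := K), map_smul] at hA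
  exact smul_right_injective B hne hA

end Jacobson

end QueerSuper

/-! ### q(n) inside a Weyl-Clifford algebra -/

namespace QueerSuper

theorem pow_mul_of_mul_eq_add_one {B : Type*} [Ring B] {d x : B} (h1 : d * x = x * d + 1) (m : ℕ) :
    d ^ m * x = x * d ^ m + m * d ^ (m - 1) := by
  induction m with
  | zero => simp
  | succ m ih =>
    rw [pow_succ, mul_assoc, h1, mul_add, ← mul_assoc, ih, add_mul, mul_one, mul_assoc, mul_assoc]
    cases m with
    | zero => simp
    | succ m =>
      simp only [Nat.add_sub_cancel, ← pow_succ]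
      push_cast
      noncomm_ring

/-- Elements of an algebra satisfying the relations of multiplication by even variables `x` and odd
variables `ξ`, and of the derivations `d` and `δ`, with prescribed `p`-th powers of `x`, `d`. -/
structure IsWeylClifford {K B σ : Type*} [Field K] [Ring B] [Algebra K B] [DecidableEq σ] (p : ℕ)
    (a b : σ → K) (x d ξ δ : σ → B) : Prop where
  x_x : ∀ s t, Commute (x s) (x t)
  d_d : ∀ s t, Commute (d s) (d t)
  d_x : ∀ s t, d s * x t = x t * d s + if s = t then 1 else 0
  ξ_ξ : ∀ s t, ξ s * ξ t = -(ξ t * ξ s)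
  δ_δ : ∀ s t, δ s * δ t = -(δ t * δ s)
  δ_ξ : ∀ s t, δ s * ξ t = -(ξ t * δ s) + if s = t then 1 else 0
  ξ_ξ_self : ∀ s, ξ s * ξ s = 0
  δ_δ_self : ∀ s, δ s * δ s = 0
  x_ξ : ∀ s t, Commute (x s) (ξ t)
  x_δ : ∀ s t, Commute (x s) (δ t)
  d_ξ : ∀ s t, Commute (d s) (ξ t)
  d_δ : ∀ s t, Commute (d s) (δ t)
  x_pow : ∀ s, x s ^ p = algebraMap K B (a s)
  d_pow : ∀ s, d s ^ p = algebraMap K B (b s)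

namespace IsWeylClifford

variable {K B σ : Type*} [Field K] [Ring B] [Algebra K B] [DecidableEq σ] {p : ℕ}
    {a b : σ → K} {x d ξ δ : σ → B}

/-- Translating x and d by scalars preserves the commutation relations, and in characteristic p it
adds p-th powers of the scalars to the p-th powers. Thus one nilpotent representation yields all the
others that are needed. -/
theorem shift (h : IsWeylClifford p a b x d ξ δ) [Fact p.Prime] [CharP B p] (u v : σ → K) :
    IsWeylClifford p (fun s => a s + u s ^ p) (fun s => b s + v s ^ p)
      (fun s => x s + algebraMap K B (u s)) (fun s => d s + algebraMap K B (v s)) ξ δ where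
  x_x s t := ((h.x_x s t).add_right (Algebra.commutes _ _).symm).add_left (Algebra.commutes _ _)
  d_d s t := ((h.d_d s t).add_right (Algebra.commutes _ _).symm).add_left (Algebra.commutes _ _)
  d_x s t := by
    simp only [add_mul, mul_add, h.d_x, Algebra.commutes (v s) (x t),
      ← Algebra.commutes (u t) (d s), Algebra.commutes (v s) (algebraMap K B (u t))]
    abel
  ξ_ξ := h.ξ_ξ
  δ_δ := h.δ_δ
  δ_ξ := h.δ_ξ
  ξ_ξ_self := h.ξ_ξ_self
  δ_δ_self := h.δ_δ_self
  x_ξ s t := (h.x_ξ s t).add_left (Algebra.commutes _ _)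
  x_δ s t := (h.x_δ s t).add_left (Algebra.commutes _ _)
  d_ξ s t := (h.d_ξ s t).add_left (Algebra.commutes _ _)
  d_δ s t := (h.d_δ s t).add_left (Algebra.commutes _ _)
  x_pow s := by
    rw [add_pow_char_of_commute p (Algebra.commutes _ _).symm, h.x_pow, ← map_pow, ← map_add]
  d_pow s := by
    rw [add_pow_char_of_commute p (Algebra.commutes _ _).symm, h.d_pow, ← map_pow, ← map_add]

theorem d_pow_mul_x (h : IsWeylClifford p a b x d ξ δ) (s : σ) (m : ℕ) :
    d s ^ m * x s = x s * d s ^ m + m * d s ^ (m - 1) :=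
  pow_mul_of_mul_eq_add_one (by rw [h.d_x, if_pos rfl]) m

/-- This is the falling factorial of the Euler operator x d. At length p it becomes T ^ p - T, which
yields `x_mul_d_pow`. -/
theorem x_pow_mul_d_pow (h : IsWeylClifford p a b x d ξ δ) (s : σ) (m : ℕ) :
    x s ^ m * d s ^ m = Polynomial.aeval (x s * d s)
      (∏ k ∈ Finset.range m, (Polynomial.X - (k : Polynomial K))) := by
  induction m with
  | zero => simp
  | succ m ih =>
    have h1 := h.d_pow_mul_x s m
    have h2 : d s ^ m * (x s * d s) = x s * d s ^ (m + 1) + m * d s ^ m := by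
      rw [← mul_assoc, h1, add_mul, mul_assoc, ← pow_succ, mul_assoc]
      cases m with
      | zero => simp
      | succ m => rw [Nat.add_sub_cancel, ← pow_succ]
    rw [Finset.prod_range_succ, map_mul, ← ih, map_sub, Polynomial.aeval_X, map_natCast, mul_sub,
      mul_assoc, h2, mul_add, ← mul_assoc, ← pow_succ, mul_assoc (x s ^ m) (d s ^ m),
      ← (Nat.cast_commute m (d s ^ m)).eq, add_sub_cancel_right]

theorem prod_X_sub_natCast [Fact p.Prime] [CharP K p] :
    ∏ k ∈ Finset.range p, (Polynomial.X - (k : Polynomial K)) = Polynomial.X ^ p - Polynomial.X := by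
  classical
  have hp := (Fact.out : p.Prime)
  have hdeg : (Polynomial.X ^ p - Polynomial.X : Polynomial K).degree = (p : WithBot ℕ) := by
    rw [Polynomial.degree_sub_eq_left_of_degree_lt, Polynomial.degree_X_pow]
    rw [Polynomial.degree_X_pow, Polynomial.degree_X]
    exact_mod_cast hp.one_lt
  have hmon : (∏ k ∈ Finset.range p, (Polynomial.X - (k : Polynomial K))).Monic :=
    Polynomial.monic_prod_of_monic _ _ fun k _ => by
      rw [← Polynomial.C_eq_natCast]
      exact Polynomial.monic_X_sub_C _
  have hdeg' : (∏ k ∈ Finset.range p, (Polynomial.X - (k : Polynomial K))).degree = (p : WithBot ℕ) := by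
    rw [Polynomial.degree_prod, Finset.sum_congr rfl fun k _ => by
      rw [← Polynomial.C_eq_natCast, Polynomial.degree_X_sub_C]]
    simp
  refine Polynomial.eq_of_degree_sub_lt_of_eval_finset_eq
    (s := (Finset.range p).image fun k : ℕ => (k : K)) ?_ ?_
  · rw [Finset.card_image_of_injOn
      (by simpa [Finset.coe_range] using CharP.natCast_injOn_Iio K p), Finset.card_range, ← hdeg']
    refine Polynomial.degree_sub_lt_left (hdeg'.trans hdeg.symm) hmon.ne_zero ?_
    rw [hmon.leadingCoeff, Polynomial.leadingCoeff_sub_of_degree_lt, Polynomial.leadingCoeff_X_pow]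
    rw [Polynomial.degree_X_pow, Polynomial.degree_X]
    exact_mod_cast hp.one_lt
  · intro y hy
    obtain ⟨j, hj, rfl⟩ := Finset.mem_image.1 hy
    rw [Polynomial.eval_prod, Finset.prod_eq_zero hj (by simp)]
    simp [natCast_pow_char]

theorem x_mul_d_pow (h : IsWeylClifford p a b x d ξ δ) [Fact p.Prime] [CharP K p] (s : σ) :
    (x s * d s) ^ p = x s * d s + algebraMap K B (a s * b s) := by
  have := h.x_pow_mul_d_pow s p
  rw [prod_X_sub_natCast, map_sub, map_pow, Polynomial.aeval_X, h.x_pow, h.d_pow, ← map_mul] at this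
  rw [this]
  abel

theorem x_mul_d_pow_of_ne (h : IsWeylClifford p a b x d ξ δ) {s t : σ} (hst : s ≠ t) :
    (x s * d t) ^ p = algebraMap K B (a s * b t) := by
  have hc : Commute (x s) (d t) := by
    have := h.d_x t s
    rw [if_neg hst.symm, add_zero] at this
    exact this.symm
  rw [hc.mul_pow, h.x_pow, h.d_pow, ← map_mul]

theorem ξ_mul_δ_pow (h : IsWeylClifford p a b x d ξ δ) (hp : 1 ≤ p) (s : σ) :
    (ξ s * δ s) ^ p = ξ s * δ s := by
  have hidem : (ξ s * δ s) * (ξ s * δ s) = ξ s * δ s := by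
    have := h.δ_ξ s s
    rw [if_pos rfl] at this
    rw [mul_assoc, ← mul_assoc (δ s), this, add_mul, mul_add, neg_mul, mul_assoc (ξ s) (δ s),
      h.δ_δ_self]
    simp
  exact (show IsIdempotentElem (ξ s * δ s) from hidem).pow_eq (by omega)

theorem ξ_mul_δ_pow_of_ne (h : IsWeylClifford p a b x d ξ δ) (hp : 2 ≤ p) {s t : σ} (hst : s ≠ t) :
    (ξ s * δ t) ^ p = 0 := by
  have hsq : (ξ s * δ t) ^ 2 = 0 := by
    have := h.δ_ξ t s
    rw [if_neg hst.symm, add_zero] at this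
    rw [pow_two, mul_assoc, ← mul_assoc (δ t), this, neg_mul, mul_assoc (ξ s) (δ t),
      h.δ_δ_self]
    simp
  exact pow_eq_zero_of_le hp hsq

end IsWeylClifford

section Family

variable {K B : Type*} [Field K] [Ring B] [Algebra K B] {n : ℕ} {p : ℕ}
    {a b : Fin n × Fin n → K} (x d ξ δ : Fin n × Fin n → B)

/-- The even matrix units of `q(n)` as quadratic expressions in a Weyl-Clifford algebra. -/
def weylEv (i j : Fin n) : B := ∑ k, (x (k, i) * d (k, j) + ξ (k, i) * δ (k, j))

/-- The odd matrix units of `q(n)` as quadratic expressions in a Weyl-Clifford algebra. -/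
def weylOd (i j : Fin n) : B := ∑ k, (x (k, i) * δ (k, j) + ξ (k, i) * d (k, j))

/-- In the bracket of a quadratic sum with a generator of first index k, only the summand k
contributes. Brackets of two quadratic sums then follow by the Leibniz rule. -/
theorem sum_mul_of_mul {t : Fin n → B} {z c : B} {k : Fin n}
    (ht : ∀ k', t k' * z = z * t k' + if k' = k then c else 0) :
    (∑ k', t k') * z = z * (∑ k', t k') + c := by
  rw [Finset.sum_mul, Finset.sum_congr rfl fun k' _ => ht k', Finset.sum_add_distrib,
    Finset.mul_sum, Finset.sum_ite_eq' Finset.univ k, if_pos (Finset.mem_univ k)]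

theorem sum_mul_of_mul_neg {t : Fin n → B} {z c : B} {k : Fin n}
    (ht : ∀ k', t k' * z = -(z * t k') + if k' = k then c else 0) :
    (∑ k', t k') * z = -(z * (∑ k', t k')) + c := by
  rw [Finset.sum_mul, Finset.sum_congr rfl fun k' _ => ht k', Finset.sum_add_distrib,
    Finset.mul_sum, Finset.sum_ite_eq' Finset.univ k, if_pos (Finset.mem_univ k),
    Finset.sum_neg_distrib]

variable {x d ξ δ} (h : IsWeylClifford p a b x d ξ δ)
include h

theorem weylEv_x (i j k l : Fin n) : weylEv x d ξ δ i j * x (k, l)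
    = x (k, l) * weylEv x d ξ δ i j + if j = l then x (k, i) else 0 := by
  refine sum_mul_of_mul (k := k) fun k' => ?_
  rw [add_mul, mul_assoc, h.d_x, mul_add, ← mul_assoc, (h.x_x _ _).eq, mul_assoc,
    ((h.x_ξ (k, l) (k', i)).mul_right (h.x_δ (k, l) (k', j))).symm.eq, mul_add]
  by_cases h1 : k' = k <;> by_cases h2 : j = l <;> simp [h1, h2] <;> abel

theorem weylEv_ξ (i j k l : Fin n) : weylEv x d ξ δ i j * ξ (k, l)
    = ξ (k, l) * weylEv x d ξ δ i j + if j = l then ξ (k, i) else 0 := by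
  refine sum_mul_of_mul (k := k) fun k' => ?_
  rw [add_mul, mul_assoc (ξ _), h.δ_ξ, mul_add, mul_neg, ← mul_assoc (ξ _), h.ξ_ξ (k', i), neg_mul,
    neg_neg, mul_assoc (ξ (k, l)), ((h.x_ξ (k', i) (k, l)).mul_left (h.d_ξ (k', j) (k, l))).eq,
    mul_add]
  by_cases h1 : k' = k <;> by_cases h2 : j = l <;> simp [h1, h2] <;> abel

theorem weylEv_d (i j k l : Fin n) : weylEv x d ξ δ i j * d (k, l)
    = d (k, l) * weylEv x d ξ δ i j + -if l = i then d (k, j) else 0 := by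
  refine sum_mul_of_mul (k := k) fun k' => ?_
  have e := h.d_x (k, l) (k', i)
  rw [add_mul, ((h.d_ξ (k, l) (k', i)).mul_right (h.d_δ (k, l) (k', j))).symm.eq, mul_assoc,
    (h.d_d (k', j) (k, l)).eq, mul_add, ← mul_assoc (x _), ← mul_assoc (d _) (x _), e, add_mul]
  by_cases h1 : k' = k <;> by_cases h2 : l = i <;> simp [h1, h2, eq_comm (a := k) (b := k')] <;> abel

theorem weylEv_δ (i j k l : Fin n) : weylEv x d ξ δ i j * δ (k, l)
    = δ (k, l) * weylEv x d ξ δ i j + -if l = i then δ (k, j) else 0 := by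
  refine sum_mul_of_mul (k := k) fun k' => ?_
  have e := h.δ_ξ (k, l) (k', i)
  rw [add_mul, ((h.x_δ (k', i) (k, l)).mul_left (h.d_δ (k', j) (k, l))).eq, mul_assoc (ξ _),
    h.δ_δ (k', j) (k, l), mul_add, mul_neg, ← mul_assoc (ξ _), ← mul_assoc (δ _) (ξ _), e, add_mul]
  by_cases h1 : k' = k <;> by_cases h2 : l = i <;> simp [h1, h2, eq_comm (a := k) (b := k')] <;> abel

theorem weylOd_x (i j k l : Fin n) : weylOd x d ξ δ i j * x (k, l)
    = x (k, l) * weylOd x d ξ δ i j + if j = l then ξ (k, i) else 0 := by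
  refine sum_mul_of_mul (k := k) fun k' => ?_
  rw [add_mul, ((h.x_x (k, l) (k', i)).mul_right (h.x_δ (k, l) (k', j))).symm.eq, mul_assoc (ξ _),
    h.d_x, mul_add, mul_add, ← mul_assoc (ξ _), ← (h.x_ξ (k, l) (k', i)).eq, mul_assoc (x (k, l)) (ξ _)]
  by_cases h1 : k' = k <;> by_cases h2 : j = l <;> simp [h1, h2] <;> abel

theorem weylOd_ξ (i j k l : Fin n) : weylOd x d ξ δ i j * ξ (k, l)
    = -(ξ (k, l) * weylOd x d ξ δ i j) + if j = l then x (k, i) else 0 := by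
  refine sum_mul_of_mul_neg (k := k) fun k' => ?_
  rw [add_mul, mul_assoc, h.δ_ξ, mul_add, mul_neg, ← mul_assoc (x _),
    (h.x_ξ (k', i) (k, l)).eq, mul_assoc (ξ (k', i)), (h.d_ξ (k', j) (k, l)).eq,
    ← mul_assoc (ξ (k', i)), h.ξ_ξ (k', i), mul_add, neg_mul, mul_assoc (ξ (k, l)),
    mul_assoc (ξ (k, l))]
  by_cases h1 : k' = k <;> by_cases h2 : j = l <;> simp [h1, h2] <;> abel

theorem weylOd_d (i j k l : Fin n) : weylOd x d ξ δ i j * d (k, l)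
    = d (k, l) * weylOd x d ξ δ i j + -if l = i then δ (k, j) else 0 := by
  refine sum_mul_of_mul (k := k) fun k' => ?_
  have e := h.d_x (k, l) (k', i)
  rw [add_mul, mul_assoc, ← (h.d_δ _ _).eq, mul_add, ← mul_assoc, ← mul_assoc, e, add_mul,
    ((h.d_ξ (k, l) (k', i)).mul_right (h.d_d (k, l) (k', j))).symm.eq]
  by_cases h1 : k' = k <;> by_cases h2 : l = i <;> simp [h1, h2, eq_comm (a := k) (b := k')] <;> abel

theorem weylOd_δ (i j k l : Fin n) : weylOd x d ξ δ i j * δ (k, l)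
    = -(δ (k, l) * weylOd x d ξ δ i j) + if l = i then d (k, j) else 0 := by
  refine sum_mul_of_mul_neg (k := k) fun k' => ?_
  have e := h.δ_ξ (k, l) (k', i)
  rw [add_mul, mul_assoc, h.δ_δ, mul_neg, ← mul_assoc, (h.x_δ _ _).eq, mul_assoc (ξ _),
    (h.d_δ _ _).eq, mul_add, ← mul_assoc (ξ _), ← mul_assoc (δ _) (ξ _), e, add_mul, mul_assoc]
  by_cases h1 : k' = k <;> by_cases h2 : l = i <;> simp [h1, h2, eq_comm (a := k) (b := k')] <;> abel

theorem weylEv_weylEv (i j k l : Fin n) : weylEv x d ξ δ i j * weylEv x d ξ δ k l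
    = weylEv x d ξ δ k l * weylEv x d ξ δ i j + ((if j = k then weylEv x d ξ δ i l else 0)
      - if l = i then weylEv x d ξ δ k j else 0) := by
  have key : ∀ m, weylEv x d ξ δ i j * (x (m, k) * d (m, l) + ξ (m, k) * δ (m, l))
      = (x (m, k) * d (m, l) + ξ (m, k) * δ (m, l)) * weylEv x d ξ δ i j
        + ((if j = k then x (m, i) * d (m, l) + ξ (m, i) * δ (m, l) else 0)
          - if l = i then x (m, k) * d (m, j) + ξ (m, k) * δ (m, j) else 0) := by
    intro m
    rw [mul_add, ← mul_assoc, ← mul_assoc, weylEv_x h, weylEv_ξ h, add_mul, add_mul, mul_assoc,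
      mul_assoc, weylEv_d h, weylEv_δ h, add_mul, mul_add, mul_add, mul_assoc, mul_assoc]
    by_cases h1 : j = k <;> by_cases h2 : l = i <;> simp [h1, h2] <;> abel
  conv_lhs => rw [weylEv.eq_1 x d ξ δ k l]
  rw [Finset.mul_sum, Finset.sum_congr rfl fun m _ => key m, Finset.sum_add_distrib,
    Finset.sum_sub_distrib, ← Finset.sum_mul]
  by_cases h1 : j = k <;> by_cases h2 : l = i <;> simp [h1, h2, weylEv]

theorem weylEv_weylOd (i j k l : Fin n) : weylEv x d ξ δ i j * weylOd x d ξ δ k l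
    = weylOd x d ξ δ k l * weylEv x d ξ δ i j + ((if j = k then weylOd x d ξ δ i l else 0)
      - if l = i then weylOd x d ξ δ k j else 0) := by
  have key : ∀ m, weylEv x d ξ δ i j * (x (m, k) * δ (m, l) + ξ (m, k) * d (m, l))
      = (x (m, k) * δ (m, l) + ξ (m, k) * d (m, l)) * weylEv x d ξ δ i j
        + ((if j = k then x (m, i) * δ (m, l) + ξ (m, i) * d (m, l) else 0)
          - if l = i then x (m, k) * δ (m, j) + ξ (m, k) * d (m, j) else 0) := by
    intro m
    rw [mul_add, ← mul_assoc, ← mul_assoc, weylEv_x h, weylEv_ξ h, add_mul, add_mul, mul_assoc,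
      mul_assoc, weylEv_d h, weylEv_δ h, add_mul, mul_add, mul_add, mul_assoc, mul_assoc]
    by_cases h1 : j = k <;> by_cases h2 : l = i <;> simp [h1, h2] <;> abel
  conv_lhs => rw [weylOd.eq_1 x d ξ δ k l]
  rw [Finset.mul_sum, Finset.sum_congr rfl fun m _ => key m, Finset.sum_add_distrib,
    Finset.sum_sub_distrib, ← Finset.sum_mul]
  by_cases h1 : j = k <;> by_cases h2 : l = i <;> simp [h1, h2, weylOd]

theorem weylOd_weylOd (i j k l : Fin n) : weylOd x d ξ δ i j * weylOd x d ξ δ k l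
    = -(weylOd x d ξ δ k l * weylOd x d ξ δ i j) + ((if j = k then weylEv x d ξ δ i l else 0)
      + if l = i then weylEv x d ξ δ k j else 0) := by
  have key : ∀ m, weylOd x d ξ δ i j * (x (m, k) * δ (m, l) + ξ (m, k) * d (m, l))
      = -((x (m, k) * δ (m, l) + ξ (m, k) * d (m, l)) * weylOd x d ξ δ i j)
        + ((if j = k then x (m, i) * d (m, l) + ξ (m, i) * δ (m, l) else 0)
          + if l = i then x (m, k) * d (m, j) + ξ (m, k) * δ (m, j) else 0) := by
    intro m
    rw [mul_add, ← mul_assoc, ← mul_assoc, weylOd_x h, weylOd_ξ h, add_mul, add_mul, neg_mul,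
      mul_assoc, mul_assoc, weylOd_d h, weylOd_δ h, add_mul, mul_add, mul_add, mul_assoc, mul_assoc]
    by_cases h1 : j = k <;> by_cases h2 : l = i <;> simp [h1, h2] <;> abel
  conv_lhs => rw [weylOd.eq_1 x d ξ δ k l]
  rw [Finset.mul_sum, Finset.sum_congr rfl fun m _ => key m, Finset.sum_add_distrib,
    Finset.sum_add_distrib, Finset.sum_neg_distrib, ← Finset.sum_mul]
  by_cases h1 : j = k <;> by_cases h2 : l = i <;> simp [h1, h2, weylOd, weylEv]

/-- Summands with different k commute, as do the even and odd parts of one summand, so the p-th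
power is additive. The even part contributes a(k, i) b(k, j), which survives only for k = i; for i =
j the Euler operators reproduce themselves, and for i ≠ j only the constant remains. -/
theorem weylEv_pow [Fact p.Prime] [CharP K p] [CharP B p]
    (ha : ∀ k i, a (k, i) = if k = i then 1 else 0) (i j : Fin n) :
    weylEv x d ξ δ i j ^ p
      = (if i = j then weylEv x d ξ δ i j else 0) + algebraMap K B (b (i, j)) := by
  have hp := (Fact.out : p.Prime)
  have hxd : ∀ k l, k ≠ l → Commute (x (k, i)) (d (l, j)) := fun k l hkl => by
    have := h.d_x (l, j) (k, i)
    rw [if_neg (by simp [hkl.symm]), add_zero] at this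
    exact this.symm
  have hξδ : ∀ k l, k ≠ l → Commute (ξ (k, i) * δ (k, j)) (ξ (l, i) * δ (l, j)) := by
    intro k l hkl
    have h1 := h.δ_ξ (k, j) (l, i)
    have h2 := h.δ_ξ (l, j) (k, i)
    rw [if_neg (by simp [hkl]), add_zero] at h1
    rw [if_neg (by simp [hkl.symm]), add_zero] at h2
    rw [Commute, SemiconjBy, mul_assoc, ← mul_assoc (δ _), h1, mul_assoc, ← mul_assoc (δ _), h2,
      neg_mul, neg_mul, mul_neg, mul_neg, mul_assoc, mul_assoc, h.δ_δ (k, j), ← mul_assoc,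
      ← mul_assoc, h.ξ_ξ (k, i)]
    simp
  have hmix : ∀ k l, Commute (x (k, i) * d (k, j)) (ξ (l, i) * δ (l, j)) := fun k l =>
    ((h.x_ξ _ _).mul_right (h.x_δ _ _)).mul_left ((h.d_ξ _ _).mul_right (h.d_δ _ _))
  have hterm : ∀ k, (x (k, i) * d (k, j) + ξ (k, i) * δ (k, j)) ^ p
      = (if i = j then x (k, i) * d (k, j) + ξ (k, i) * δ (k, j) else 0)
        + if k = i then algebraMap K B (b (i, j)) else 0 := by
    intro k
    rw [add_pow_char_of_commute p (hmix k k)]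
    by_cases hij : i = j
    · subst hij
      rw [h.x_mul_d_pow, h.ξ_mul_δ_pow hp.one_le, if_pos rfl, ha]
      by_cases hki : k = i
      · subst hki; simp; abel
      · simp [hki]
    · rw [h.x_mul_d_pow_of_ne (by simp [hij]), h.ξ_mul_δ_pow_of_ne hp.two_le (by simp [hij]),
        if_neg hij, ha]
      by_cases hki : k = i
      · subst hki; simp
      · simp [hki]
  have hsum : ∀ s : Finset (Fin n), (∑ k ∈ s, (x (k, i) * d (k, j) + ξ (k, i) * δ (k, j))) ^ p
      = ∑ k ∈ s, (x (k, i) * d (k, j) + ξ (k, i) * δ (k, j)) ^ p := by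
    intro s
    induction s using Finset.induction_on with
    | empty => simp [hp.ne_zero]
    | insert k s hk ih =>
      rw [Finset.sum_insert hk, Finset.sum_insert hk, add_pow_char_of_commute p, ih]
      refine Commute.sum_right _ _ _ fun l hl => ?_
      have hkl : k ≠ l := fun e => hk (e ▸ hl)
      refine (Commute.add_right ?_ (hmix k l)).add_left
        ((hmix l k).symm.add_right (hξδ k l hkl))
      exact ((h.x_x _ _).mul_right (hxd k l hkl)).mul_left
        ((hxd l k hkl.symm).symm.mul_right (h.d_d _ _))
  rw [weylEv, hsum, Finset.sum_congr rfl fun k _ => hterm k, Finset.sum_add_distrib,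
    Finset.sum_ite_eq' Finset.univ i, if_pos (Finset.mem_univ i)]
  by_cases hij : i = j <;> simp [hij]

end Family

end QueerSuper

/-! ### Homomorphisms determined on matrix units -/

namespace QueerSuper

section MatSum

variable {K B : Type*} [Field K] [Ring B] [Algebra K B] {n : ℕ}

/-- The linear map on matrices with prescribed values on the matrix units. -/
def matSum (s : Fin n → Fin n → B) : Matrix (Fin n) (Fin n) K →ₗ[K] B where
  toFun A := ∑ i, ∑ j, A i j • s i j
  map_add' A A' := by simp [add_smul, Finset.sum_add_distrib]
  map_smul' c A := by simp [mul_smul, Finset.smul_sum]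

theorem matSum_single (s : Fin n → Fin n → B) (i j : Fin n) (c : K) :
    matSum s (Matrix.single i j c) = c • s i j := by
  simp only [matSum, LinearMap.coe_mk, AddHom.coe_mk, Matrix.single_apply, ite_smul, zero_smul]
  rw [Finset.sum_eq_single i, Finset.sum_eq_single j]
  · simp
  · intro k _ hk
    simp [hk.symm]
  · simp
  · intro k _ hk
    simp [hk.symm]
  · simp

/-- The scalar η is the super sign, so that commutators and anticommutators are treated at once. -/
theorem matSum_mul_matSum {s t r : Fin n → Fin n → B} {η : K}
    (hst : ∀ i j k l, s i j * t k l = η • (t k l * s i j)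
      + ((if j = k then r i l else 0) - η • if l = i then r k j else 0))
    (X Y : Matrix (Fin n) (Fin n) K) :
    matSum s X * matSum t Y = η • (matSum t Y * matSum s X) + matSum r (X * Y - η • (Y * X)) := by
  induction X using Matrix.induction_on' with
  | h_zero => simp
  | h_add X X' h h' =>
    rw [map_add, add_mul, h, h', add_mul, mul_add, mul_add, smul_add, smul_add, add_sub_add_comm,
      map_add]
    abel
  | h_std_basis i j c =>
    induction Y using Matrix.induction_on' with
    | h_zero => simp
    | h_add Y Y' h h' =>
      rw [map_add, mul_add, h, h', mul_add, add_mul, add_mul, smul_add, smul_add, add_sub_add_comm,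
        map_add]
      abel
    | h_std_basis k l c' =>
      rw [matSum_single, matSum_single, smul_mul_smul_comm, hst, smul_mul_smul_comm, mul_comm c' c,
        smul_comm η (c * c'), smul_add, add_right_inj, map_sub, map_smul, smul_sub,
        smul_comm (c * c') η]
      congr 2
      · by_cases h1 : j = k
        · subst h1
          rw [Matrix.single_mul_single_same, if_pos rfl, matSum_single]
        · rw [Matrix.single_mul_single_of_ne _ _ _ _ h1, if_neg h1, smul_zero, map_zero]
      · by_cases h2 : l = i
        · subst h2
          rw [Matrix.single_mul_single_same, if_pos rfl, matSum_single, mul_comm c' c]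
        · rw [Matrix.single_mul_single_of_ne _ _ _ _ h2, if_neg h2, smul_zero, map_zero]

/-- By Jacobson's formula the defect in the p-th power relation is additive in X, so it suffices to
check multiples of matrix units, which are semisimple on the diagonal and square to zero off it. -/
theorem matSum_pow {p : ℕ} [Fact p.Prime] [CharP K p] {ev : Fin n → Fin n → B}
    (hev : ∀ i j k l, ev i j * ev k l = ev k l * ev i j
      + ((if j = k then ev i l else 0) - if l = i then ev k j else 0))
    (χ : Matrix (Fin n) (Fin n) K →ₗ[K] K)
    (hpow : ∀ i j, ev i j ^ p = (if i = j then ev i j else 0)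
      + algebraMap K B (χ (Matrix.single i j 1) ^ p)) (X : Matrix (Fin n) (Fin n) K) :
    matSum ev X ^ p = matSum ev (X ^ p) + algebraMap K B (χ X ^ p) := by
  have hp := (Fact.out : p.Prime)
  have hlie : ∀ X Y : Matrix (Fin n) (Fin n) K,
      matSum ev (X * Y - Y * X) = matSum ev X * matSum ev Y - matSum ev Y * matSum ev X := by
    intro X Y
    have := matSum_mul_matSum (s := ev) (t := ev) (r := ev) (η := (1 : K))
      (by simpa only [one_smul] using hev) X Y
    rw [one_smul, one_smul] at this
    rw [this]
    abel
  induction X using Matrix.induction_on' with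
  | h_zero => simp [hp.ne_zero]
  | h_add X Y hX hY =>
    have h1 := map_add_pow_sub (matSum ev) hlie X Y (p := p)
    rw [map_sub, map_sub] at h1
    rw [map_add, map_add, add_pow_char, map_add,
      ← sub_add_cancel (matSum ev ((X + Y) ^ p)) (matSum ev (X ^ p) + matSum ev (Y ^ p)), ← sub_sub,
      h1, hX, hY]
    abel
  | h_std_basis i j c =>
    have hχ : χ (Matrix.single i j c) = c * χ (Matrix.single i j 1) := by
      rw [← smul_eq_mul, ← map_smul, Matrix.smul_single, smul_eq_mul, mul_one]
    rw [matSum_single, smul_pow, hpow, hχ, smul_add, mul_pow, map_mul, Algebra.smul_def,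
      ← Algebra.smul_def (c ^ p) (algebraMap K B _), Algebra.smul_def (c ^ p) (algebraMap K B _)]
    congr 1
    by_cases hij : i = j
    · subst hij
      have : ∀ m : ℕ, Matrix.single i i c ^ (m + 1) = Matrix.single i i (c ^ (m + 1)) := by
        intro m
        induction m with
        | zero => simp
        | succ m ih => rw [pow_succ, ih, Matrix.single_mul_single_same, ← pow_succ]
      obtain ⟨m, hm⟩ := Nat.exists_eq_succ_of_ne_zero hp.ne_zero
      rw [if_pos rfl, ← Algebra.smul_def, hm, this m, matSum_single]
    · have h0 : Matrix.single i j c ^ p = 0 :=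
        pow_eq_zero_of_le hp.two_le (by
          rw [pow_two, Matrix.single_mul_single_of_ne _ _ _ _ (Ne.symm hij)])
      rw [if_neg hij, mul_zero, h0, map_zero]

end MatSum

section Blocks

variable {K : Type*} [Field K] {n : ℕ}

theorem evenElt_mul_evenElt (X Y : Matrix (Fin n) (Fin n) K) :
    evenElt K n X * evenElt K n Y = evenElt K n (X * Y) :=
  Subtype.ext (by simp [evenElt, Matrix.fromBlocks_multiply])

theorem evenElt_mul_oddElt (X Y : Matrix (Fin n) (Fin n) K) :
    evenElt K n X * oddElt K n Y = oddElt K n (X * Y) :=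
  Subtype.ext (by simp [evenElt, oddElt, Matrix.fromBlocks_multiply])

theorem oddElt_mul_evenElt (X Y : Matrix (Fin n) (Fin n) K) :
    oddElt K n X * evenElt K n Y = oddElt K n (X * Y) :=
  Subtype.ext (by simp [evenElt, oddElt, Matrix.fromBlocks_multiply])

theorem oddElt_mul_oddElt (X Y : Matrix (Fin n) (Fin n) K) :
    oddElt K n X * oddElt K n Y = evenElt K n (X * Y) :=
  Subtype.ext (by simp [evenElt, oddElt, Matrix.fromBlocks_multiply])

theorem evenElt_pow (X : Matrix (Fin n) (Fin n) K) (m : ℕ) :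
    evenElt K n X ^ m = evenElt K n (X ^ m) := by
  induction m with
  | zero => exact Subtype.ext (by simp [evenElt])
  | succ m ih => rw [pow_succ, pow_succ, ih, evenElt_mul_evenElt]

end Blocks

section Lift

variable {K B : Type*} [Field K] [Ring B] [Algebra K B] {n : ℕ} {p : ℕ} [Fact p.Prime] [CharP K p]
  (χ : Module.Dual K (queerPart K n 0))

/-- `χ` as a linear form on matrices. -/
def charGL : Matrix (Fin n) (Fin n) K →ₗ[K] K :=
  χ ∘ₗ LinearMap.codRestrict (queerPart K n 0) (evenElt K n) evenElt_mem

variable {ev od : Fin n → Fin n → B}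

/-- A homomorphism out of `U_χ(q(n))` with prescribed values on the matrix units. -/
theorem exists_algHom
    (hee : ∀ i j k l, ev i j * ev k l = ev k l * ev i j
      + ((if j = k then ev i l else 0) - if l = i then ev k j else 0))
    (heo : ∀ i j k l, ev i j * od k l = od k l * ev i j
      + ((if j = k then od i l else 0) - if l = i then od k j else 0))
    (hoo : ∀ i j k l, od i j * od k l = -(od k l * od i j)
      + ((if j = k then ev i l else 0) + if l = i then ev k j else 0))
    (hpow : ∀ i j, ev i j ^ p = (if i = j then ev i j else 0)
      + algebraMap K B (χ (ofGL (Matrix.single i j 1)) ^ p)) :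
    ∃ F : ReducedEnvelope p χ →ₐ[K] B,
      (∀ i j, F (redι p χ (evenElt K n (Matrix.single i j 1))) = ev i j) ∧
      ∀ i j, F (redι p χ (oddElt K n (Matrix.single i j 1))) = od i j := by
  have h2 : ∀ k : ZMod 2, k = 0 ∨ k = 1 := by decide
  let f : queer K n →ₗ[K] B := matSum ev ∘ₗ evenBlock + matSum od ∘ₗ oddBlock
  have f0 : ∀ X, f (evenElt K n X) = matSum ev X := fun X => by
    have h1 : evenBlock (evenElt K n X) = X := rfl
    have h2 : oddBlock (evenElt K n X) = 0 := rfl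
    simp [f, h1, h2]
  have f1 : ∀ X, f (oddElt K n X) = matSum od X := fun X => by
    have h1 : evenBlock (oddElt K n X) = 0 := rfl
    have h2 : oddBlock (oddElt K n X) = X := rfl
    simp [f, h1, h2]
  have s00 : sign K 0 0 = 1 := by simp [sign]
  have s01 : sign K 0 1 = 1 := by simp [sign]
  have s10 : sign K 1 0 = 1 := by simp [sign]
  have s11 : sign K 1 1 = -1 := by simp [sign, ZMod.val_one]
  have hf : ∀ (i j : ZMod 2) (x y : queer K n), x ∈ queerPart K n i → y ∈ queerPart K n j →
      f x * f y = sign K i j • (f y * f x) + f (superBracket i j x y) := by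
    intro i j x y hx hy
    rcases h2 i with rfl | rfl <;> rcases h2 j with rfl | rfl <;>
      simp only [queerPart, one_ne_zero, if_true, if_false, LinearMap.mem_range] at hx hy <;>
      obtain ⟨X, rfl⟩ := hx <;> obtain ⟨Y, rfl⟩ := hy <;>
      simp only [superBracket, evenElt_mul_evenElt,
        evenElt_mul_oddElt, oddElt_mul_evenElt, oddElt_mul_oddElt, ← map_smul, ← map_sub, f0, f1] <;>
      refine matSum_mul_matSum (fun i j k l => ?_) X Y
    · simpa only [s00, one_smul] using hee i j k l
    · simpa only [s01, one_smul] using heo i j k l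
    · rw [s10, one_smul, one_smul, heo k l i j]
      abel
    · simpa only [s11, neg_smul, one_smul, sub_neg_eq_add] using hoo i j k l
  have hf' : ∀ x : queerPart K n 0,
      f x ^ p = f ((x : queer K n) ^ p) + algebraMap K B (χ x ^ p) := by
    rintro ⟨x, hx⟩
    have hx' := hx
    simp only [queerPart, if_true, LinearMap.mem_range] at hx'
    obtain ⟨X, rfl⟩ := hx'
    have := matSum_pow hee (charGL χ) hpow X
    change f (evenElt K n X) ^ p = f (evenElt K n X ^ p) + _
    rw [evenElt_pow, f0, f0]
    exact this
  refine ⟨redLift p χ f hf hf', fun i j => ?_, fun i j => ?_⟩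
  · rw [redLift_ι, f0, matSum_single, one_smul]
  · rw [redLift_ι, f1, matSum_single, one_smul]

end Lift

end QueerSuper

/-! ### The Fock representation -/

namespace QueerSuper

section Fock

open scoped TensorProduct

universe u

variable {K : Type u} [Field K] {σ : Type} [DecidableEq σ] (p : ℕ)

/-- Polynomials truncated at the `p`-th powers of the variables, with the operators of
multiplication by the variables, the partial derivatives, and the constant coefficient. -/
theorem exists_truncated_weyl [Fact p.Prime] [CharP K p] :
    ∃ (P : Type u) (_ : AddCommGroup P) (_ : Module K P) (x d : σ → Module.End K P) (v : P)
      (ℓ : P →ₗ[K] K), (∀ s t, Commute (x s) (x t)) ∧ (∀ s t, Commute (d s) (d t)) ∧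
      (∀ s t, d s * x t = x t * d s + if s = t then 1 else 0) ∧ (∀ s, x s ^ p = 0) ∧
      (∀ s, d s ^ p = 0) ∧ (∀ s, d s v = 0) ∧ ℓ v = 1 ∧ ∀ s w, ℓ (x s w) = 0 := by
  have hp := (Fact.out : p.Prime)
  let I : Ideal (MvPolynomial σ K) := Ideal.span (Set.range fun s => MvPolynomial.X s ^ p)
  let J : Submodule K (MvPolynomial σ K) := I.restrictScalars K
  let X : σ → Module.End K (MvPolynomial σ K) := fun s => LinearMap.mulLeft K (MvPolynomial.X s)
  let D : σ → Module.End K (MvPolynomial σ K) := fun s => (MvPolynomial.pderiv s).toLinearMap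
  have hX : ∀ s, J ≤ J.comap (X s) := fun s f hf => I.mul_mem_left _ hf
  -- The ideal of p-th powers of the variables is stable under derivations because the derivative of
  -- X ^ p is zero.
  have hD : ∀ s, J ≤ J.comap (D s) := by
    intro s f hf
    change f ∈ I at hf
    change MvPolynomial.pderiv s f ∈ I
    induction hf using Submodule.span_induction with
    | mem f hf =>
      obtain ⟨t, rfl⟩ := hf
      simp
    | zero => simp
    | add f g _ _ hf hg => rw [map_add]; exact I.add_mem hf hg
    | smul c f h hf =>
      rw [smul_eq_mul, MvPolynomial.pderiv_mul]
      exact I.add_mem (I.mul_mem_left _ h) (I.mul_mem_left _ hf)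
  have hℓ : J ≤ LinearMap.ker (MvPolynomial.lcoeff K (0 : σ →₀ ℕ)) := by
    intro f hf
    change f ∈ I at hf
    change MvPolynomial.constantCoeff f = 0
    induction hf using Submodule.span_induction with
    | mem f hf =>
      obtain ⟨t, rfl⟩ := hf
      simp [hp.ne_zero]
    | zero => simp
    | add f g _ _ hf hg => rw [map_add, hf, hg, add_zero]
    | smul c f h hf => rw [smul_eq_mul, map_mul, hf, mul_zero]
  have hDX : ∀ s t, D s * X t = X t * D s + if s = t then 1 else 0 := by
    intro s t
    refine LinearMap.ext fun f => ?_
    by_cases hst : s = t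
    · subst hst
      simp [D, X]
    · simp [D, X, hst, MvPolynomial.pderiv_X_of_ne (Ne.symm hst)]
  have hDD : ∀ s t, Commute (D s) (D t) := by
    intro s t
    refine LinearMap.ext fun f => ?_
    change MvPolynomial.pderiv s (MvPolynomial.pderiv t f)
      = MvPolynomial.pderiv t (MvPolynomial.pderiv s f)
    have := congrArg (fun D : Derivation K _ (MvPolynomial σ K) => D f)
      (MvPolynomial.derivation_ext (D₁ := ⁅MvPolynomial.pderiv (R := K) s, MvPolynomial.pderiv t⁆)
        (D₂ := 0) fun u => by
          simp [Derivation.commutator_apply, MvPolynomial.pderiv_X, Pi.single_apply, apply_ite])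
    rw [Derivation.commutator_apply] at this
    exact sub_eq_zero.1 this
  -- The p-th power annihilates constants and commutes with multiplication by every variable, the
  -- correction p D ^ (p - 1) being zero.
  have hDp : ∀ s, D s ^ p = 0 := by
    intro s
    refine LinearMap.ext fun f => ?_
    change (D s ^ p) f = 0
    induction f using MvPolynomial.induction_on with
    | C a =>
      rw [← Nat.sub_add_cancel hp.one_le, pow_succ, Module.End.mul_apply]
      simp [D]
    | add f g hf hg => rw [map_add, hf, hg, add_zero]
    | mul_X f t hf =>
      have hc : D s ^ p * X t = X t * D s ^ p := by
        by_cases hst : s = t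
        · subst hst
          have := hDX s s
          rw [if_pos rfl] at this
          have hz : ((p : ℕ) : Module.End K (MvPolynomial σ K)) = 0 := by
            rw [← map_natCast (algebraMap K _), CharP.cast_eq_zero, map_zero]
          rw [pow_mul_of_mul_eq_add_one this, hz, zero_mul, add_zero]
        · have := hDX s t
          rw [if_neg hst, add_zero] at this
          exact Commute.pow_left this p
      have := LinearMap.congr_fun hc f
      rw [Module.End.mul_apply, Module.End.mul_apply, hf, map_zero] at this
      rwa [mul_comm]
  refine ⟨_ ⧸ J, inferInstance, inferInstance, fun s => J.mapQ J (X s) (hX s),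
    fun s => J.mapQ J (D s) (hD s), J.mkQ 1, J.liftQ _ hℓ, fun s t => ?_, fun s t => ?_,
    fun s t => ?_, fun s => ?_, fun s => ?_, fun s => ?_, ?_, fun s w => ?_⟩
  · refine LinearMap.ext fun w => ?_
    obtain ⟨f, rfl⟩ := J.mkQ_surjective w
    exact congrArg J.mkQ (mul_left_comm _ _ _)
  · refine LinearMap.ext fun w => ?_
    obtain ⟨f, rfl⟩ := J.mkQ_surjective w
    exact congrArg J.mkQ (LinearMap.congr_fun (hDD s t) f)
  · refine LinearMap.ext fun w => ?_
    obtain ⟨f, rfl⟩ := J.mkQ_surjective w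
    have := congrArg J.mkQ (LinearMap.congr_fun (hDX s t) f)
    split_ifs at this ⊢ <;> exact this
  · refine LinearMap.ext fun w => ?_
    obtain ⟨f, rfl⟩ := J.mkQ_surjective w
    rw [← Submodule.mapQ_pow]
    refine (Submodule.Quotient.mk_eq_zero J).2 ?_
    rw [LinearMap.pow_mulLeft]
    exact I.mul_mem_right _ (Ideal.subset_span ⟨s, rfl⟩)
  · refine LinearMap.ext fun w => ?_
    obtain ⟨f, rfl⟩ := J.mkQ_surjective w
    rw [← Submodule.mapQ_pow]
    refine (Submodule.Quotient.mk_eq_zero J).2 ?_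
    rw [hDp]
    exact J.zero_mem
  · change J.mkQ (D s 1) = 0
    simp [D]
  · change MvPolynomial.coeff 0 1 = 1
    simp
  · obtain ⟨f, rfl⟩ := J.mkQ_surjective w
    change MvPolynomial.constantCoeff (MvPolynomial.X s * f) = 0
    simp

/-- The Fock representation of the Weyl-Clifford algebra on truncated polynomials in even and odd
variables, with its vacuum vector and the constant coefficient. -/
theorem exists_isWeylClifford [Fact p.Prime] [CharP K p] :
    ∃ (S : Type u) (_ : AddCommGroup S) (_ : Module K S) (x d ξ δ : σ → Module.End K S) (v : S)
      (ℓ : S →ₗ[K] K), IsWeylClifford p (0 : σ → K) (0 : σ → K) x d ξ δ ∧ (∀ s, d s v = 0) ∧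
      (∀ s, δ s v = 0) ∧ ℓ v = 1 ∧ (∀ s w, ℓ (x s w) = 0) ∧ ∀ s w, ℓ (ξ s w) = 0 := by
  have hp := (Fact.out : p.Prime)
  obtain ⟨P, _, _, x, d, v, ℓ, hxx, hdd, hdx, hxp, hdp, hdv, hℓv, hℓx⟩ :=
    exists_truncated_weyl (K := K) (σ := σ) p
  let Λ := ExteriorAlgebra K (σ → K)
  let e : σ → σ → K := fun s => Pi.single s 1
  let e' : σ → Module.Dual K (σ → K) := fun s => LinearMap.proj s
  let ξ : σ → Module.End K Λ := fun s => LinearMap.mulLeft K (ExteriorAlgebra.ι K (e s))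
  let δ : σ → Module.End K Λ := fun s => CliffordAlgebra.contractLeft (e' s)
  have he : ∀ s t, e' s (e t) = if s = t then 1 else 0 := fun s t => by
    simp [e, e', Pi.single_apply]
  have hδξ : ∀ s t, δ s * ξ t = -(ξ t * δ s) + if s = t then 1 else 0 := by
    intro s t
    refine LinearMap.ext fun w => ?_
    have h1 : δ s (ξ t w) = e' s (e t) • w - ξ t (δ s w) := CliffordAlgebra.contractLeft_ι_mul ..
    rw [he] at h1
    change δ s (ξ t w) = _
    rw [h1]
    by_cases hst : s = t <;> simp [hst]
    abel
  have hξξ : ∀ s, ξ s * ξ s = 0 := fun s => LinearMap.ext fun w => by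
    have h : (ExteriorAlgebra.ι K (e s) * ExteriorAlgebra.ι K (e s) : Λ) = 0 :=
      ExteriorAlgebra.ι_sq_zero _
    change ExteriorAlgebra.ι K (e s) * (ExteriorAlgebra.ι K (e s) * w) = 0
    rw [← mul_assoc, h, zero_mul]
  -- Even operators act on the truncated polynomials and odd ones on the exterior algebra. The mixed
  -- relations are plain commutation, so no sign twist is needed.
  let r := Module.End.rTensorAlgHom K P Λ
  let l := Module.End.lTensorAlgHom K Λ P
  have hlr : ∀ f g, Commute (r f) (l g) := fun f g => by
    change LinearMap.rTensor Λ f ∘ₗ LinearMap.lTensor P g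
      = LinearMap.lTensor P g ∘ₗ LinearMap.rTensor Λ f
    rw [LinearMap.rTensor_comp_lTensor, LinearMap.lTensor_comp_rTensor]
  refine ⟨P ⊗[K] Λ, inferInstance, inferInstance, fun s => r (x s), fun s => r (d s),
    fun s => l (ξ s), fun s => l (δ s), v ⊗ₜ 1,
    LinearMap.mul' K K ∘ₗ TensorProduct.map ℓ ExteriorAlgebra.algebraMapInv.toLinearMap,
    ⟨fun s t => (hxx s t).map r, fun s t => (hdd s t).map r, fun s t => ?_, fun s t => ?_,
      fun s t => ?_, fun s t => ?_, fun s => ?_, fun s => ?_, fun s t => hlr _ _, fun s t => hlr _ _,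
      fun s t => hlr _ _, fun s t => hlr _ _, fun s => ?_, fun s => ?_⟩, fun s => ?_, fun s => ?_,
    ?_, fun s w => ?_, fun s w => ?_⟩
  · rw [← map_mul, hdx, map_add, map_mul]
    split_ifs <;> simp
  · rw [← map_mul, ← map_mul, ← map_neg]
    congr 1
    refine LinearMap.ext fun w => ?_
    have := ExteriorAlgebra.ι_add_mul_swap (R := K) (e s) (e t)
    simp only [ξ, Module.End.mul_apply, LinearMap.mulLeft_apply, ← mul_assoc, LinearMap.neg_apply,
      ← neg_mul]
    rw [eq_neg_of_add_eq_zero_left this]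
    simp only [neg_mul]
    exact neg_mul _ _
  · rw [← map_mul l (δ s), ← map_mul l (δ t), ← map_neg]
    congr 1
    exact LinearMap.ext fun w => CliffordAlgebra.contractLeft_comm ..
  · rw [← map_mul l (δ s), hδξ, map_add, map_neg, map_mul]
    split_ifs <;> simp
  · rw [← map_mul, hξξ, map_zero]
  · rw [← map_mul l (δ s), show δ s * δ s = 0 from
      LinearMap.ext fun w => CliffordAlgebra.contractLeft_contractLeft .., map_zero]
  · rw [← map_pow, hxp, map_zero, Pi.zero_apply, map_zero]
  · rw [← map_pow, hdp, map_zero, Pi.zero_apply, map_zero]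
  · change d s v ⊗ₜ[K] (1 : Λ) = 0
    rw [hdv, TensorProduct.zero_tmul]
  · change v ⊗ₜ[K] δ s (1 : Λ) = 0
    rw [show δ s (1 : Λ) = 0 from CliffordAlgebra.contractLeft_one .., TensorProduct.tmul_zero]
  · change ℓ v * ExteriorAlgebra.algebraMapInv (1 : Λ) = 1
    rw [hℓv, map_one, one_mul]
  · induction w with
    | zero => simp
    | add w w' h h' => rw [map_add, map_add, h, h', add_zero]
    | tmul w w' =>
      change ℓ (x s w) * _ = 0
      rw [hℓx, zero_mul]
  · induction w with
    | zero => simp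
    | add w w' h h' => rw [map_add, map_add, h, h', add_zero]
    | tmul w w' =>
      change _ * ExteriorAlgebra.algebraMapInv (ExteriorAlgebra.ι K (e s) * w') = 0
      rw [map_mul, ExteriorAlgebra.algebraMapInv, ExteriorAlgebra.lift_ι_apply]
      simp

end Fock

end QueerSuper

/-! ### Filtration and leading terms -/

namespace QueerSuper

section Filtration

variable {K S σ : Type*} [Field K] [AddCommGroup S] [Module K S]
  (x d ξ δ : σ → Module.End K S)

/-- The filtration by powers of the augmentation ideal of the algebra of raising operators. -/
def raiseFiltration : ℕ → Submodule K S
  | 0 => ⊤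
  | m + 1 => ⨆ s, (raiseFiltration m).map (x s) ⊔ (raiseFiltration m).map (ξ s)

variable {x d ξ δ}

theorem x_mem_raiseFiltration {m : ℕ} {w : S} (hw : w ∈ raiseFiltration x ξ m) (s : σ) :
    x s w ∈ raiseFiltration x ξ (m + 1) :=
  Submodule.mem_iSup_of_mem s (Submodule.mem_sup_left (Submodule.mem_map_of_mem hw))

theorem ξ_mem_raiseFiltration {m : ℕ} {w : S} (hw : w ∈ raiseFiltration x ξ m) (s : σ) :
    ξ s w ∈ raiseFiltration x ξ (m + 1) :=
  Submodule.mem_iSup_of_mem s (Submodule.mem_sup_right (Submodule.mem_map_of_mem hw))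

theorem raiseFiltration_succ_le {m : ℕ} {N : Submodule K S}
    (hx : ∀ s, ∀ w ∈ raiseFiltration x ξ m, x s w ∈ N)
    (hξ : ∀ s, ∀ w ∈ raiseFiltration x ξ m, ξ s w ∈ N) : raiseFiltration x ξ (m + 1) ≤ N :=
  iSup_le fun s => sup_le (Submodule.map_le_iff_le_comap.2 (hx s))
    (Submodule.map_le_iff_le_comap.2 (hξ s))

theorem raiseFiltration_antitone : Antitone (raiseFiltration x ξ) := by
  refine antitone_nat_of_succ_le fun m => ?_
  induction m with
  | zero => exact le_top
  | succ m ih =>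
    exact raiseFiltration_succ_le (fun s w hw => x_mem_raiseFiltration (ih hw) s)
      fun s w hw => ξ_mem_raiseFiltration (ih hw) s

/-- Moving D past a raising operator costs only a scalar, and that scalar term has lost exactly one
raising factor. -/
theorem lower_mem_raiseFiltration {D : Module.End K S}
    (hx : ∀ s, ∃ c : K, D * x s = x s * D + c • 1)
    (hξ : ∀ s, ∃ η c : K, D * ξ s = η • (ξ s * D) + c • 1) {m : ℕ} :
    ∀ {w : S}, w ∈ raiseFiltration x ξ (m + 1) → D w ∈ raiseFiltration x ξ m := by
  induction m with
  | zero => exact fun _ => Submodule.mem_top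
  | succ m ih =>
    intro w hw
    refine raiseFiltration_succ_le (N := (raiseFiltration x ξ (m + 1)).comap D)
      (fun s w hw => ?_) (fun s w hw => ?_) hw
    · obtain ⟨c, hc⟩ := hx s
      have := LinearMap.congr_fun hc w
      change D (x s w) = x s (D w) + c • w at this
      rw [Submodule.mem_comap, this]
      exact Submodule.add_mem _ (x_mem_raiseFiltration (ih hw) s) (Submodule.smul_mem _ _ hw)
    · obtain ⟨η, c, hc⟩ := hξ s
      have := LinearMap.congr_fun hc w
      change D (ξ s w) = η • ξ s (D w) + c • w at this
      rw [Submodule.mem_comap, this]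
      exact Submodule.add_mem _ (Submodule.smul_mem _ _ (ξ_mem_raiseFiltration (ih hw) s))
        (Submodule.smul_mem _ _ hw)

variable (x ξ) in
/-- The operator `X` lowers the filtration by at most `e`, with leading term `X₀`. -/
def HasLeading (e : ℕ) (X X₀ : Module.End K S) : Prop :=
  ∀ m, ∀ w ∈ raiseFiltration x ξ (m + e),
    (X - X₀) w ∈ raiseFiltration x ξ (m + 1) ∧ X₀ w ∈ raiseFiltration x ξ m

namespace HasLeading

variable {e e' : ℕ} {X X₀ Y Y₀ : Module.End K S}

theorem one : HasLeading x ξ 0 1 1 := fun m w hw => by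
  simpa using hw

theorem mul (hX : HasLeading x ξ e X X₀) (hY : HasLeading x ξ e' Y Y₀) :
    HasLeading x ξ (e + e') (X * Y) (X₀ * Y₀) := by
  intro m w hw
  rw [← add_assoc] at hw
  obtain ⟨h1, h2⟩ := hY _ w hw
  obtain ⟨h3, h4⟩ := hX _ _ h2
  rw [add_right_comm] at h1
  obtain ⟨h5, h6⟩ := hX _ _ h1
  refine ⟨?_, h4⟩
  rw [show X * Y - X₀ * Y₀ = (X - X₀) * (Y - Y₀) + X₀ * (Y - Y₀) + (X - X₀) * Y₀ by noncomm_ring]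
  exact Submodule.add_mem _ (Submodule.add_mem _
    (raiseFiltration_antitone (Nat.le_succ _) h5) h6) h3

theorem pow (hX : HasLeading x ξ e X X₀) (k : ℕ) : HasLeading x ξ (k * e) (X ^ k) (X₀ ^ k) := by
  induction k with
  | zero => simpa using one
  | succ k ih =>
    rw [pow_succ, pow_succ, Nat.succ_mul]
    exact ih.mul hX

theorem add_of_mem (hX : HasLeading x ξ e X X₀)
    (hY : ∀ m, ∀ w ∈ raiseFiltration x ξ (m + e), Y w ∈ raiseFiltration x ξ (m + 1)) :
    HasLeading x ξ e (X + Y) X₀ := by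
  intro m w hw
  obtain ⟨h1, h2⟩ := hX m w hw
  refine ⟨?_, h2⟩
  rw [add_sub_right_comm]
  exact Submodule.add_mem _ h1 (hY m w hw)

theorem neg (hX : HasLeading x ξ e X X₀) : HasLeading x ξ e (-X) (-X₀) := by
  intro m w hw
  obtain ⟨h1, h2⟩ := hX m w hw
  refine ⟨?_, Submodule.neg_mem _ h2⟩
  rw [show -X - -X₀ = -(X - X₀) by abel]
  exact Submodule.neg_mem _ h1

theorem of_mem (h : ∀ m, ∀ w ∈ raiseFiltration x ξ (m + e), X w ∈ raiseFiltration x ξ m) :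
    HasLeading x ξ e X X := fun m w hw => by
  rw [sub_self]
  exact ⟨Submodule.zero_mem _, h m w hw⟩

end HasLeading

end Filtration

section Monomials

variable {K S σ : Type*} [Field K] [AddCommGroup S] [Module K S] (p : ℕ)
  (x d ξ δ : σ → Module.End K S)

/-- The top power of the derivation with respect to an even or odd variable. -/
def topLower : σ ⊕ σ → Module.End K S := Sum.elim (fun s => d s ^ (p - 1)) δ

/-- The top power of an even or odd variable. -/
def topRaise : σ ⊕ σ → Module.End K S := Sum.elim (fun s => x s ^ (p - 1)) ξ

/-- The degree of the top power of a variable. -/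
def topDegree : σ ⊕ σ → ℕ := Sum.elim (fun _ => p - 1) fun _ => 1

variable {p x d ξ δ}

theorem topRaise_mem_raiseFiltration (u : σ ⊕ σ) {m : ℕ} {w : S} (hw : w ∈ raiseFiltration x ξ m) :
    topRaise p x ξ u w ∈ raiseFiltration x ξ (m + topDegree p u) := by
  rcases u with s | s
  · change (x s ^ (p - 1)) w ∈ raiseFiltration x ξ (m + (p - 1))
    induction p - 1 with
    | zero => simpa using hw
    | succ k ih =>
      rw [pow_succ', Module.End.mul_apply]
      exact x_mem_raiseFiltration ih s
  · exact ξ_mem_raiseFiltration hw s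

variable (p x d ξ δ) in
/-- The operator `X` has as leading term a nonzero multiple of the product of the top derivations
listed in `l`. -/
def HasTopLeading (l : List (σ ⊕ σ)) (X : Module.End K S) : Prop :=
  ∃ ε : K, ε ≠ 0 ∧
    HasLeading x ξ (l.map (topDegree p)).sum X (ε • (l.map (topLower p d δ)).prod)

theorem HasTopLeading.mul {l l' : List (σ ⊕ σ)} {X Y : Module.End K S}
    (hX : HasTopLeading p x d ξ δ l X) (hY : HasTopLeading p x d ξ δ l' Y) :
    HasTopLeading p x d ξ δ (l ++ l') (X * Y) := by
  obtain ⟨ε, hε, hX⟩ := hX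
  obtain ⟨ε', hε', hY⟩ := hY
  refine ⟨ε * ε', mul_ne_zero hε hε', ?_⟩
  have := hX.mul hY
  rwa [smul_mul_smul_comm, ← List.prod_append, ← List.sum_append, ← List.map_append,
    ← List.map_append] at this

theorem HasTopLeading.one : HasTopLeading p x d ξ δ [] (1 : Module.End K S) :=
  ⟨1, one_ne_zero, by simpa using HasLeading.one⟩

variable [DecidableEq σ] (h : IsWeylClifford p (0 : σ → K) 0 x d ξ δ)
include h

theorem IsWeylClifford.d_mem_raiseFiltration (s : σ) {m : ℕ} {w : S}
    (hw : w ∈ raiseFiltration x ξ (m + 1)) : d s w ∈ raiseFiltration x ξ m := by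
  refine lower_mem_raiseFiltration (fun t => ⟨if s = t then 1 else 0, ?_⟩)
    (fun t => ⟨1, 0, ?_⟩) hw
  · rw [h.d_x]
    split_ifs <;> simp
  · rw [(h.d_ξ s t).eq]
    simp

theorem IsWeylClifford.δ_mem_raiseFiltration (s : σ) {m : ℕ} {w : S}
    (hw : w ∈ raiseFiltration x ξ (m + 1)) : δ s w ∈ raiseFiltration x ξ m := by
  refine lower_mem_raiseFiltration (fun t => ⟨0, ?_⟩)
    (fun t => ⟨-1, if s = t then 1 else 0, ?_⟩) hw
  · rw [(h.x_δ t s).eq]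
    simp
  · rw [h.δ_ξ]
    split_ifs <;> simp

theorem sumElim_topRaise_apply {u u' : σ ⊕ σ} (hu : u ≠ u') {w : S} (hw : Sum.elim d δ u w = 0) :
    Sum.elim d δ u (topRaise p x ξ u' w) = 0 := by
  have of_commute : ∀ {f g : Module.End K S}, Commute f g → f w = 0 → f (g w) = 0 := by
    intro f g hfg hf
    rw [← Module.End.mul_apply, hfg.eq, Module.End.mul_apply, hf, map_zero]
  rcases u with s | s <;> rcases u' with t | t
  · have hst : s ≠ t := fun e => hu (e ▸ rfl)
    have := h.d_x s t
    rw [if_neg hst, add_zero] at this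
    exact of_commute (Commute.pow_right this _) hw
  · exact of_commute (h.d_ξ s t) hw
  · exact of_commute ((h.x_δ t s).symm.pow_right _) hw
  · have hst : s ≠ t := fun e => hu (e ▸ rfl)
    have := h.δ_ξ s t
    rw [if_neg hst, add_zero] at this
    change δ s (ξ t w) = 0
    change δ s w = 0 at hw
    rw [← Module.End.mul_apply, this, LinearMap.neg_apply, Module.End.mul_apply, hw, map_zero,
      neg_zero]

/-- The exponent `Sum.elim 1 0 u` is a switch: an even variable gives (p - 1)!, an odd one gives 1.
-/
theorem topLower_topRaise_apply (u : σ ⊕ σ) {w : S} (hw : Sum.elim d δ u w = 0) :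
    topLower p d δ u (topRaise p x ξ u w) = (((p - 1).factorial : ℕ) ^ (Sum.elim 1 0 u : ℕ) : K) • w := by
  rcases u with s | s
  · change (d s ^ (p - 1)) ((x s ^ (p - 1)) w) = (((p - 1).factorial : K) ^ 1) • w
    change d s w = 0 at hw
    have h1 := h.d_x s s
    rw [if_pos rfl] at h1
    have h2 : ∀ k : ℕ, d s ((x s ^ k) w) = (k : K) • (x s ^ (k - 1)) w := by
      intro k
      induction k with
      | zero => simpa using hw
      | succ k ih =>
        rw [pow_succ', Module.End.mul_apply, ← Module.End.mul_apply, h1, LinearMap.add_apply,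
          Module.End.mul_apply, ih, map_smul, ← Module.End.mul_apply, ← pow_succ',
          Nat.add_sub_cancel, Module.End.one_apply, Nat.cast_succ, add_smul, one_smul]
        cases k with
        | zero => simp
        | succ k => rw [Nat.add_sub_cancel]
    rw [pow_one]
    induction p - 1 with
    | zero => simp
    | succ k ih =>
      rw [pow_succ, Module.End.mul_apply, h2, map_smul, Nat.add_sub_cancel, ih, smul_smul,
        Nat.factorial_succ, Nat.cast_mul]
  · change δ s (ξ s w) = ((p - 1).factorial ^ 0 : K) • w
    change δ s w = 0 at hw
    have h1 := h.δ_ξ s s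
    rw [if_pos rfl] at h1
    rw [← Module.End.mul_apply, h1, LinearMap.add_apply, LinearMap.neg_apply, Module.End.mul_apply,
      hw]
    simp

/-- The test vector is the matching product of top raising operators applied to the vacuum. The
leading term sends it to a nonzero multiple of `v`, whereas X minus its leading term sends it into
the first filtration step, where `ℓ` vanishes. -/
theorem HasTopLeading.ne_zero [Fact p.Prime] [CharP K p] {v : S} {ℓ : S →ₗ[K] K}
    (hd : ∀ s, d s v = 0) (hδ : ∀ s, δ s v = 0) (hv : ℓ v = 1) (hx : ∀ s w, ℓ (x s w) = 0)
    (hξ : ∀ s w, ℓ (ξ s w) = 0) {l : List (σ ⊕ σ)} (hl : l.Nodup) {X : Module.End K S}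
    (hX : HasTopLeading p x d ξ δ l X) : X ≠ 0 := by
  have hfac : ((p - 1).factorial : K) ≠ 0 := by
    have hp := (Fact.out : p.Prime)
    rw [Ne, CharP.cast_eq_zero_iff K p, hp.dvd_factorial]
    have := hp.pos
    omega
  -- Recursion from the end of the list, because the last operator acts first and must meet its own
  -- variable outermost.
  have key : ∀ l : List (σ ⊕ σ), l.Nodup → ∃ w c,
      w ∈ raiseFiltration x ξ (l.map (topDegree p)).sum ∧ c ≠ (0 : K) ∧
      (∀ u, u ∉ l → Sum.elim d δ u w = 0) ∧ (l.map (topLower p d δ)).prod w = c • v := by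
    intro l
    induction l using List.reverseRecOn with
    | nil =>
      refine fun _ => ⟨v, 1, Submodule.mem_top, one_ne_zero, fun u _ => ?_, by simp⟩
      rcases u with s | s
      exacts [hd s, hδ s]
    | append_singleton l u ih =>
      intro hl
      rw [List.nodup_append] at hl
      obtain ⟨w, c, h1, h2, h3, h4⟩ := ih hl.1
      have hu : u ∉ l := fun hu => hl.2.2 u hu u (List.mem_singleton.2 rfl) rfl
      refine ⟨topRaise p x ξ u w, _, ?_, mul_ne_zero (pow_ne_zero (Sum.elim 1 0 u : ℕ) hfac) h2,
        fun u' hu' => ?_, ?_⟩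
      · have := topRaise_mem_raiseFiltration (p := p) u h1
        simpa using this
      · simp only [List.mem_append, List.mem_singleton, not_or] at hu'
        exact sumElim_topRaise_apply h hu'.2 (h3 u' hu'.1)
      · rw [List.map_append, List.prod_append, List.map_singleton, List.prod_singleton,
          Module.End.mul_apply, topLower_topRaise_apply h u (h3 u hu), map_smul, h4, smul_smul]
  obtain ⟨ε, hε, hX⟩ := hX
  obtain ⟨w, c, h1, h2, -, h4⟩ := key l hl
  rintro rfl
  have h5 := (hX 0 w (by rwa [zero_add])).1
  have h6 : raiseFiltration x ξ 1 ≤ LinearMap.ker ℓ :=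
    raiseFiltration_succ_le (m := 0) (fun s w _ => hx s w) fun s w _ => hξ s w
  have h7 := h6 h5
  rw [LinearMap.mem_ker, zero_sub, LinearMap.neg_apply, LinearMap.smul_apply, h4, map_neg, map_smul,
    map_smul, hv] at h7
  simp [hε, h2] at h7

end Monomials

end QueerSuper

/-! ### Nonvanishing of the sandwich elements -/

namespace QueerSuper

section Index

variable {n : ℕ}

/-- The variables whose top derivations lead the product of the positive blocks. -/
def posIndex : List (Fin n × Fin n) → List (Fin n × Fin n ⊕ Fin n × Fin n)
  | [] => []
  | β :: L => [.inl β, .inr β] ++ posIndex L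

/-- The variables whose top derivations lead the product of the negative blocks. -/
def negIndex : List (Fin n × Fin n) → List (Fin n × Fin n ⊕ Fin n × Fin n)
  | [] => []
  | β :: L => negIndex L ++ [.inl β.swap, .inr β.swap]

theorem mem_posIndex {L : List (Fin n × Fin n)} {u : Fin n × Fin n ⊕ Fin n × Fin n} :
    u ∈ posIndex L ↔ u.elim id id ∈ L := by
  induction L with
  | nil => simp [posIndex]
  | cons β L ih => rcases u with u | u <;> simp [posIndex, ih]

theorem mem_negIndex {L : List (Fin n × Fin n)} {u : Fin n × Fin n ⊕ Fin n × Fin n} :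
    u ∈ negIndex L ↔ (u.elim id id).swap ∈ L := by
  induction L with
  | nil => simp [negIndex]
  | cons β L ih =>
    rcases u with u | u <;> simp [negIndex, ih, ← Prod.swap_eq_iff_eq_swap, or_comm]

theorem IsRootList.notMem {β : Fin n × Fin n} {L : List (Fin n × Fin n)}
    (hL : IsRootList (β :: L)) : β ∉ L := fun h => by
  rcases ((hL.2.2 β).1 h).2 with h | h
  exacts [lt_irrefl _ h, lt_irrefl _ h.2]

theorem nodup_posIndex {L : List (Fin n × Fin n)} (hL : IsRootList L) : (posIndex L).Nodup := by
  induction L with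
  | nil => simp [posIndex]
  | cons β L ih =>
    simp [posIndex, mem_posIndex, hL.notMem, ih hL.1]

theorem nodup_negIndex {L : List (Fin n × Fin n)} (hL : IsRootList L) : (negIndex L).Nodup := by
  induction L with
  | nil => simp [negIndex]
  | cons β L ih =>
    rw [negIndex, List.nodup_append_comm]
    simp [mem_negIndex, hL.notMem, ih hL.1]

/-- The variables indexed by the whole basis of `q(n)` without the odd Cartan elements. -/
theorem nodup_index {L : List (Fin n × Fin n)} (hL : IsRootList L)
    (hall : ∀ γ, γ ∈ L ↔ γ.1 < γ.2) {l : List (Fin n × Fin n ⊕ Fin n × Fin n)} (hl : l.Nodup)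
    (hdiag : ∀ u ∈ l, (u.elim id id).1 = (u.elim id id).2) :
    (negIndex L ++ (l ++ posIndex L)).Nodup := by
  rw [List.nodup_append', List.nodup_append']
  refine ⟨nodup_negIndex hL, ⟨hl, nodup_posIndex hL, fun u h1 h2 => ?_⟩, fun u h1 h2 => ?_⟩
  · rw [mem_posIndex, hall] at h2
    exact h2.ne (hdiag u h1)
  · rw [mem_negIndex, hall] at h1
    rcases List.mem_append.1 h2 with h2 | h2
    · exact h1.ne' (hdiag u h2)
    · rw [mem_posIndex, hall] at h2
      exact lt_asymm h1 h2

theorem map_posProd {R R' : Type*} [Ring R] [Ring R'] (F : R →+* R') {p : ℕ}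
    (ev od : Fin n → Fin n → R) (L : List (Fin n × Fin n)) :
    F (posProd p ev od L) = posProd p (fun i j => F (ev i j)) (fun i j => F (od i j)) L := by
  induction L with
  | nil => exact map_one F
  | cons β L ih => simp [posProd, block, ih]

theorem map_negProd {R R' : Type*} [Ring R] [Ring R'] (F : R →+* R') {p : ℕ}
    (ev od : Fin n → Fin n → R) (L : List (Fin n × Fin n)) :
    F (negProd p ev od L) = negProd p (fun i j => F (ev i j)) (fun i j => F (od i j)) L := by
  induction L with
  | nil => exact map_one F
  | cons β L ih => simp [negProd, block, ih]

theorem map_weightProj {K R R' : Type*} [Field K] [Ring R] [Ring R'] [Algebra K R] [Algebra K R']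
    (F : R →ₐ[K] R') {p : ℕ} (ev : Fin n → Fin n → R) (μ : Fin n → K) :
    F (weightProj p ev μ) = weightProj p (fun i j => F (ev i j)) μ := by
  rw [weightProj, map_list_prod, List.map_map]
  simp [weightProj, Function.comp_def]

end Index

section Leading

variable {K S : Type*} [Field K] [AddCommGroup S] [Module K S] {n p : ℕ}
  {x d ξ δ : Fin n × Fin n → Module.End K S}
  {ev od : Fin n → Fin n → Module.End K S} {L : List (Fin n × Fin n)}

variable (x d ξ δ) in
/-- The even family obtained from the Fock representation by shifting the even variables. -/
def fockEv (v : Fin n × Fin n → K) : Fin n → Fin n → Module.End K S :=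
  weylEv (fun s => x s + algebraMap K _ (if s.1 = s.2 then 1 else 0))
    (fun s => d s + algebraMap K _ (v s)) ξ δ

variable (x d ξ δ) in
/-- The odd family obtained from the Fock representation by shifting the even variables. -/
def fockOd (v : Fin n × Fin n → K) : Fin n → Fin n → Module.End K S :=
  weylOd (fun s => x s + algebraMap K _ (if s.1 = s.2 then 1 else 0))
    (fun s => d s + algebraMap K _ (v s)) ξ δ

section Weyl

variable (h : IsWeylClifford p (0 : Fin n × Fin n → K) 0 x d ξ δ) (v : Fin n × Fin n → K)
include h

/-- Translation of x to the identity matrix isolates `d (i, j)`. Every other term is a scalar, a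
multiple of a raising operator, or a raising operator after a lowering one, and so does not lower
the filtration. -/
theorem hasLeading_fockEv (i j : Fin n) :
    HasLeading x ξ 1 (fockEv x d ξ δ v i j) (d (i, j)) := by
  have e : fockEv x d ξ δ v i j = d (i, j) + (algebraMap K _ (v (i, j))
      + ∑ k, (x (k, i) * d (k, j) + algebraMap K _ (v (k, j)) * x (k, i) + ξ (k, i) * δ (k, j))) := by
    have : ∀ k, (x (k, i) + algebraMap K (Module.End K S) (if k = i then 1 else 0))
        * (d (k, j) + algebraMap K _ (v (k, j))) + ξ (k, i) * δ (k, j)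
        = (if k = i then d (k, j) + algebraMap K _ (v (k, j)) else 0)
          + (x (k, i) * d (k, j) + algebraMap K _ (v (k, j)) * x (k, i) + ξ (k, i) * δ (k, j)) := by
      intro k
      rw [Algebra.commutes (v (k, j)) (x (k, i))]
      split_ifs
      · rw [map_one]
        noncomm_ring
      · rw [map_zero]
        noncomm_ring
    rw [fockEv, weylEv, Finset.sum_congr rfl fun k _ => this k, Finset.sum_add_distrib,
      Finset.sum_ite_eq' Finset.univ i, if_pos (Finset.mem_univ i), add_assoc]
  rw [e]
  refine HasLeading.add_of_mem (HasLeading.of_mem fun m w hw => h.d_mem_raiseFiltration _ hw)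
    fun m w hw => ?_
  rw [LinearMap.add_apply, LinearMap.sum_apply]
  refine Submodule.add_mem _ (Submodule.smul_mem _ _ hw) (Submodule.sum_mem _ fun k _ => ?_)
  exact Submodule.add_mem _ (Submodule.add_mem _
    (x_mem_raiseFiltration (h.d_mem_raiseFiltration _ hw) _)
    (Submodule.smul_mem _ _ (x_mem_raiseFiltration (raiseFiltration_antitone (Nat.le_succ m) hw) _)))
    (ξ_mem_raiseFiltration (h.δ_mem_raiseFiltration _ hw) _)

theorem hasLeading_fockOd (i j : Fin n) :
    HasLeading x ξ 1 (fockOd x d ξ δ v i j) (δ (i, j)) := by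
  have e : fockOd x d ξ δ v i j = δ (i, j)
      + ∑ k, (x (k, i) * δ (k, j) + algebraMap K _ (v (k, j)) * ξ (k, i) + ξ (k, i) * d (k, j)) := by
    have : ∀ k, (x (k, i) + algebraMap K (Module.End K S) (if k = i then 1 else 0))
        * δ (k, j) + ξ (k, i) * (d (k, j) + algebraMap K _ (v (k, j)))
        = (if k = i then δ (k, j) else 0)
          + (x (k, i) * δ (k, j) + algebraMap K _ (v (k, j)) * ξ (k, i) + ξ (k, i) * d (k, j)) := by
      intro k
      rw [Algebra.commutes (v (k, j)) (ξ (k, i))]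
      split_ifs
      · rw [map_one]
        noncomm_ring
      · rw [map_zero]
        noncomm_ring
    rw [fockOd, weylOd, Finset.sum_congr rfl fun k _ => this k, Finset.sum_add_distrib,
      Finset.sum_ite_eq' Finset.univ i, if_pos (Finset.mem_univ i)]
  rw [e]
  refine HasLeading.add_of_mem (HasLeading.of_mem fun m w hw => h.δ_mem_raiseFiltration _ hw)
    fun m w hw => ?_
  rw [LinearMap.sum_apply]
  refine Submodule.sum_mem _ fun k _ => ?_
  exact Submodule.add_mem _ (Submodule.add_mem _
    (x_mem_raiseFiltration (h.δ_mem_raiseFiltration _ hw) _)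
    (Submodule.smul_mem _ _ (ξ_mem_raiseFiltration (raiseFiltration_antitone (Nat.le_succ m) hw) _)))
    (ξ_mem_raiseFiltration (h.d_mem_raiseFiltration _ hw) _)

end Weyl

variable (hev : ∀ i j, HasLeading x ξ 1 (ev i j) (d (i, j)))
  (hod : ∀ i j, HasLeading x ξ 1 (od i j) (δ (i, j)))

include hod in
theorem hasTopLeading_od (i j : Fin n) : HasTopLeading p x d ξ δ [.inr (i, j)] (od i j) :=
  ⟨1, one_ne_zero, by simpa [topDegree, topLower] using hod i j⟩

include hev hod in
theorem hasTopLeading_block (i j : Fin n) :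
    HasTopLeading p x d ξ δ [.inl (i, j), .inr (i, j)] (block p ev od i j) := by
  refine HasTopLeading.mul (l := [.inl (i, j)]) ⟨1, one_ne_zero, ?_⟩ (hasTopLeading_od hod i j)
  simpa [topDegree, topLower] using (hev i j).pow (p - 1)

include hev hod in
theorem hasTopLeading_posProd (L : List (Fin n × Fin n)) :
    HasTopLeading p x d ξ δ (posIndex L) (posProd p ev od L) := by
  induction L with
  | nil => exact HasTopLeading.one
  | cons β L ih => exact (hasTopLeading_block hev hod _ _).mul ih

include hev hod in
theorem hasTopLeading_negProd (L : List (Fin n × Fin n)) :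
    HasTopLeading p x d ξ δ (negIndex L) (negProd p ev od L) := by
  induction L with
  | nil => exact HasTopLeading.one
  | cons β L ih => exact ih.mul (hasTopLeading_block hev hod _ _)

include hev in
theorem hasTopLeading_weightProj (hp : 2 ≤ p) (μ : Fin n → K) :
    HasTopLeading p x d ξ δ ((List.finRange n).map fun i => .inl (i, i)) (weightProj p ev μ) := by
  rw [weightProj]
  generalize List.finRange n = l
  induction l with
  | nil => exact HasTopLeading.one
  | cons i l ih =>
    refine HasTopLeading.mul (l := [.inl (i, i)]) ⟨-1, neg_ne_zero.2 one_ne_zero, ?_⟩ ih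
    have h1 : HasLeading x ξ 1 (ev i i - algebraMap K _ (μ i)) (d (i, i)) := by
      rw [sub_eq_add_neg]
      exact (hev i i).add_of_mem fun m w hw => Submodule.neg_mem _ (Submodule.smul_mem _ _ hw)
    -- The constant 1 is of lower order than the power because p - 1 ≥ 1, so 1 - y ^ (p - 1) has
    -- leading term -d ^ (p - 1).
    have h2 := ((h1.pow (p - 1)).neg).add_of_mem (Y := 1) fun m w hw =>
      raiseFiltration_antitone (by omega) hw
    rw [neg_add_eq_sub, mul_one] at h2
    simpa [topDegree, topLower] using h2

end Leading

section Nonvanishing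

universe u

variable {K : Type u} [Field K] {n p : ℕ} [Fact p.Prime] [CharP K p]

/-- The leading terms involve the even derivations of all matrix units, the odd ones off the
diagonal and, in the second case, one odd diagonal derivation. Each variable occurs once, so the
Fock image is nonzero. -/
theorem negProd_weightProj_posProd_ne_zero (χ : Module.Dual K (queerPart K n 0)) {ev od : Fin n → Fin n →
    ReducedEnvelope p χ}
    (hev : ∀ i j, ev i j = redι p χ (evenElt K n (Matrix.single i j 1)))
    (hod : ∀ i j, od i j = redι p χ (oddElt K n (Matrix.single i j 1)))
    {L : List (Fin n × Fin n)} (hL : IsRootList L) (hall : ∀ γ, γ ∈ L ↔ γ.1 < γ.2) (μ : Fin n → K) :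
    negProd p ev od L * weightProj p ev μ * posProd p ev od L ≠ 0 ∧
      ∀ i, negProd p ev od L * weightProj p ev μ * (od i i * posProd p ev od L) ≠ 0 := by
  have hp := (Fact.out : p.Prime)
  obtain ⟨S, _, _, x, d, ξ, δ, v, ℓ, h, hd, hδ, hv, hx, hξ⟩ :=
    exists_isWeylClifford (K := K) (σ := Fin n × Fin n) p
  have : Nontrivial S := ⟨v, 0, fun e => by simp [e] at hv⟩
  have : CharP (Module.End K S) p :=
    charP_of_injective_algebraMap (algebraMap K (Module.End K S)).injective p
  let b : Fin n × Fin n → K := fun s => χ (ofGL (Matrix.single s.1 s.2 1))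
  -- The even variables are translated to the identity matrix, so that only k = i survives in
  -- `weylEv_pow`; the derivations are shifted by the values of χ, which gives the p-character.
  have h' := h.shift (fun s => if s.1 = s.2 then 1 else 0) b
  obtain ⟨F, hF0, hF1⟩ := exists_algHom χ (weylEv_weylEv h') (weylEv_weylOd h') (weylOd_weylOd h')
    (fun i j => by
      have := weylEv_pow h' (fun k i => by
        by_cases hk : k = i <;> simp [hk, hp.ne_zero]) i j
      simpa [b] using this)
  have hFev : (fun i j => F (ev i j)) = fockEv x d ξ δ b :=
    funext₂ fun i j => by rw [hev, hF0]; rfl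
  have hFod : (fun i j => F (od i j)) = fockOd x d ξ δ b :=
    funext₂ fun i j => by rw [hod, hF1]; rfl
  have hpos : F (posProd p ev od L) = posProd p (fockEv x d ξ δ b) (fockOd x d ξ δ b) L := by
    rw [← hFev, ← hFod]
    exact map_posProd F.toRingHom ev od L
  have hneg : F (negProd p ev od L) = negProd p (fockEv x d ξ δ b) (fockOd x d ξ δ b) L := by
    rw [← hFev, ← hFod]
    exact map_negProd F.toRingHom ev od L
  have hproj : F (weightProj p ev μ) = weightProj p (fockEv x d ξ δ b) μ := by
    rw [← hFev]
    exact map_weightProj F ev μ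
  have lev := hasLeading_fockEv h b
  have lod := hasLeading_fockOd h b
  have tneg := hasTopLeading_negProd (p := p) lev lod L
  have tpos := hasTopLeading_posProd (p := p) lev lod L
  have tproj := hasTopLeading_weightProj (δ := δ) lev hp.two_le μ
  have hinj : ((List.finRange n).map fun i => (.inl (i, i) : Fin n × Fin n ⊕ Fin n × Fin n)).Nodup :=
    (List.nodup_finRange n).map fun i j e => (Prod.mk.inj (Sum.inl_injective e)).1
  refine ⟨fun e => ?_, fun i e => ?_⟩
  · refine ((tneg.mul (tproj.mul tpos)).ne_zero h hd hδ hv hx hξ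
      (nodup_index hL hall hinj ?_)) ?_
    · intro u hu
      obtain ⟨i, -, rfl⟩ := List.mem_map.1 hu
      rfl
    · rw [← hpos, ← hneg, ← hproj, ← map_mul, ← map_mul, ← mul_assoc, e, map_zero]
  · have hF : F (od i i) = fockOd x d ξ δ b i i := congrFun (congrFun hFod i) i
    refine ((tneg.mul ((tproj.mul (hasTopLeading_od lod i i)).mul tpos)).ne_zero h hd hδ hv hx hξ
      (nodup_index hL hall ?_ ?_)) ?_
    · refine List.nodup_append'.2 ⟨hinj, List.nodup_singleton _, fun u h1 h2 => ?_⟩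
      obtain ⟨i, -, rfl⟩ := List.mem_map.1 h1
      simp at h2
    · intro u hu
      rcases List.mem_append.1 hu with hu | hu
      · obtain ⟨i, -, rfl⟩ := List.mem_map.1 hu
        rfl
      · rw [List.mem_singleton.1 hu]
        rfl
    · rw [← hpos, ← hneg, ← hproj, ← hF, ← map_mul, ← map_mul, ← map_mul, mul_assoc, ← mul_assoc, e,
        map_zero]

end Nonvanishing

end QueerSuper

/-! ### Conclusion for the reduced enveloping superalgebra -/

namespace QueerSuper

section UnitFamily

variable {K : Type*} [Field K] {n : ℕ} (p : ℕ) (χ : Module.Dual K (queerPart K n 0))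

/-- The images of the even matrix units in `U_χ(q(n))`. -/
def unitEv (i j : Fin n) : ReducedEnvelope p χ := redι p χ (evenElt K n (Matrix.single i j 1))

/-- The images of the odd matrix units in `U_χ(q(n))`. -/
def unitOd (i j : Fin n) : ReducedEnvelope p χ := redι p χ (oddElt K n (Matrix.single i j 1))

theorem single_mul_single_one (i j k l : Fin n) :
    Matrix.single i j (1 : K) * Matrix.single k l 1 = if j = k then Matrix.single i l 1 else 0 := by
  split_ifs with h
  · subst h
    rw [Matrix.single_mul_single_same, one_mul]
  · rw [Matrix.single_mul_single_of_ne _ _ _ _ h]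

theorem unitEv_pow (i j : Fin n) : unitEv p χ i j ^ p
    = redι p χ (evenElt K n (Matrix.single i j 1 ^ p))
      + algebraMap K _ (χ (ofGL (Matrix.single i j 1)) ^ p) := by
  rw [← evenElt_pow]
  exact redι_pow p χ (ofGL (Matrix.single i j 1))

theorem isQueerFamily_unit [Fact p.Prime] [CharP K p] (hp : 2 < p)
    (hχ : ∀ i j, i ≠ j → χ (ofGL (Matrix.single i j 1)) = 0) :
    IsQueerFamily p (unitEv p χ) (unitOd p χ) := by
  have hp' := (Fact.out : p.Prime)
  have h2 : (2 : K) ≠ 0 := by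
    intro h
    have := (CharP.cast_eq_zero_iff K p 2).1 (by exact_mod_cast h)
    exact absurd (Nat.le_of_dvd two_pos this) (by omega)
  have hodd : ∀ i j k l, unitOd p χ i j * unitOd p χ k l = -(unitOd p χ k l * unitOd p χ i j)
      + ((if j = k then unitEv p χ i l else 0) + if l = i then unitEv p χ k j else 0) := by
    intro i j k l
    have := redι_bracket p χ (oddElt_mem (Matrix.single i j (1 : K))) (oddElt_mem (Matrix.single k l 1))
    rw [superBracket, oddElt_mul_oddElt, oddElt_mul_oddElt, single_mul_single_one,
      single_mul_single_one, show sign K 1 1 = -1 by simp [sign, ZMod.val_one], neg_smul, one_smul,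
      neg_smul, one_smul, sub_neg_eq_add, map_add] at this
    rw [unitOd, unitOd, this]
    split_ifs <;> simp [unitEv]
  -- The superbracket of an odd element with itself is twice its square, so the squares are obtained
  -- by dividing by 2.
  have hhalf : ∀ z z' : ReducedEnvelope p χ, z = -z + (z' + z') → z = z' := by
    intro z z' h
    have h3 : (2 : K) • (z - z') = 0 := by
      rw [two_smul]
      nth_rewrite 1 [h]
      abel
    exact sub_eq_zero.1 ((smul_eq_zero.1 h3).resolve_left h2)
  refine ⟨fun i j k l => ?_, fun i j k l => ?_, hodd, fun i j hij => ?_, fun i => ?_,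
    fun i j hij => ?_⟩
  · have := redι_bracket p χ (evenElt_mem (Matrix.single i j (1 : K)))
      (evenElt_mem (Matrix.single k l 1))
    rw [superBracket, evenElt_mul_evenElt, evenElt_mul_evenElt, single_mul_single_one,
      single_mul_single_one, show sign K 0 0 = 1 by simp [sign], one_smul, one_smul, map_sub] at this
    rw [unitEv, unitEv, this]
    split_ifs <;> simp [unitEv]
  · have := redι_bracket p χ (evenElt_mem (Matrix.single i j (1 : K)))
      (oddElt_mem (Matrix.single k l 1))
    rw [superBracket, evenElt_mul_oddElt, oddElt_mul_evenElt, single_mul_single_one,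
      single_mul_single_one, show sign K 0 1 = 1 by simp [sign], one_smul, one_smul, map_sub] at this
    rw [unitEv, unitOd, this]
    split_ifs <;> simp [unitOd]
  · refine hhalf _ _ ?_
    have := hodd i j i j
    rwa [if_neg hij.symm] at this
  · refine hhalf _ _ ?_
    have := hodd i i i i
    rwa [if_pos rfl] at this
  · rw [unitEv_pow, hχ i j hij, zero_pow hp'.ne_zero, map_zero, add_zero,
      pow_eq_zero_of_le hp'.two_le (by rw [pow_two, single_mul_single_one, if_neg hij.symm]),
      map_zero, map_zero]

theorem unitEv_diag_pow (hp : p ≠ 0) (i : Fin n) :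
    unitEv p χ i i ^ p = unitEv p χ i i + algebraMap K _ (χ (h i) ^ p) := by
  have : ∀ m : ℕ, Matrix.single i i (1 : K) ^ (m + 1) = Matrix.single i i 1 := by
    intro m
    induction m with
    | zero => rw [zero_add, pow_one]
    | succ m ih => rw [pow_succ, ih, single_mul_single_one, if_pos rfl]
  obtain ⟨m, rfl⟩ := Nat.exists_eq_succ_of_ne_zero hp
  rw [unitEv_pow, this]
  rfl

theorem redι_mem_adjoin_unit (X : queer K n) :
    redι p χ X ∈ Algebra.adjoin K {r | ∃ i j, r = unitEv p χ i j ∨ r = unitOd p χ i j} := by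
  obtain ⟨A, B, rfl⟩ := queer_eq_add X
  rw [map_add]
  refine Subalgebra.add_mem _ ?_ ?_
  · induction A using Matrix.induction_on' with
    | h_zero => simp only [map_zero, Subalgebra.zero_mem]
    | h_add A A' h h' =>
      rw [map_add, map_add]
      exact Subalgebra.add_mem _ h h'
    | h_std_basis i j c =>
      rw [← mul_one c, ← smul_eq_mul, ← Matrix.smul_single, map_smul, map_smul]
      refine Subalgebra.smul_mem _ (Algebra.subset_adjoin ?_) c
      exact ⟨i, j, Or.inl rfl⟩
  · induction B using Matrix.induction_on' with
    | h_zero => simp only [map_zero, Subalgebra.zero_mem]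
    | h_add A A' h h' =>
      rw [map_add, map_add]
      exact Subalgebra.add_mem _ h h'
    | h_std_basis i j c =>
      rw [← mul_one c, ← smul_eq_mul, ← Matrix.smul_single, map_smul, map_smul]
      refine Subalgebra.smul_mem _ (Algebra.subset_adjoin ?_) c
      exact ⟨i, j, Or.inr rfl⟩

theorem adjoin_unit_eq_top :
    Algebra.adjoin K {r | ∃ i j, r = unitEv p χ i j ∨ r = unitOd p χ i j} = ⊤ := by
  refine (Algebra.eq_top_iff).2 fun u => ?_
  obtain ⟨u, rfl⟩ := RingQuot.mkAlgHom_surjective K (ReducedRel p χ) u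
  obtain ⟨u, rfl⟩ := RingQuot.mkAlgHom_surjective K (EnvelopeRel K n) u
  change redMk p χ (envMk K n u) ∈ _
  induction u using TensorAlgebra.induction with
  | algebraMap r =>
    rw [AlgHom.commutes, AlgHom.commutes]
    exact Subalgebra.algebraMap_mem _ r
  | ι X => exact redι_mem_adjoin_unit p χ X
  | mul u v hu hv =>
    rw [map_mul, map_mul]
    exact Subalgebra.mul_mem _ hu hv
  | add u v hu hv =>
    rw [map_add, map_add]
    exact Subalgebra.add_mem _ hu hv

end UnitFamily

theorem weightScalar_eq_zero_of_mem {K : Type*} [Field K] {n p : ℕ} {μ : Fin n → K}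
    {L : List (Fin n × Fin n)} {β : Fin n × Fin n} (hβ : β ∈ L)
    (h0 : rootScalar p (μ β.1) (μ β.2) = 0) : weightScalar p μ L = 0 :=
  List.prod_eq_zero (h0 ▸ List.mem_map_of_mem hβ)

/-- If two of the values `c i` agree up to sign, some weight makes a root scalar vanish. -/
theorem exists_weightScalar_eq_zero {K : Type*} [Field K] [IsAlgClosed K] {n p : ℕ} [Fact p.Prime]
    [CharP K p] {c : Fin n → K} {L : List (Fin n × Fin n)} (hall : ∀ γ, γ ∈ L ↔ γ.1 < γ.2)
    (hp2 : 2 < p) {i j : Fin n} (hij : i < j) (hc : c i = c j ∨ c i = -c j) :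
    ∃ μ : Fin n → K, (∀ k, μ k ^ p - μ k = c k ^ p) ∧ weightScalar p μ L = 0 := by
  have hp := (Fact.out : p.Prime)
  choose a ha using fun k => exists_pow_sub_eq hp.one_lt (c k ^ p)
  obtain ⟨b, hb, h0⟩ : ∃ b : K, b ^ p - b = c i ^ p ∧ rootScalar p b (a j) = 0 := by
    rcases hc with hc | hc
    -- Adding 1 gives another root of the same Artin-Schreier equation and makes the factor with k =
    -- 0 vanish.
    · refine ⟨a j + 1, ?_, ?_⟩
      · rw [add_pow_char, one_pow, hc, ← ha j]
        ring
      · rw [rootScalar, Finset.prod_eq_zero (i := 0) (Finset.mem_range.2 (by omega)) (by simp),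
          mul_zero, zero_mul]
    -- Since p is odd, negation maps roots for `c j` to roots for -c j, and the factor a + b
    -- vanishes.
    · refine ⟨-a j, ?_, ?_⟩
      · have hodd := hp.odd_of_ne_two hp2.ne'
        rw [hodd.neg_pow, hc, hodd.neg_pow, ← ha j]
        ring
      · rw [rootScalar, neg_add_cancel, mul_zero]
  refine ⟨Function.update a i b, fun k => ?_, weightScalar_eq_zero_of_mem ((hall (i, j)).2 hij) ?_⟩
  · by_cases hk : k = i
    · subst hk
      rwa [Function.update_self]
    · rw [Function.update_of_ne hk, ha]
  · rwa [Function.update_self, Function.update_of_ne hij.ne']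

/-- The reduced enveloping superalgebra of `q(n)` of a `p`-character in diagonal form is semisimple
if and only if the `p`-character is regular. -/
theorem isSemisimpleSuperalgebra_parity_iff {K : Type*} [Field K] [IsAlgClosed K] {p : ℕ}
    [Fact p.Prime] [CharP K p] (hp : 2 < p) {n : ℕ} {χ : Module.Dual K (queerPart K n 0)}
    (hplus : VanishesOnNPlus χ) (hminus : VanishesOnNMinus χ) :
    IsSemisimpleSuperalgebra (parity p χ) ↔ (∀ i : Fin n, χ (h i) ≠ 0) ∧
      ∀ i j : Fin n, i ≠ j → χ (h i) ≠ χ (h j) ∧ χ (h i) ≠ -χ (h j) := by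
  have hp' := (Fact.out : p.Prime)
  have hχ : ∀ i j, i ≠ j → χ (ofGL (Matrix.single i j 1)) = 0 := by
    intro i j hij
    rcases lt_or_gt_of_ne hij with h | h
    · refine hplus _ fun k l hkl => Matrix.single_apply_of_ne _ _ _ _ _ ?_
      rintro ⟨rfl, rfl⟩
      exact absurd hkl (not_le.2 h)
    · refine hminus _ fun k l hkl => Matrix.single_apply_of_ne _ _ _ _ _ ?_
      rintro ⟨rfl, rfl⟩
      exact absurd hkl (not_le.2 h)
  have H := isQueerFamily_unit p χ hp hχ
  have hgen := adjoin_unit_eq_top p χ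
  have hdiag := unitEv_diag_pow p χ hp'.ne_zero
  have hev : ∀ i j, unitEv p χ i j ∈ parity p χ 0 := fun i j => redι_mem p χ (evenElt_mem _)
  have hod : ∀ i j, unitOd p χ i j ∈ parity p χ 1 := fun i j => redι_mem p χ (oddElt_mem _)
  obtain ⟨L, hL, hall⟩ := exists_isRootList n
  constructor
  · intro hsemi
    have hne := negProd_weightProj_posProd_ne_zero χ (ev := unitEv p χ) (od := unitOd p χ)
      (fun _ _ => rfl) (fun _ _ => rfl) hL hall
    have hpair : ∀ i j : Fin n, i < j → ¬ (χ (h i) = χ (h j) ∨ χ (h i) = -χ (h j)) := by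
      intro i j hij hc
      obtain ⟨μ, hμ, h0⟩ := exists_weightScalar_eq_zero (c := fun i => χ (h i)) hall hp hij hc
      exact (hne μ).1
        (negProd_weightProj_posProd_eq_zero hsemi hev hod H hgen hdiag hμ hL hall h0)
    refine ⟨fun i hi => ?_, fun i j hij => ?_⟩
    -- When χ(h i) = 0 the value 0 is an admissible i-th coordinate of a weight.
    · choose a ha using fun k => exists_pow_sub_eq hp'.one_lt (χ (h k) ^ p)
      refine (hne (Function.update a i 0)).2 i
        (negProd_weightProj_od_posProd_eq_zero hsemi hev hod H hgen hdiag (fun k => ?_) hL hall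
          (Function.update_self ..))
      by_cases hk : k = i
      · subst hk
        rw [Function.update_self, hi, sub_zero]
      · rw [Function.update_of_ne hk, ha]
    · rw [← not_or]
      rcases lt_or_gt_of_ne hij with h1 | h1
      · exact hpair i j h1
      · refine fun hc => hpair j i h1 (hc.imp Eq.symm fun e => ?_)
        rw [e, neg_neg]
  · rintro ⟨hc0, hc⟩ I hI
    -- An ungraded complement is enough, since it can be replaced by a graded one.
    obtain ⟨J, hIJ⟩ := exists_isCompl_of_regular (c := fun i => χ (h i)) hp H hgen hdiag hc0 hc I
    exact exists_homogeneous_isCompl (parity p χ) hI hIJ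

end QueerSuper

end

theorem theoremB {K : Type*} [Field K] [IsAlgClosed K] (p : ℕ) [Fact p.Prime] [CharP K p]
    (hp : 2 < p) (n : ℕ) (χ : Module.Dual K (QueerSuper.queerPart K n 0))
    (hss : QueerSuper.IsSemisimpleCharacter χ)
    (hplus : QueerSuper.VanishesOnNPlus χ) (hminus : QueerSuper.VanishesOnNMinus χ) :
    QueerSuper.IsSemisimpleSuperalgebra (QueerSuper.parity p χ) ↔
      (∀ i : Fin n, χ (QueerSuper.h i) ≠ 0) ∧
        ∀ i j : Fin n, i ≠ j →
          χ (QueerSuper.h i) ≠ χ (QueerSuper.h j) ∧ χ (QueerSuper.h i) ≠ -χ (QueerSuper.h j) :=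
  QueerSuper.isSemisimpleSuperalgebra_parity_iff hp hplus hminus
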